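/- Theorem 1 (Main Result 1). Let $d\in\mathbb N$, $0<m\le d$ (real), $0<\tau\le 1$, $0<C_{CZ}<\infty$, and $A\in\mathbb R$. There is a constant $C=C(A,m,d,\tau,C_{CZ})$ with the following property. Let $X\subset\mathbb R^d$ and let $k$ be a real- or complex-valued Calderón–Zygmund kernel of order $m$ on $X$, that is, for all $x,x',y\in X$ with $x\neq y$, $$|k(x,y)|\le \frac{C_{CZ}}{|x-y|^m},\qquad |k(y,x)-k(y,x')|+|k(x,y)-k(x',y)|\le C_{CZ}\frac{|x-x'|^\tau}{|x-y|^{m+\tau}}\ \text{ if } |x-x'|\le\tfrac12|x-y|.$$ Let $\mu$ be a Borel probability measure on $\mathbb R^d$ with compact support contained in $X$, and let $H\subset\mathbb R^d$ be an open set that contains every ball $B(x,r)$ ($x\in\mathbb R^d$, $r>0$) with $\mu(B(x,r))>r^m$. With $d(x):=\operatorname{dist}(x,\mathbb R^d\setminus H)\in[0,\infty]$ (and $\operatorname{dist}(x,\emptyset)=\infty$), suppose that $$|k(x,y)|\le\frac1{\max(d(x)^m,d(y)^m)}\qquad\text{for all }x,y\in X .$$ Let $T=T_{\mu,m}$ be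 a bounded operator on $L^2(\mathbb R^d;\mu)$ which is a Calderón–Zygmund operator with kernel $k$, i.e. for every $f\in L^2(\mathbb R^d;\mu)$, $Tf(x)=\int k(x,y)f(y)\,d\mu(y)$ for $\mu$-almost every $x\notin\operatorname{supp}f$ (for instance, the integral operator $Tf(x)=\int k(x,y)f(y)\,d\mu(y)$ when $k$ is a bounded measurable kernel). Let $T^*$ be its transpose, which has kernel $k(y,x)$. If for all axis-parallel cubes $Q\subset\mathbb R^d$ $$\|T\chi_Q\|_{L^2(\mathbb R^d;\mu)}^2\le A\,\mu(Q),\qquad \|T^*\chi_Q\|_{L^2(\mathbb R^d;\mu)}^2\le A\,\mu(Q),$$ then $\|T\|_{L^2(\mathbb R^d;\mu)\to L^2(\mathbb R^d;\mu)}\le C(A,m,d,\tau,C_{CZ})$. -/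

import Mathlib

/-!
Fix a fine dyadic grid on a cube around the support of `μ`, shift the dyadic cubes above it at
random and approximate by step functions. Then the theorem becomes an estimate, uniform in the
grid, for a bilinear form on functions on a finite tree of cells.

Let `δ` be the distance to the complement of `H`. The part `|x - y| ≲ max (δ x) (δ y)` of the
kernel is dominated by `max (δ x) (δ y) ^ (-m)`, and the balls of radius above `δ x` around `x`
have growth of order `m`, so Schur's test bounds it. A smooth cutoff leaves a kernel that decays
like `(|x - y| + δ x + δ y) ^ (-m)`: it behaves like a kernel for a measure with growth on all
scales.

Following Nazarov, Treil and Volberg, call a cell bad if it is close to the boundary of a much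
larger cell. On functions whose martingale differences live on good cells, the form is bounded by
the `T1` argument: well-separated or deeply nested cells decouple, cells of comparable size are
handled by testing, and the remaining paraproduct by testing and the Carleson embedding theorem.
Each cell is bad with small probability, so for some shift the bad parts of two given functions
are small in `L²`; their contribution is at most `‖T‖ / 2` and is absorbed.
-/

open MeasureTheory Metric Set
open scoped ENNReal

/-- `k` is a Calderón–Zygmund kernel of order `m` on `X` with constants `C` and `τ`. Only the
values of `k` on `X × X` matter; nothing is asked on the diagonal, where the bounds read `∞`. -/
structure IsCZKernel {d : ℕ} {𝕜 : Type*} [RCLike 𝕜] (X : Set (EuclideanSpace ℝ (Fin d)))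
    (m C τ : ℝ) (k : EuclideanSpace ℝ (Fin d) → EuclideanSpace ℝ (Fin d) → 𝕜) : Prop where
  size : ∀ x ∈ X, ∀ y ∈ X, x ≠ y → ‖k x y‖ ≤ C / dist x y ^ m
  smooth : ∀ x ∈ X, ∀ x' ∈ X, ∀ y ∈ X, x ≠ y → dist x x' ≤ 1 / 2 * dist x y →
    ‖k y x - k y x'‖ + ‖k x y - k x' y‖ ≤ C * (dist x x' ^ τ / dist x y ^ (m + τ))

/-- All balls `B(x,r)` with `μ (B(x,r)) > r ^ m` (the non-Ahlfors balls) lie in `H`. -/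
def NonAhlforsBallsIn {d : ℕ} (μ : Measure (EuclideanSpace ℝ (Fin d))) (m : ℝ)
    (H : Set (EuclideanSpace ℝ (Fin d))) : Prop :=
  ∀ (x : EuclideanSpace ℝ (Fin d)) (r : ℝ), 0 < r →
    ENNReal.ofReal (r ^ m) < μ (ball x r) → ball x r ⊆ H

/-- The Bergman-type bound `|k(x,y)| ≤ 1 / max (d(x)^m, d(y)^m)` on `X`, where `d` is the distance
to the complement of `H`. Everything is computed in `[0,∞]`, so that the bound is void where
`d(x) = d(y) = 0`, and `d = ∞` when `H` is the whole space. -/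
def HasBergmanBound {d : ℕ} {𝕜 : Type*} [RCLike 𝕜] (X H : Set (EuclideanSpace ℝ (Fin d)))
    (m : ℝ) (k : EuclideanSpace ℝ (Fin d) → EuclideanSpace ℝ (Fin d) → 𝕜) : Prop :=
  ∀ x ∈ X, ∀ y ∈ X, ‖k x y‖ₑ ≤ 1 / max (infEDist x Hᶜ ^ m) (infEDist y Hᶜ ^ m)

/-- The essential support of `f` with respect to `μ`: the complement of the largest open set on
which `f = 0` almost everywhere. -/
def essSupport {d : ℕ} {𝕜 : Type*} [RCLike 𝕜] (μ : Measure (EuclideanSpace ℝ (Fin d)))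
    (f : EuclideanSpace ℝ (Fin d) → 𝕜) : Set (EuclideanSpace ℝ (Fin d)) :=
  (μ.restrict {x | f x ≠ 0}).support

/-- The bounded operator `T` on `L²(μ)` is a Calderón–Zygmund operator with kernel `k`:
`T f (x) = ∫ k(x,y) f(y) dμ(y)` for (almost) all `x` outside the support of `f`. -/
def IsCZOperator {d : ℕ} {𝕜 : Type*} [RCLike 𝕜] (μ : Measure (EuclideanSpace ℝ (Fin d)))
    (k : EuclideanSpace ℝ (Fin d) → EuclideanSpace ℝ (Fin d) → 𝕜)
    (T : Lp 𝕜 2 μ →L[𝕜] Lp 𝕜 2 μ) : Prop :=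
  ∀ f : Lp 𝕜 2 μ, ∀ᵐ x ∂μ, x ∉ essSupport μ f → T f x = ∫ y, k x y * f y ∂μ

/-- The half-open axis-parallel cube with corner `a` and side length `l`. -/
def cube {d : ℕ} (a : EuclideanSpace ℝ (Fin d)) (l : ℝ) : Set (EuclideanSpace ℝ (Fin d)) :=
  {x | ∀ i, x i ∈ Ico (a i) (a i + l)}

theorem measurableSet_cube {d : ℕ} (a : EuclideanSpace ℝ (Fin d)) (l : ℝ) :
    MeasurableSet (cube a l) := by
  have h : cube a l = ⋂ i, (fun x : EuclideanSpace ℝ (Fin d) => x i) ⁻¹' Ico (a i) (a i + l) := by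
    ext x
    simp [cube]
  rw [h]
  exact MeasurableSet.iInter fun i =>
    (by fun_prop : Measurable fun x : EuclideanSpace ℝ (Fin d) => x i) measurableSet_Ico

/-- The indicator function of a cube as an element of `L²(μ)`. -/
noncomputable def cubeIndicator {d : ℕ} (𝕜 : Type*) [RCLike 𝕜]
    (μ : Measure (EuclideanSpace ℝ (Fin d))) [IsFiniteMeasure μ]
    (a : EuclideanSpace ℝ (Fin d)) (l : ℝ) : Lp 𝕜 2 μ :=
  indicatorConstLp 2 (measurableSet_cube a l) (measure_ne_top μ (cube a l)) (1 : 𝕜)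

/-- The testing condition `‖T χ_Q‖² ≤ A μ(Q)` for all cubes `Q`. -/
def T1Condition {d : ℕ} {𝕜 : Type*} [RCLike 𝕜] (μ : Measure (EuclideanSpace ℝ (Fin d)))
    [IsFiniteMeasure μ] (A : ℝ) (T : Lp 𝕜 2 μ →L[𝕜] Lp 𝕜 2 μ) : Prop :=
  ∀ (a : EuclideanSpace ℝ (Fin d)) (l : ℝ), 0 < l →
    ‖T (cubeIndicator 𝕜 μ a l)‖ ^ 2 ≤ A * μ.real (cube a l)

section CellAverages

variable {P ι 𝕜 : Type*} [Fintype P] [DecidableEq ι] [RCLike 𝕜]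

/-- The total weight of the cell `{q | c q = c p}` of `p`. Partitions of a finite set `P` into cells
are encoded by labellings `c : P → ι`, and constancy on the cells is `Function.FactorsThrough`. -/
noncomputable def cellMass (w : P → ℝ) (c : P → ι) (p : P) : ℝ := ∑ q with c q = c p, w q

/-- The conditional expectation onto the functions that are constant on the cells of `c`: the
average of `f` over the cell of `p` with respect to the weights `w`. -/
noncomputable def cellAvg (w : P → ℝ) (c : P → ι) : (P → 𝕜) →ₗ[𝕜] (P → 𝕜) where
  toFun f p := ((cellMass w c p : ℝ) : 𝕜)⁻¹ * ∑ q with c q = c p, (w q : 𝕜) * f q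
  map_add' f g := by
    ext p
    simp [mul_add, Finset.sum_add_distrib]
  map_smul' r f := by
    ext p
    simp only [Pi.smul_apply, smul_eq_mul, RingHom.id_apply, Finset.mul_sum]
    exact Finset.sum_congr rfl fun q _ => by ring

/-- The squared weighted `ℓ²` norm. -/
noncomputable def normSq (w : P → ℝ) (f : P → 𝕜) : ℝ := ∑ p, w p * ‖f p‖ ^ 2

variable {w : P → ℝ} {c c' : P → ι}

theorem cellAvg_apply (f : P → 𝕜) (p : P) :
    cellAvg w c f p = ((cellMass w c p : ℝ) : 𝕜)⁻¹ * ∑ q with c q = c p, (w q : 𝕜) * f q := rfl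

theorem cellAvg_real_apply (f : P → ℝ) (p : P) :
    cellAvg w c f p = (cellMass w c p)⁻¹ * ∑ q with c q = c p, w q * f q := rfl

theorem cellMass_pos (hw : ∀ p, 0 < w p) (p : P) : 0 < cellMass w c p :=
  Finset.sum_pos (fun q _ => hw q) ⟨p, by simp⟩

theorem cellMass_ne_zero (hw : ∀ p, 0 < w p) (p : P) : ((cellMass w c p : ℝ) : 𝕜) ≠ 0 :=
  RCLike.ofReal_ne_zero.mpr (cellMass_pos hw p).ne'

theorem cellMass_factorsThrough : (cellMass w c).FactorsThrough c := fun p q h => by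
  simp only [cellMass, h]

theorem cellAvg_factorsThrough (f : P → 𝕜) : (cellAvg w c f).FactorsThrough c := fun p q h => by
  simp only [cellAvg_apply, cellMass, h]

theorem cellAvg_mul_of_factorsThrough (f : P → 𝕜) {g : P → 𝕜} (hg : g.FactorsThrough c) :
    cellAvg w c (g * f) = g * cellAvg w c f := by
  ext p
  rw [Pi.mul_apply, cellAvg_apply, cellAvg_apply, mul_left_comm, Finset.mul_sum (a := g p)]
  congr 1
  refine Finset.sum_congr rfl fun q hq => ?_
  rw [Pi.mul_apply, hg (by simpa using hq : c q = c p)]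
  ring

theorem cellAvg_one (hw : ∀ p, 0 < w p) : cellAvg w c (1 : P → 𝕜) = 1 := by
  ext p
  rw [cellAvg_apply, Pi.one_apply, inv_mul_eq_one₀ (cellMass_ne_zero hw p), cellMass]
  push_cast
  simp only [Pi.one_apply, mul_one]

theorem cellAvg_of_factorsThrough (hw : ∀ p, 0 < w p) {g : P → 𝕜} (hg : g.FactorsThrough c) :
    cellAvg w c g = g := by
  simpa only [mul_one, cellAvg_one hw] using cellAvg_mul_of_factorsThrough (w := w) 1 hg

theorem cellAvg_star (f : P → 𝕜) : cellAvg w c (star f) = star (cellAvg w c f) := by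
  ext p
  simp [cellAvg_apply, star_sum, star_mul']

theorem sum_cellAvg_mul (hw : ∀ p, 0 < w p) (f : P → 𝕜) {g : P → 𝕜} (hg : g.FactorsThrough c) :
    ∑ p, (w p : 𝕜) * cellAvg w c f p * g p = ∑ p, (w p : 𝕜) * f p * g p := by
  have expand : ∀ p, (w p : 𝕜) * cellAvg w c f p * g p = ∑ q, if c q = c p then
      (w q : 𝕜) * f q * ((cellMass w c q : ℝ) : 𝕜)⁻¹ * ((w p : 𝕜) * g q) else 0 := by
    intro p
    rw [cellAvg_apply, ← Finset.sum_filter, Finset.mul_sum, Finset.mul_sum, Finset.sum_mul]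
    refine Finset.sum_congr rfl fun q hq => ?_
    have hqp : c q = c p := by simpa using hq
    rw [hg hqp, cellMass_factorsThrough hqp]
    ring
  have mass : ∀ q, (∑ p with c q = c p, (w p : 𝕜)) = ((cellMass w c q : ℝ) : 𝕜) := fun q => by
    simp only [cellMass, RCLike.ofReal_sum, eq_comm]
  rw [Finset.sum_congr rfl fun p _ => expand p, Finset.sum_comm]
  refine Finset.sum_congr rfl fun q _ => ?_
  rw [← Finset.sum_filter, ← Finset.mul_sum, ← Finset.sum_mul, mass]
  field_simp [cellMass_ne_zero (𝕜 := 𝕜) (c := c) hw q]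

theorem cellAvg_cellAvg_of_factorsThrough (hw : ∀ p, 0 < w p) (h : c'.FactorsThrough c)
    (f : P → 𝕜) : cellAvg w c' (cellAvg w c f) = cellAvg w c' f := by
  ext p
  rw [cellAvg_apply, cellAvg_apply]
  congr 1
  have := sum_cellAvg_mul (c := c) hw f (g := fun q => if c' q = c' p then (1 : 𝕜) else 0)
    fun q q' hq => by simp only [h hq]
  simpa [Finset.sum_filter] using this

theorem normSq_nonneg (hw : ∀ p, 0 < w p) (f : P → 𝕜) : 0 ≤ normSq w f :=
  Finset.sum_nonneg fun p _ => mul_nonneg (hw p).le (sq_nonneg _)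

theorem normSq_add_of_cellAvg_eq_zero (hw : ∀ p, 0 < w p) {f g : P → 𝕜}
    (hf : cellAvg w c f = 0) (hg : g.FactorsThrough c) :
    normSq w (f + g) = normSq w f + normSq w g := by
  have inner_eq_zero : ∑ p, w p * RCLike.re (f p * star (g p)) = 0 := by
    have h := congrArg RCLike.re (sum_cellAvg_mul (c := c) hw f (g := star g)
      fun p q hpq => by simp only [Pi.star_apply, hg hpq])
    simpa [hf, mul_assoc, RCLike.re_ofReal_mul] using h.symm
  have expand : ∀ p, w p * ‖(f + g) p‖ ^ 2 =
      w p * ‖f p‖ ^ 2 + w p * ‖g p‖ ^ 2 + 2 * (w p * RCLike.re (f p * star (g p))) := by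
    intro p
    simp only [Pi.add_apply, ← RCLike.normSq_eq_def', RCLike.normSq_add, RCLike.star_def]
    ring
  simp only [normSq, expand, Finset.sum_add_distrib, ← Finset.mul_sum, inner_eq_zero, mul_zero,
    add_zero]

theorem normSq_cellAvg_le (hw : ∀ p, 0 < w p) (f : P → 𝕜) :
    normSq w (cellAvg w c f) ≤ normSq w f := by
  have pythagoras := normSq_add_of_cellAvg_eq_zero hw (f := f - cellAvg w c f)
    (by rw [map_sub, cellAvg_cellAvg_of_factorsThrough hw fun _ _ h => h, sub_self])
    (cellAvg_factorsThrough (w := w) f)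
  rw [sub_add_cancel] at pythagoras
  linarith [normSq_nonneg hw (f - cellAvg w c f)]

theorem norm_cellAvg_le (hw : ∀ p, 0 < w p) (f : P → 𝕜) (p : P) :
    ‖cellAvg w c f p‖ ≤ cellAvg w c (fun q => ‖f q‖) p := by
  have hm := cellMass_pos (c := c) hw p
  rw [cellAvg_apply, cellAvg_real_apply, norm_mul, norm_inv, RCLike.norm_ofReal, abs_of_pos hm]
  gcongr
  refine (norm_sum_le _ _).trans_eq (Finset.sum_congr rfl fun q _ => ?_)
  rw [norm_mul, RCLike.norm_ofReal, abs_of_pos (hw q)]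

theorem cellAvg_mono (hw : ∀ p, 0 < w p) {f g : P → ℝ} (h : f ≤ g) :
    cellAvg w c f ≤ cellAvg w c g := fun p => by
  have hm := cellMass_pos (c := c) hw p
  rw [cellAvg_real_apply, cellAvg_real_apply]
  gcongr with q
  · exact (hw q).le
  · exact h q

theorem cellAvg_nonneg (hw : ∀ p, 0 < w p) {f : P → ℝ} (h : 0 ≤ f) : 0 ≤ cellAvg w c f := by
  simpa only [map_zero] using cellAvg_mono (c := c) hw h

/-- Joint convexity of `(x, y) ↦ x² / y`. -/
theorem sq_cellAvg_div_cellAvg_le (hw : ∀ p, 0 < w p) (f : P → ℝ) {g : P → ℝ}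
    (hg : ∀ p, 0 < g p) : cellAvg w c f ^ 2 / cellAvg w c g ≤ cellAvg w c (f ^ 2 / g) := by
  intro p
  have hm := cellMass_pos (c := c) hw p
  have hsum : 0 < ∑ q with c q = c p, w q * g q :=
    Finset.sum_pos (fun q _ => mul_pos (hw q) (hg q)) ⟨p, by simp⟩
  simp only [Pi.div_apply, Pi.pow_apply, cellAvg_real_apply]
  calc ((cellMass w c p)⁻¹ * ∑ q with c q = c p, w q * f q) ^ 2 /
        ((cellMass w c p)⁻¹ * ∑ q with c q = c p, w q * g q)
      = (cellMass w c p)⁻¹ * ((∑ q with c q = c p, w q * f q) ^ 2 /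
          ∑ q with c q = c p, w q * g q) := by field_simp
    _ ≤ (cellMass w c p)⁻¹ * ∑ q with c q = c p, (w q * f q) ^ 2 / (w q * g q) := by
        gcongr
        exact Finset.sq_sum_div_le_sum_sq_div _ _ fun q _ => mul_pos (hw q) (hg q)
    _ = (cellMass w c p)⁻¹ * ∑ q with c q = c p, w q * (f q ^ 2 / g q) := by
        congr 1
        refine Finset.sum_congr rfl fun q _ => ?_
        have := (hw q).ne'
        have := (hg q).ne'
        field_simp

end CellAverages

section Martingale

variable {P ι 𝕜 : Type*} [Fintype P] [DecidableEq ι] [RCLike 𝕜]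

/-- A sequence of partitions, encoded by labellings, each of which is coarser than the previous
one. -/
def NestedCells {P ι : Type*} (c : ℕ → P → ι) : Prop := ∀ n, (c (n + 1)).FactorsThrough (c n)

theorem NestedCells.factorsThrough {P ι : Type*} {c : ℕ → P → ι} (hc : NestedCells c) {i j : ℕ}
    (hij : i ≤ j) : (c j).FactorsThrough (c i) := by
  induction j, hij using Nat.le_induction with
  | base => exact fun _ _ h => h
  | succ n _ ih => exact fun _ _ h => hc n (ih h)

/-- The martingale difference between the cells of level `n` and of level `n + 1`. -/
noncomputable def cellDiff (w : P → ℝ) (c : ℕ → P → ι) (n : ℕ) : (P → 𝕜) →ₗ[𝕜] (P → 𝕜) :=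
  cellAvg w (c n) - cellAvg w (c (n + 1))

variable {w : P → ℝ} {c : ℕ → P → ι}

theorem cellDiff_apply (n : ℕ) (f : P → 𝕜) :
    cellDiff w c n f = cellAvg w (c n) f - cellAvg w (c (n + 1)) f := rfl

theorem cellDiff_factorsThrough (hc : NestedCells c) (n : ℕ) (f : P → 𝕜) :
    (cellDiff w c n f).FactorsThrough (c n) := fun p q h => by
  simp only [cellDiff_apply, Pi.sub_apply, cellAvg_factorsThrough f h,
    cellAvg_factorsThrough f (hc n h)]

theorem cellAvg_cellDiff (hw : ∀ p, 0 < w p) (hc : NestedCells c) (n : ℕ) (f : P → 𝕜) :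
    cellAvg w (c (n + 1)) (cellDiff w c n f) = 0 := by
  rw [cellDiff_apply, map_sub, cellAvg_cellAvg_of_factorsThrough hw (hc n),
    cellAvg_cellAvg_of_factorsThrough hw fun _ _ h => h, sub_self]

theorem normSq_cellAvg (hw : ∀ p, 0 < w p) (hc : NestedCells c) (n : ℕ) (f : P → 𝕜) :
    normSq w (cellAvg w (c n) f) =
      normSq w (cellDiff w c n f) + normSq w (cellAvg w (c (n + 1)) f) := by
  rw [← normSq_add_of_cellAvg_eq_zero hw (cellAvg_cellDiff hw hc n f)
    (cellAvg_factorsThrough f), cellDiff_apply, sub_add_cancel]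

theorem normSq_cellAvg_eq_sum (hw : ∀ p, 0 < w p) (hc : NestedCells c) (N : ℕ) (f : P → 𝕜) :
    normSq w (cellAvg w (c 0) f) =
      ∑ n ∈ Finset.range N, normSq w (cellDiff w c n f) + normSq w (cellAvg w (c N) f) := by
  induction N with
  | zero => simp
  | succ N ih => rw [ih, normSq_cellAvg hw hc N, Finset.sum_range_succ]; ring

theorem sum_normSq_cellDiff_le (hw : ∀ p, 0 < w p) (hc : NestedCells c) (N : ℕ) (f : P → 𝕜) :
    ∑ n ∈ Finset.range N, normSq w (cellDiff w c n f) ≤ normSq w f := by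
  linarith [normSq_cellAvg_eq_sum hw hc N f, normSq_cellAvg_le (c := c 0) hw f,
    normSq_nonneg hw (cellAvg w (c N) f)]

theorem cellAvg_eq_sum_cellDiff (n N : ℕ) (f : P → 𝕜) :
    cellAvg w (c n) f =
      ∑ k ∈ Finset.range N, cellDiff w c (n + k) f + cellAvg w (c (n + N)) f := by
  induction N with
  | zero => simp
  | succ N ih =>
    rw [ih, Finset.sum_range_succ, cellDiff_apply (n + N), ← add_assoc n N 1]
    abel

end Martingale

section CarlesonEmbedding

variable {P ι 𝕜 : Type*} [Fintype P] [DecidableEq ι] [RCLike 𝕜]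

/-- The Bellman function of the Carleson embedding theorem for the function `g`, where the average
of `s` is the Carleson mass accumulated below the current cell, out of a maximum `C`. -/
noncomputable def bellman (w : P → ℝ) (c : P → ι) (C : ℝ) (s g : P → ℝ) : P → ℝ :=
  (4 * C) • (cellAvg w c (g ^ 2) - cellAvg w c g ^ 2 / cellAvg w c (1 + C⁻¹ • s))

variable {w : P → ℝ} {c c' : P → ι} {C : ℝ} {s a g : P → ℝ}

theorem cellAvg_one_add_smul (hw : ∀ p, 0 < w p) (s : P → ℝ) (p : P) :
    cellAvg w c (1 + C⁻¹ • s) p = 1 + cellAvg w c s p / C := by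
  rw [map_add, map_smul, cellAvg_one hw, Pi.add_apply, Pi.smul_apply, Pi.one_apply, smul_eq_mul,
    inv_mul_eq_div]

theorem bellman_apply (hw : ∀ p, 0 < w p) (p : P) : bellman w c C s g p =
    4 * C * (cellAvg w c (g ^ 2) p - cellAvg w c g p ^ 2 / (1 + cellAvg w c s p / C)) := by
  rw [← cellAvg_one_add_smul hw]
  rfl

theorem bellman_le (hw : ∀ p, 0 < w p) (hC : 0 < C) (hs : 0 ≤ s) :
    bellman w c C s g ≤ (4 * C) • cellAvg w c (g ^ 2) := fun p => by
  have := cellAvg_nonneg (c := c) hw hs p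
  simp only [Pi.zero_apply] at this
  rw [bellman_apply hw, Pi.smul_apply, smul_eq_mul]
  exact mul_le_mul_of_nonneg_left (sub_le_self _ (by positivity)) (by positivity)

theorem bellman_zero_nonneg (hw : ∀ p, 0 < w p) (hC : 0 < C) : 0 ≤ bellman w c C 0 g := fun p => by
  have jensen := sq_cellAvg_div_cellAvg_le (c := c) hw g (g := 1) (fun _ => one_pos) p
  rw [cellAvg_one hw, div_one, div_one, Pi.pow_apply] at jensen
  rw [bellman_apply hw, map_zero, Pi.zero_apply, zero_div, add_zero, div_one]
  exact mul_nonneg (by positivity) (sub_nonneg.mpr jensen)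

theorem cellAvg_bellman_le (hw : ∀ p, 0 < w p) (h : c'.FactorsThrough c) (hC : 0 < C)
    (hs : 0 ≤ s) : cellAvg w c' (bellman w c C s g) ≤ bellman w c' C s g := by
  have hpos : ∀ p, 0 < cellAvg w c (1 + C⁻¹ • s) p := fun p => by
    have := cellAvg_nonneg (c := c) hw hs p
    simp only [Pi.zero_apply] at this
    rw [cellAvg_one_add_smul hw]
    positivity
  have convex := sq_cellAvg_div_cellAvg_le (c := c') hw (cellAvg w c g) hpos
  rw [cellAvg_cellAvg_of_factorsThrough hw h, cellAvg_cellAvg_of_factorsThrough hw h] at convex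
  rw [bellman, map_smul, map_sub, cellAvg_cellAvg_of_factorsThrough hw h]
  exact smul_le_smul_of_nonneg_left (sub_le_sub_left convex _) (by positivity)

theorem mul_sq_le_bellman_jump (hC : 0 < C) {A α : ℝ} (hA : 0 ≤ A) (hα : 0 ≤ α) (h : A + α ≤ C)
    (x : ℝ) : α * x ^ 2 ≤ 4 * C * (x ^ 2 / (1 + A / C) - x ^ 2 / (1 + (A + α) / C)) := by
  have factor : 4 * C * (x ^ 2 / (1 + A / C) - x ^ 2 / (1 + (A + α) / C)) =
      α * x ^ 2 * ((2 * C) ^ 2 / ((C + A) * (C + (A + α)))) := by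
    have : C + A ≠ 0 := by positivity
    have : C + (A + α) ≠ 0 := by positivity
    field_simp
    ring
  rw [factor]
  refine le_mul_of_one_le_right (by positivity) ?_
  rw [one_le_div (by positivity)]
  nlinarith

theorem bellman_add_le (hw : ∀ p, 0 < w p) (hC : 0 < C) (hs : 0 ≤ s) (ha : 0 ≤ a)
    (h : ∀ p, cellAvg w c (s + a) p ≤ C) :
    bellman w c C s g + cellAvg w c (a * cellAvg w c g ^ 2) ≤ bellman w c C (s + a) g := by
  intro p
  have hmul : cellAvg w c (a * cellAvg w c g ^ 2) p = cellAvg w c a p * cellAvg w c g p ^ 2 := by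
    rw [mul_comm a, cellAvg_mul_of_factorsThrough a fun p q hpq => by
      simp only [Pi.pow_apply, cellAvg_factorsThrough g hpq], mul_comm]
    rfl
  have hle := h p
  rw [map_add, Pi.add_apply] at hle
  have jump := mul_sq_le_bellman_jump hC (cellAvg_nonneg (c := c) hw hs p)
    (cellAvg_nonneg (c := c) hw ha p) hle (cellAvg w c g p)
  rw [Pi.add_apply, hmul, bellman_apply hw, bellman_apply hw, map_add, Pi.add_apply]
  rw [mul_sub] at jump ⊢
  linarith

theorem cellAvg_sum_mul_sq_le_bellman {c : ℕ → P → ι} (hw : ∀ p, 0 < w p) (hc : NestedCells c)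
    (hC : 0 < C) {a : ℕ → P → ℝ} (ha : ∀ n, 0 ≤ a n)
    (hcar : ∀ n p, cellAvg w (c n) (∑ l ∈ Finset.range (n + 1), a l) p ≤ C) (g : P → ℝ) (n : ℕ) :
    cellAvg w (c n) (∑ l ∈ Finset.range (n + 1), a l * cellAvg w (c l) g ^ 2) ≤
      bellman w (c n) C (∑ l ∈ Finset.range (n + 1), a l) g := by
  induction n with
  | zero =>
    have step := bellman_add_le (c := c 0) (g := g) hw hC le_rfl (ha 0) (by simpa using hcar 0)
    rw [zero_add] at step
    simpa using (le_add_of_nonneg_left (bellman_zero_nonneg hw hC)).trans step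
  | succ n ih =>
    have hsum : 0 ≤ ∑ l ∈ Finset.range (n + 1), a l := Finset.sum_nonneg fun l _ => ha l
    have hcar' := hcar (n + 1)
    rw [Finset.sum_range_succ] at hcar' ⊢
    rw [map_add, ← cellAvg_cellAvg_of_factorsThrough hw (hc n), Finset.sum_range_succ a]
    calc _ ≤ bellman w (c (n + 1)) C (∑ l ∈ Finset.range (n + 1), a l) g +
          cellAvg w (c (n + 1)) (a (n + 1) * cellAvg w (c (n + 1)) g ^ 2) :=
          add_le_add_left ((cellAvg_mono hw ih).trans (cellAvg_bellman_le hw (hc n) hC hsum)) _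
      _ ≤ _ := bellman_add_le hw hC hsum (ha _) hcar'

theorem carleson_embedding {c : ℕ → P → ι} (hw : ∀ p, 0 < w p) (hc : NestedCells c) (hC : 0 < C)
    {a : ℕ → P → ℝ} (ha : ∀ n, 0 ≤ a n)
    (hcar : ∀ n p, cellAvg w (c n) (∑ l ∈ Finset.range (n + 1), a l) p ≤ C) (g : P → 𝕜) (N : ℕ) :
    ∑ n ∈ Finset.range N, ∑ p, w p * (a n p * ‖cellAvg w (c n) g p‖ ^ 2) ≤
      4 * C * normSq w g := by
  rcases N with _ | n
  · simpa using mul_nonneg (by positivity : 0 ≤ 4 * C) (normSq_nonneg hw g)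
  set g' : P → ℝ := fun q => ‖g q‖
  have total : ∀ f : P → ℝ, ∑ p, w p * cellAvg w (c n) f p = ∑ p, w p * f p := fun f => by
    simpa using sum_cellAvg_mul (c := c n) hw f (g := fun _ => 1) fun _ _ _ => rfl
  calc ∑ n ∈ Finset.range (n + 1), ∑ p, w p * (a n p * ‖cellAvg w (c n) g p‖ ^ 2)
      ≤ ∑ n ∈ Finset.range (n + 1), ∑ p, w p * (a n p * cellAvg w (c n) g' p ^ 2) := by
        gcongr with n _ p _
        · exact (hw p).le
        · exact ha n p
        · exact norm_cellAvg_le hw g p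
    _ = ∑ p, w p * (∑ n ∈ Finset.range (n + 1), a n * cellAvg w (c n) g' ^ 2) p := by
        rw [Finset.sum_comm]
        simp only [Finset.mul_sum, Finset.sum_apply, Pi.mul_apply, Pi.pow_apply]
    _ ≤ ∑ p, w p * ((4 * C) • cellAvg w (c n) (g' ^ 2)) p := by
        rw [← total]
        gcongr with p
        · exact (hw p).le
        · exact (cellAvg_sum_mul_sq_le_bellman hw hc hC ha hcar g' n).trans
            (bellman_le hw hC (Finset.sum_nonneg fun l _ => ha l)) p
    _ = 4 * C * normSq w g := by
        rw [← map_smul, total, normSq, Finset.mul_sum]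
        refine Finset.sum_congr rfl fun p _ => ?_
        simp only [Pi.smul_apply, Pi.pow_apply, smul_eq_mul, g']
        ring

end CarlesonEmbedding

section Schur

theorem sum_le_sqrt_sum_mul_sqrt_sum {α : Type*} (s : Finset α) {r f g : α → ℝ}
    (hf : ∀ i ∈ s, 0 ≤ f i) (hg : ∀ i ∈ s, 0 ≤ g i) (h : ∀ i ∈ s, r i ^ 2 ≤ f i * g i) :
    ∑ i ∈ s, r i ≤ √(∑ i ∈ s, f i) * √(∑ i ∈ s, g i) := by
  rw [← Real.sqrt_mul (Finset.sum_nonneg hf)]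
  exact Real.le_sqrt_of_sq_le (Finset.sum_sq_le_sum_mul_sum_of_sq_le_mul s hf hg h)

theorem schur_test {α β : Type*} (s : Finset α) (t : Finset β) {u : α → β → ℝ}
    (hu : ∀ i j, 0 ≤ u i j) {C : ℝ} (hC : 0 ≤ C) {m : α → ℝ} {m' : β → ℝ}
    (hrow : ∀ i ∈ s, ∑ j ∈ t, u i j ≤ C * m i) (hcol : ∀ j ∈ t, ∑ i ∈ s, u i j ≤ C * m' j)
    (x : α → ℝ) (y : β → ℝ) :
    ∑ i ∈ s, ∑ j ∈ t, u i j * (x i * y j) ≤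
      C * (√(∑ i ∈ s, m i * x i ^ 2) * √(∑ j ∈ t, m' j * y j ^ 2)) := by
  have rows : ∑ z ∈ s ×ˢ t, u z.1 z.2 * x z.1 ^ 2 ≤ C * ∑ i ∈ s, m i * x i ^ 2 := by
    simp only [Finset.sum_product, Finset.mul_sum, ← Finset.sum_mul, ← mul_assoc]
    gcongr with i hi
    exact hrow i hi
  have cols : ∑ z ∈ s ×ˢ t, u z.1 z.2 * y z.2 ^ 2 ≤ C * ∑ j ∈ t, m' j * y j ^ 2 := by
    simp only [Finset.sum_product_right, Finset.mul_sum, ← Finset.sum_mul, ← mul_assoc]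
    gcongr with j hj
    exact hcol j hj
  calc ∑ i ∈ s, ∑ j ∈ t, u i j * (x i * y j)
      = ∑ z ∈ s ×ˢ t, u z.1 z.2 * (x z.1 * y z.2) := (Finset.sum_product' ..).symm
    _ ≤ √(∑ z ∈ s ×ˢ t, u z.1 z.2 * x z.1 ^ 2) * √(∑ z ∈ s ×ˢ t, u z.1 z.2 * y z.2 ^ 2) :=
        sum_le_sqrt_sum_mul_sqrt_sum _ (fun z _ => mul_nonneg (hu _ _) (sq_nonneg _))
          (fun z _ => mul_nonneg (hu _ _) (sq_nonneg _)) fun z _ => le_of_eq (by ring)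
    _ ≤ √(C * ∑ i ∈ s, m i * x i ^ 2) * √(C * ∑ j ∈ t, m' j * y j ^ 2) := by gcongr
    _ = C * (√(∑ i ∈ s, m i * x i ^ 2) * √(∑ j ∈ t, m' j * y j ^ 2)) := by
        rw [Real.sqrt_mul hC, Real.sqrt_mul hC, mul_mul_mul_comm, Real.mul_self_sqrt hC]

end Schur

section CellIndicator

variable {P ι 𝕜 : Type*} [RCLike 𝕜]

/-- The indicator function of the cell of `p₀`. -/
noncomputable def cellIndicator (c : P → ι) (p₀ : P) : P → 𝕜 := {p | c p = c p₀}.indicator 1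

theorem cellIndicator_apply [DecidableEq ι] {c : P → ι} (p₀ p : P) :
    cellIndicator c p₀ p = if c p = c p₀ then (1 : 𝕜) else 0 := by
  simp [cellIndicator, Set.indicator_apply]

end CellIndicator

section TreeForm

open Matrix

variable {P ι 𝕜 : Type*} [Fintype P] [DecidableEq ι] [RCLike 𝕜]

/-- The pairing of a matrix with a kernel on `P × P`; the kernels `f p * g q` give the bilinear form
`bilin b`, and general kernels allow to cut off `g` depending on `p`. -/
def pairing (b : Matrix P P 𝕜) : (P → P → 𝕜) →ₗ[𝕜] 𝕜 where
  toFun Φ := ∑ p, ∑ q, b p q * Φ p q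
  map_add' Φ Ψ := by simp only [Pi.add_apply, mul_add, Finset.sum_add_distrib]
  map_smul' r Φ := by
    simp only [Pi.smul_apply, smul_eq_mul, Finset.mul_sum, RingHom.id_apply, mul_left_comm]

/-- The bilinear form with matrix `b`. -/
def bilin (b : Matrix P P 𝕜) : (P → 𝕜) →ₗ[𝕜] (P → 𝕜) →ₗ[𝕜] 𝕜 :=
  LinearMap.mk₂ 𝕜 (fun f g => pairing b fun p q => f p * g q)
    (fun f f' g => by rw [← map_add]; congr 1; ext; exact add_mul ..)
    (fun r f g => by rw [← map_smul]; congr 1; ext; exact mul_assoc ..)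
    (fun f g g' => by rw [← map_add]; congr 1; ext; exact mul_add ..)
    (fun r f g => by rw [← map_smul]; congr 1; ext; exact mul_left_comm ..)

/-- The operator on the weighted `ℓ²` space whose bilinear form has the matrix `b`. -/
noncomputable def formOp (w : P → ℝ) (b : Matrix P P 𝕜) : (P → 𝕜) →ₗ[𝕜] (P → 𝕜) where
  toFun g p := (w p : 𝕜)⁻¹ * (b *ᵥ g) p
  map_add' f g := by
    ext
    simp only [mulVec_add, Pi.add_apply, mul_add]
  map_smul' r g := by
    ext
    simp only [mulVec_smul, Pi.smul_apply, smul_eq_mul, RingHom.id_apply, mul_left_comm]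

/-- The testing condition on the cells of `c` for the form with matrix `b`. -/
def CellTesting (w : P → ℝ) (c : P → ι) (b : Matrix P P 𝕜) (a : ℝ) : Prop :=
  ∀ p₀ g, ‖bilin b (cellIndicator c p₀) g‖ ≤ a * (√(cellMass w c p₀) * √(normSq w g))

/-- The form with matrix `b`, applied to a mean zero function `h` on the cell of a point `p₀` and
a function `g` supported in the set of all `q` with `S p₀ q`, is controlled by the absolute
values of `h` and `g` through weights that satisfy the Schur test with constant `C`. -/
def Decouples (w : P → ℝ) (c : P → ι) (b : Matrix P P 𝕜) (S : P → P → Prop) (C : ℝ) : Prop :=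
  ∃ u : P → P → ℝ, (∀ p q, 0 ≤ u p q) ∧ (∀ p, ∑ q, u p q ≤ C * w p) ∧
    (∀ q, ∑ p, u p q ≤ C * w q) ∧ ∀ (p₀ : P) (h g : P → 𝕜), (∀ p, h p ≠ 0 → c p = c p₀) →
      ∑ p, (w p : 𝕜) * h p = 0 → (∀ q, g q ≠ 0 → S p₀ q) →
      ‖bilin b h g‖ ≤ ∑ p, ∑ q, u p q * (‖h p‖ * ‖g q‖)

variable {w : P → ℝ} {c : P → ι} {b : Matrix P P 𝕜} {S : P → P → Prop} {a D : ℝ}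

theorem pairing_apply (Φ : P → P → 𝕜) : pairing b Φ = ∑ p, ∑ q, b p q * Φ p q := rfl

theorem bilin_apply (f g : P → 𝕜) : bilin b f g = ∑ p, ∑ q, b p q * (f p * g q) := rfl

theorem bilin_sub (b b' : Matrix P P 𝕜) (f g : P → 𝕜) :
    bilin (b - b') f g = bilin b f g - bilin b' f g := by
  simp only [bilin_apply, Matrix.sub_apply, sub_mul, Finset.sum_sub_distrib]

theorem bilin_transpose (f g : P → 𝕜) : bilin bᵀ f g = bilin b g f := by
  rw [bilin_apply, bilin_apply, Finset.sum_comm]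
  simp only [transpose_apply, mul_comm (f _)]

theorem bilin_eq_sum_formOp_mul (hw : ∀ p, 0 < w p) (f g : P → 𝕜) :
    bilin b f g = ∑ p, (w p : 𝕜) * formOp w b g p * f p := by
  refine Finset.sum_congr rfl fun p _ => ?_
  have hwp : (w p : 𝕜) ≠ 0 := RCLike.ofReal_ne_zero.mpr (hw p).ne'
  change _ = (w p : 𝕜) * ((w p : 𝕜)⁻¹ * ∑ q, b p q * g q) * f p
  rw [mul_inv_cancel_left₀ hwp, Finset.sum_mul]
  exact Finset.sum_congr rfl fun q _ => by ring

theorem normSq_zero : normSq w (0 : P → 𝕜) = 0 := by simp [normSq]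

theorem normSq_star (f : P → 𝕜) : normSq w (star f) = normSq w f := by simp [normSq]

theorem sum_mul_mul_star_eq_normSq (f : P → 𝕜) :
    ∑ p, (w p : 𝕜) * f p * star (f p) = (normSq w f : ℝ) := by
  rw [normSq]
  push_cast
  refine Finset.sum_congr rfl fun p _ => ?_
  rw [mul_assoc, RCLike.star_def, RCLike.mul_conj]

theorem normSq_cellIndicator (p₀ : P) :
    normSq w (cellIndicator c p₀ : P → 𝕜) = cellMass w c p₀ := by
  rw [normSq, cellMass, Finset.sum_filter]
  refine Finset.sum_congr rfl fun p _ => ?_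
  rw [cellIndicator_apply]
  split_ifs <;> simp

theorem sum_eq_sum_image_fiber {M : Type*} [AddCommMonoid M] (c : P → ι) (x : P → M) :
    ∑ p, x p = ∑ v ∈ Finset.univ.image c, ∑ p with c p = v, x p :=
  (Finset.sum_fiberwise_of_maps_to (fun p _ => Finset.mem_image_of_mem c (Finset.mem_univ p))
    x).symm

theorem bilin_mul_cellIndicator {f : P → 𝕜} {G : P → P → 𝕜} (hG : G.FactorsThrough c) (p₀ : P) :
    bilin b (f * cellIndicator c p₀) (G p₀) =
      ∑ p with c p = c p₀, ∑ q, b p q * (f p * G p q) := by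
  rw [bilin_apply, Finset.sum_filter]
  refine Finset.sum_congr rfl fun p _ => ?_
  rw [Pi.mul_apply, cellIndicator_apply]
  split_ifs with hp
  · simp only [hG hp, mul_one]
  · simp only [mul_zero, zero_mul, Finset.sum_const_zero]

theorem Decouples.exists_weight (hD : Decouples w c b S D) (hw : ∀ p, 0 < w p) :
    ∃ u : P → P → ℝ, (∀ p q, 0 ≤ u p q) ∧ (∀ p, ∑ q, u p q ≤ D * w p) ∧
      (∀ q, ∑ p, u p q ≤ D * w q) ∧ ∀ (f : P → 𝕜) (G : P → P → 𝕜), cellAvg w c f = 0 →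
        G.FactorsThrough c → (∀ p q, f p ≠ 0 → G p q ≠ 0 → S p q) →
        ‖pairing b fun p q => f p * G p q‖ ≤ ∑ p, ∑ q, u p q * (‖f p‖ * ‖G p q‖) := by
  obtain ⟨u, hu, hrow, hcol, h⟩ := hD
  refine ⟨u, hu, hrow, hcol, fun f G hf hG hS => ?_⟩
  rw [pairing_apply, sum_eq_sum_image_fiber c, sum_eq_sum_image_fiber c]
  refine norm_sum_le_of_le _ fun v _ => ?_
  by_cases hv : ∃ p₀, c p₀ = v ∧ f p₀ ≠ 0
  · obtain ⟨p₀, rfl, hp₀⟩ := hv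
    have mean_zero : ∑ p, (w p : 𝕜) * (f * cellIndicator c p₀ : P → 𝕜) p = 0 := by
      have h0 := congrFun hf p₀
      rw [cellAvg_apply, Pi.zero_apply, mul_eq_zero, Finset.sum_filter] at h0
      simpa [cellIndicator_apply] using h0.resolve_left (inv_ne_zero (cellMass_ne_zero hw p₀))
    rw [← bilin_mul_cellIndicator hG]
    refine (h p₀ _ _ (fun p hp => ?_) mean_zero fun q hq => hS p₀ q hp₀ hq).trans_eq ?_
    · by_contra hne
      simp [cellIndicator_apply, hne] at hp
    · rw [Finset.sum_filter]
      refine Finset.sum_congr rfl fun p _ => ?_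
      rw [Pi.mul_apply, cellIndicator_apply]
      split_ifs with hp
      · simp only [hG hp, mul_one]
      · simp only [mul_zero, norm_zero, zero_mul, Finset.sum_const_zero]
  · push Not at hv
    have hzero : ∀ p ∈ Finset.univ.filter (fun p => c p = v), f p = 0 := fun p hp =>
      hv p (by simpa using hp)
    rw [Finset.sum_eq_zero fun p hp => by simp [hzero p hp],
      Finset.sum_eq_zero fun p hp => by simp [hzero p hp], norm_zero]

theorem Decouples.norm_pairing_le (hD : Decouples w c b S D) (hw : ∀ p, 0 < w p) (hD0 : 0 ≤ D)
    {f : P → 𝕜} (g g' : P → 𝕜) {G : P → P → 𝕜} (hf : cellAvg w c f = 0) (hG : G.FactorsThrough c)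
    (hS : ∀ p q, f p ≠ 0 → G p q ≠ 0 → S p q)
    (hle : ∀ p q, f p ≠ 0 → ‖G p q‖ ≤ ‖g q‖ + ‖g' p‖) :
    ‖pairing b fun p q => f p * G p q‖ ≤
      D * (√(normSq w f) * (√(normSq w g) + √(normSq w g'))) := by
  obtain ⟨u, hu, hrow, hcol, h⟩ := hD.exists_weight hw
  have schur : ∑ p, ∑ q, u p q * (‖f p‖ * ‖g q‖) ≤ D * (√(normSq w f) * √(normSq w g)) :=
    schur_test Finset.univ Finset.univ hu hD0 (fun p _ => hrow p) (fun q _ => hcol q) _ _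
  have rows : ∑ p, ∑ q, u p q * (‖f p‖ * ‖g' p‖) ≤ D * (√(normSq w f) * √(normSq w g')) :=
    calc ∑ p, ∑ q, u p q * (‖f p‖ * ‖g' p‖) ≤ ∑ p, D * w p * (‖f p‖ * ‖g' p‖) := by
          simp only [← Finset.sum_mul]
          gcongr with p
          exact hrow p
      _ = D * ∑ p, w p * (‖f p‖ * ‖g' p‖) := by simp only [Finset.mul_sum, mul_assoc]
      _ ≤ D * (√(normSq w f) * √(normSq w g')) := by
          gcongr
          exact sum_le_sqrt_sum_mul_sqrt_sum _ (fun p _ => mul_nonneg (hw p).le (sq_nonneg _))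
            (fun p _ => mul_nonneg (hw p).le (sq_nonneg _)) fun p _ => le_of_eq (by ring)
  calc ‖pairing b fun p q => f p * G p q‖ ≤ ∑ p, ∑ q, u p q * (‖f p‖ * ‖G p q‖) := h f G hf hG hS
    _ ≤ ∑ p, ∑ q, (u p q * (‖f p‖ * ‖g q‖) + u p q * (‖f p‖ * ‖g' p‖)) := by
        refine Finset.sum_le_sum fun p _ => Finset.sum_le_sum fun q _ => ?_
        rw [← mul_add, ← mul_add]
        refine mul_le_mul_of_nonneg_left ?_ (hu p q)
        rcases eq_or_ne (f p) 0 with hp | hp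
        · simp [hp]
        · exact mul_le_mul_of_nonneg_left (hle p q hp) (norm_nonneg _)
    _ ≤ D * (√(normSq w f) * √(normSq w g)) + D * (√(normSq w f) * √(normSq w g')) := by
        simp only [Finset.sum_add_distrib]
        exact add_le_add schur rows
    _ = D * (√(normSq w f) * (√(normSq w g) + √(normSq w g'))) := by ring

theorem CellTesting.norm_sum_fiber_le (hT : CellTesting w c b a) {f : P → 𝕜}
    (hf : f.FactorsThrough c) {G : P → P → 𝕜} (hG : G.FactorsThrough c) (p₀ : P) :
    ‖∑ p with c p = c p₀, ∑ q, b p q * (f p * G p q)‖ ≤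
      a * (√(∑ p with c p = c p₀, w p * ‖f p‖ ^ 2) * √(normSq w (G p₀))) := by
  have hmul : f * cellIndicator c p₀ = f p₀ • (cellIndicator c p₀ : P → 𝕜) := by
    ext p
    rw [Pi.mul_apply, Pi.smul_apply, cellIndicator_apply, smul_eq_mul]
    split_ifs with hp
    · rw [hf hp]
    · simp
  have hsum : ∑ p with c p = c p₀, w p * ‖f p‖ ^ 2 = ‖f p₀‖ ^ 2 * cellMass w c p₀ := by
    rw [cellMass, Finset.mul_sum]
    refine Finset.sum_congr rfl fun p hp => ?_
    rw [hf (by simpa using hp : c p = c p₀), mul_comm]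
  rw [← bilin_mul_cellIndicator hG, hmul, map_smul, LinearMap.smul_apply, norm_smul, hsum,
    Real.sqrt_mul (sq_nonneg _), Real.sqrt_sq (norm_nonneg _), mul_assoc, mul_left_comm a]
  exact mul_le_mul_of_nonneg_left (hT p₀ (G p₀)) (norm_nonneg _)

omit [DecidableEq ι] in
theorem sum_sum_ite_mem_le_of_ncard_le (s : Finset ι) {V : P → Set ι}
    [∀ q v, Decidable (v ∈ V q)] (hfin : ∀ q, (V q).Finite) {K : ℕ} (hV : ∀ q, (V q).ncard ≤ K)
    {y : P → ℝ} (hy : 0 ≤ y) :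
    ∑ v ∈ s, ∑ q, (if v ∈ V q then y q else 0) ≤ K * ∑ q, y q := by
  rw [Finset.sum_comm, Finset.mul_sum]
  refine Finset.sum_le_sum fun q _ => ?_
  rw [← Finset.sum_filter, Finset.sum_const, nsmul_eq_mul]
  refine mul_le_mul_of_nonneg_right (Nat.cast_le.mpr (le_trans ?_ (hV q))) (hy q)
  rw [← Set.ncard_coe_finset]
  exact Set.ncard_le_ncard (fun v hv => (Finset.mem_filter.mp hv).2) (hfin q)

theorem CellTesting.norm_pairing_ite_le (hT : CellTesting w c b a) (hw : ∀ p, 0 < w p)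
    (ha : 0 ≤ a) {K : ℕ} {R : P → P → Prop} [DecidableRel R] (hR : R.FactorsThrough c)
    (hK : ∀ q, (c '' {p | R p q}).ncard ≤ K) {f : P → 𝕜} (hf : f.FactorsThrough c) (g : P → 𝕜) :
    ‖pairing b fun p q => f p * (if R p q then g q else 0)‖ ≤
      a * √K * (√(normSq w f) * √(normSq w g)) := by
  classical
  set I := Finset.univ.image c
  set X : ι → ℝ := fun v => ∑ p with c p = v, w p * ‖f p‖ ^ 2
  set Y : ι → ℝ := fun v => ∑ q, if v ∈ c '' {p | R p q} then w q * ‖g q‖ ^ 2 else 0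
  have hX : ∀ v, 0 ≤ X v := fun v =>
    Finset.sum_nonneg fun p _ => mul_nonneg (hw p).le (sq_nonneg _)
  have hY : ∀ v, 0 ≤ Y v := fun v => Finset.sum_nonneg fun q _ => by
    have := hw q
    split_ifs <;> positivity
  have cell : ∀ v ∈ I, ‖∑ p with c p = v, ∑ q, b p q * (f p * if R p q then g q else 0)‖ ≤
      a * (√(X v) * √(Y v)) := fun v hv => by
    obtain ⟨p₀, -, rfl⟩ := Finset.mem_image.mp hv
    have hmem : ∀ q, c p₀ ∈ c '' {p | R p q} ↔ R p₀ q := fun q =>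
      ⟨fun ⟨p, hp, h⟩ => congrFun (hR h) q ▸ hp, fun h => ⟨p₀, h, rfl⟩⟩
    have hYp : normSq w (fun q => if R p₀ q then g q else 0) = Y (c p₀) := by
      refine Finset.sum_congr rfl fun q _ => ?_
      simp only [hmem]
      split_ifs <;> simp
    rw [← hYp]
    exact hT.norm_sum_fiber_le hf (G := fun p q => if R p q then g q else 0)
      (fun p p' h => by simp only [hR h]) p₀
  have sum_Y : ∑ v ∈ I, Y v ≤ K * normSq w g := sum_sum_ite_mem_le_of_ncard_le I
    (fun q => Set.toFinite _) hK fun q => mul_nonneg (hw q).le (sq_nonneg _)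
  rw [pairing_apply, sum_eq_sum_image_fiber c]
  calc _ ≤ ∑ v ∈ I, a * (√(X v) * √(Y v)) := norm_sum_le_of_le _ cell
    _ ≤ a * (√(∑ v ∈ I, X v) * √(∑ v ∈ I, Y v)) := by
        rw [← Finset.mul_sum]
        exact mul_le_mul_of_nonneg_left (Real.sum_sqrt_mul_sqrt_le _ hX hY) ha
    _ ≤ a * (√(normSq w f) * √(K * normSq w g)) := by
        rw [show ∑ v ∈ I, X v = normSq w f from (sum_eq_sum_image_fiber c _).symm]
        gcongr
    _ = a * √K * (√(normSq w f) * √(normSq w g)) := by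
        rw [Real.sqrt_mul (Nat.cast_nonneg K)]
        ring

end TreeForm

section TreeTheorem

open Matrix

variable {P ι 𝕜 : Type*} [Fintype P] [DecidableEq ι] [RCLike 𝕜]

/-- The hypotheses of the `T1` theorem on a finite tree of cells that control the interactions of
martingale differences with martingale differences at the same or a coarser level. The constants
are `r` for the goodness of cells, `K` for the number of subcells of cells near to a given cell,
`a` for the testing condition, and `C`, `θ` for the decay of the off-diagonal interactions. -/
structure IsUpperT1Form (w : P → ℝ) (c : ℕ → P → ι) (b : Matrix P P 𝕜) (near : ι → ι → Prop)
    (good : ℕ → P → Prop) (r K : ℕ) (a C θ : ℝ) : Prop where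
  weight_pos : ∀ p, 0 < w p
  nested : NestedCells c
  good_factorsThrough : ∀ n, (good n).FactorsThrough (c n)
  near_card : ∀ n q, (c n '' {p | near (c (n + 1) p) (c (n + 1) q)}).ncard ≤ K
  testing : ∀ n, CellTesting w (c n) b a
  testing_transpose : ∀ n, CellTesting w (c n) bᵀ a
  near_far : ∀ n, Decouples w (c n) b (fun p q => ¬near (c n p) (c n q)) C
  good_far : ∀ n k, r ≤ k →
    Decouples w (c n) b (fun p q => good n p ∧ c (n + k) q ≠ c (n + k) p) (C * θ ^ k)
  a_nonneg : 0 ≤ a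
  C_pos : 0 < C
  θ_nonneg : 0 ≤ θ
  θ_lt_one : θ < 1

/-- A function all of whose martingale differences live on good cells. -/
def IsGoodFunction (w : P → ℝ) (c : ℕ → P → ι) (good : ℕ → P → Prop) (f : P → 𝕜) : Prop :=
  ∀ n p, cellDiff w c n f p ≠ 0 → good (n + 1) p

/-- The squared martingale difference of `β` of level `l`, cut off to the good cells. For the
image `β` of `1` under the operator of the form, these are the Carleson coefficients. -/
noncomputable def goodDiffSq (w : P → ℝ) (c : ℕ → P → ι) (good : ℕ → P → Prop) (β : P → 𝕜)
    (l : ℕ) : P → ℝ :=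
  {p | good (l + 1) p}.indicator fun p => ‖cellDiff w c l β p‖ ^ 2

/-- The constant in the Carleson condition of the paraproduct. -/
noncomputable def carlesonConst (a C θ : ℝ) : ℝ := 2 * a ^ 2 + 2 * C ^ 2 * (1 - θ)⁻¹

/-- The bound for the interactions of martingale differences with the coarser levels: the first
summand comes from comparable levels, the second one from cells that are much smaller, and the last
one from the paraproduct. -/
noncomputable def upperConst (r K : ℕ) (a C θ : ℝ) : ℝ :=
  (r + 1) * (a * √K + C) + 2 * C * (1 - θ)⁻¹ + √(4 * carlesonConst a C θ)

variable {w : P → ℝ} {c : ℕ → P → ι} {b : Matrix P P 𝕜} {near : ι → ι → Prop}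
  {good : ℕ → P → Prop} {r K : ℕ} {a C θ : ℝ}

theorem mul_cellDiff_factorsThrough (hc : NestedCells c) {n : ℕ} (f : P → 𝕜) {e : P → 𝕜}
    (he : e.FactorsThrough (c (n + 1))) : (e * cellDiff w c n f).FactorsThrough (c n) :=
  fun p q h => by rw [Pi.mul_apply, Pi.mul_apply, he (hc n h), cellDiff_factorsThrough hc n f h]

theorem cellAvg_mul_cellDiff (hw : ∀ p, 0 < w p) (hc : NestedCells c) {n : ℕ} (f : P → 𝕜)
    {e : P → 𝕜} (he : e.FactorsThrough (c (n + 1))) :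
    cellAvg w (c (n + 1)) (e * cellDiff w c n f) = 0 := by
  rw [cellAvg_mul_of_factorsThrough _ he, cellAvg_cellDiff hw hc, mul_zero]

theorem sum_cellDiff_mul (hw : ∀ p, 0 < w p) {n : ℕ} (f : P → 𝕜) {g : P → 𝕜}
    (hg : g.FactorsThrough (c n)) (hg0 : cellAvg w (c (n + 1)) g = 0) :
    ∑ p, (w p : 𝕜) * cellDiff w c n f p * g p = ∑ p, (w p : 𝕜) * f p * g p := by
  have coarse : ∑ p, (w p : 𝕜) * cellAvg w (c (n + 1)) f p * g p = 0 := by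
    have h := sum_cellAvg_mul hw g (cellAvg_factorsThrough (w := w) (c := c (n + 1)) f)
    rw [hg0] at h
    simpa [mul_right_comm] using h.symm
  simp only [cellDiff_apply, Pi.sub_apply, mul_sub, sub_mul, Finset.sum_sub_distrib, coarse,
    sum_cellAvg_mul hw f hg, sub_zero]

theorem cellDiff_star (n : ℕ) (f : P → 𝕜) :
    cellDiff w c n (star f) = star (cellDiff w c n f) := by
  simp only [cellDiff_apply, cellAvg_star, star_sub]

theorem bilin_mul_cellDiff (hw : ∀ p, 0 < w p) (hc : NestedCells c) {n : ℕ} (f g : P → 𝕜)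
    {e : P → 𝕜} (he : e.FactorsThrough (c (n + 1))) :
    bilin b (e * cellDiff w c n f) g =
      ∑ p, (w p : 𝕜) * cellDiff w c n (formOp w b g) p * (e p * cellDiff w c n f p) :=
  (bilin_eq_sum_formOp_mul hw _ g).trans (sum_cellDiff_mul hw _
    (mul_cellDiff_factorsThrough hc f he) (cellAvg_mul_cellDiff hw hc f he)).symm

theorem bilin_eq_pairing_sub_add (f h : P → 𝕜) :
    bilin b f h = pairing b (fun p q => f p * (h q - h p)) + bilin b (h * f) 1 := by
  rw [bilin_apply, bilin_apply, pairing_apply]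
  simp only [← Finset.sum_add_distrib]
  refine Finset.sum_congr rfl fun p _ => Finset.sum_congr rfl fun q _ => ?_
  rw [Pi.mul_apply, Pi.one_apply]
  ring

theorem sum_sqrt_normSq_cellDiff_le (hw : ∀ p, 0 < w p) (hc : NestedCells c) (f g : P → 𝕜)
    (N k : ℕ) :
    ∑ n ∈ Finset.range N, √(normSq w (cellDiff w c n f)) * √(normSq w (cellDiff w c (k + n) g)) ≤
      √(normSq w f) * √(normSq w g) := by
  refine (Real.sum_sqrt_mul_sqrt_le _ (fun n => normSq_nonneg hw _)
    (fun n => normSq_nonneg hw _)).trans ?_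
  gcongr
  · exact sum_normSq_cellDiff_le hw hc N f
  · exact sum_normSq_cellDiff_le (c := fun n => c (k + n)) hw (fun n => hc (k + n)) N g

theorem geom_sum_le_inv_one_sub (hθ : 0 ≤ θ) (hθ1 : θ < 1) (n : ℕ) :
    ∑ j ∈ Finset.range n, θ ^ j ≤ (1 - θ)⁻¹ := by
  rw [← tsum_geometric_of_lt_one hθ hθ1]
  exact (summable_geometric_of_lt_one hθ hθ1).sum_le_tsum _ fun j _ => pow_nonneg hθ j

theorem le_sq_mul_of_le_mul_sqrt_mul_sqrt {x m D : ℝ} (hx : 0 ≤ x) (hm : 0 ≤ m)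
    (h : x ≤ D * (√x * √m)) : x ≤ D ^ 2 * m := by
  have hsq : x ^ 2 ≤ D ^ 2 * m * x :=
    calc x ^ 2 ≤ (D * (√x * √m)) ^ 2 := by gcongr
      _ = D ^ 2 * m * x := by
        rw [mul_pow, mul_pow, Real.sq_sqrt hx, Real.sq_sqrt hm]
        ring
  rcases hx.eq_or_lt with rfl | hx
  · positivity
  · exact le_of_mul_le_mul_right (by rwa [← sq]) hx

theorem norm_sum_mul_mul_star_self (hw : ∀ p, 0 < w p) (f : P → 𝕜) :
    ‖∑ p, (w p : 𝕜) * f p * star (f p)‖ = normSq w f := by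
  rw [sum_mul_mul_star_eq_normSq, RCLike.norm_ofReal, abs_of_nonneg (normSq_nonneg hw f)]

theorem CellTesting.normSq_formOp_cellIndicator_le {c : P → ι} (hT : CellTesting w c bᵀ a)
    (hw : ∀ p, 0 < w p) (p₀ : P) :
    normSq w (formOp w b (cellIndicator c p₀)) ≤ a ^ 2 * cellMass w c p₀ := by
  set β := formOp w b (cellIndicator c p₀)
  have h := hT p₀ (star β)
  rw [bilin_transpose, bilin_eq_sum_formOp_mul hw, normSq_star, mul_comm √_] at h
  simp only [Pi.star_apply] at h
  rw [norm_sum_mul_mul_star_self hw β] at h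
  exact le_sq_mul_of_le_mul_sqrt_mul_sqrt (normSq_nonneg hw β) (cellMass_pos hw p₀).le h

theorem norm_bilin_indicator_mul_cellDiff_star_formOp (hw : ∀ p, 0 < w p) (hc : NestedCells c)
    {n : ℕ} {S : Set P} (hS : (S.indicator (1 : P → 𝕜)).FactorsThrough (c (n + 1))) (ψ : P → 𝕜) :
    ‖bilin b (S.indicator 1 * cellDiff w c n (star (formOp w b ψ))) ψ‖ =
      normSq w (S.indicator 1 * cellDiff w c n (star (formOp w b ψ))) := by
  classical
  rw [bilin_mul_cellDiff hw hc _ ψ hS, ← norm_sum_mul_mul_star_self hw]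
  congr 1
  refine Finset.sum_congr rfl fun p _ => ?_
  simp only [cellDiff_star, Pi.mul_apply, Pi.star_apply, Set.indicator_apply]
  split_ifs
  · simp only [Pi.one_apply, one_mul, star_star]
    ring
  · simp

namespace IsUpperT1Form

variable (H : IsUpperT1Form w c b near good r K a C θ)

include H

theorem nearConst_nonneg : 0 ≤ a * √K + C := by
  have := H.a_nonneg
  have := H.C_pos
  positivity

theorem carlesonConst_pos : 0 < carlesonConst a C θ := by
  have := H.C_pos
  have := sub_pos.mpr H.θ_lt_one
  unfold carlesonConst
  positivity

theorem norm_bilin_cellDiff_le (f g : P → 𝕜) (n k : ℕ) :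
    ‖bilin b (cellDiff w c n f) (cellDiff w c (k + n) g)‖ ≤ (a * √K + C) *
      (√(normSq w (cellDiff w c n f)) * √(normSq w (cellDiff w c (k + n) g))) := by
  classical
  set F := cellDiff w c n f
  set G := cellDiff w c (k + n) g
  have split : bilin b F G =
      pairing b (fun p q => F p * if near (c (n + 1) p) (c (n + 1) q) then G q else 0) +
      pairing b (fun p q => F p * if near (c (n + 1) p) (c (n + 1) q) then 0 else G q) := by
    rw [← map_add]
    change pairing b (fun p q => F p * G q) = _
    congr 1
    ext p q
    simp only [Pi.add_apply]
    split_ifs <;> simp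
  have near_part := (H.testing n).norm_pairing_ite_le H.weight_pos H.a_nonneg
    (R := fun p q => near (c (n + 1) p) (c (n + 1) q))
    (fun p p' h => by simp only [H.nested n h]) (H.near_card n)
    (cellDiff_factorsThrough (w := w) H.nested n f) G
  have far_part := (H.near_far (n + 1)).norm_pairing_le H.weight_pos H.C_pos.le G 0
    (G := fun p q => if near (c (n + 1) p) (c (n + 1) q) then 0 else G q)
    (cellAvg_cellDiff H.weight_pos H.nested n f) (fun p p' h => by simp only [h])
    (fun p q _ hG hnear => hG (if_pos hnear))
    (fun p q _ => by split_ifs <;> simp)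
  rw [normSq_zero, Real.sqrt_zero, add_zero] at far_part
  rw [split, add_mul]
  exact (norm_add_le _ _).trans (add_le_add near_part far_part)

theorem norm_sum_bilin_cellDiff_le (f g : P → 𝕜) (N k : ℕ) :
    ‖∑ n ∈ Finset.range N, bilin b (cellDiff w c n f) (cellDiff w c (k + n) g)‖ ≤
      (a * √K + C) * (√(normSq w f) * √(normSq w g)) := by
  refine (norm_sum_le_of_le _ fun n _ => H.norm_bilin_cellDiff_le f g n k).trans ?_
  rw [← Finset.mul_sum]
  exact mul_le_mul_of_nonneg_left (sum_sqrt_normSq_cellDiff_le H.weight_pos H.nested f g N k)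
    H.nearConst_nonneg

theorem norm_pairing_cellDiff_sub_le {f : P → 𝕜} (hf : IsGoodFunction w c good f) (g : P → 𝕜)
    (n : ℕ) {k : ℕ} (hk : r ≤ k) :
    ‖pairing b fun p q => cellDiff w c n f p *
      (cellDiff w c (n + 1 + k) g q - cellDiff w c (n + 1 + k) g p)‖ ≤ 2 * C * θ ^ k *
      (√(normSq w (cellDiff w c n f)) * √(normSq w (cellDiff w c (n + 1 + k) g))) := by
  set G := cellDiff w c (n + 1 + k) g
  have hG : G.FactorsThrough (c (n + 1 + k)) := cellDiff_factorsThrough H.nested _ g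
  have hCθ : 0 ≤ C * θ ^ k := mul_nonneg H.C_pos.le (pow_nonneg H.θ_nonneg k)
  refine ((H.good_far (n + 1) k hk).norm_pairing_le H.weight_pos hCθ G G
    (cellAvg_cellDiff H.weight_pos H.nested n f)
    (fun p p' h => ?_) (fun p q hp hq => ⟨hf n p hp, fun h => ?_⟩)
    (fun p q _ => norm_sub_le _ _)).trans_eq (by ring)
  · simp only [hG (H.nested.factorsThrough (Nat.le_add_right (n + 1) k) h)]
  · exact hq (sub_eq_zero.mpr (hG h))

theorem norm_sum_pairing_cellDiff_sub_le {f : P → 𝕜} (hf : IsGoodFunction w c good f)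
    (g : P → 𝕜) (N j : ℕ) :
    ‖∑ n ∈ Finset.range N, pairing b fun p q => cellDiff w c n f p *
      (cellDiff w c (n + 1 + (r + j)) g q - cellDiff w c (n + 1 + (r + j)) g p)‖ ≤
      2 * C * θ ^ j * (√(normSq w f) * √(normSq w g)) := by
  have hC := H.C_pos
  have hθ := H.θ_nonneg
  have levels := sum_sqrt_normSq_cellDiff_le H.weight_pos H.nested f g N (1 + (r + j))
  refine (norm_sum_le_of_le _ fun n _ =>
    H.norm_pairing_cellDiff_sub_le hf g n (Nat.le_add_right r j)).trans ?_
  rw [← Finset.mul_sum, Finset.sum_congr rfl fun n _ => by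
    rw [show n + 1 + (r + j) = 1 + (r + j) + n by ring]]
  refine mul_le_mul (mul_le_mul_of_nonneg_left ?_ (by positivity)) levels
    (Finset.sum_nonneg fun n _ => by positivity) (by positivity)
  exact pow_le_pow_of_le_one hθ H.θ_lt_one.le (Nat.le_add_left j r)

theorem sum_goodDiffSq_formOp_compl_le (p₀ : P) (l : ℕ) {k : ℕ} (hk : r ≤ k) :
    ∑ p with c (l + 1 + k) p = c (l + 1 + k) p₀,
      w p * goodDiffSq w c good (formOp w b (1 - cellIndicator (c (l + 1 + k)) p₀)) l p ≤
      (C * θ ^ k) ^ 2 * cellMass w (c (l + 1 + k)) p₀ := by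
  classical
  set J := l + 1 + k
  set ψ : P → 𝕜 := 1 - cellIndicator (c J) p₀
  set e : P → 𝕜 := {p | c J p = c J p₀ ∧ good (l + 1) p}.indicator 1 with he
  set F : P → 𝕜 := e * cellDiff w c l (star (formOp w b ψ)) with hF
  have he_factor : e.FactorsThrough (c (l + 1)) := fun p q h => by
    have hJ : c J p = c J q := H.nested.factorsThrough (Nat.le_add_right (l + 1) k) h
    simp only [he, Set.indicator_apply, Set.mem_ofPred_eq, hJ, H.good_factorsThrough _ h,
      Pi.one_apply]
  have hF_ne : ∀ p, F p ≠ 0 → c J p = c J p₀ ∧ good (l + 1) p := fun p hp => by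
    by_contra hne
    exact hp (by simp [hF, he, hne])
  have hψ : ∀ q, ψ q = if c J q = c J p₀ then 0 else 1 := fun q => by
    simp only [ψ, Pi.sub_apply, Pi.one_apply, cellIndicator_apply]
    split_ifs <;> simp
  have lhs_eq : ∑ p with c J p = c J p₀, w p * goodDiffSq w c good (formOp w b ψ) l p =
      normSq w F := by
    rw [normSq, Finset.sum_filter]
    refine Finset.sum_congr rfl fun p _ => ?_
    simp only [hF, he, goodDiffSq, Set.indicator_apply, Set.mem_ofPred_eq, cellDiff_star]
    by_cases hJ : c J p = c J p₀ <;> by_cases hl : good (l + 1) p <;> simp [hJ, hl]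
  have form_eq : ‖bilin b F ψ‖ = normSq w F :=
    norm_bilin_indicator_mul_cellDiff_star_formOp H.weight_pos H.nested he_factor ψ
  have form_le := (H.good_far (l + 1) k hk).norm_pairing_le H.weight_pos
    (mul_nonneg H.C_pos.le (pow_nonneg H.θ_nonneg k)) (f := F) 0 (cellIndicator (c J) p₀)
    (G := fun _ => ψ) (cellAvg_mul_cellDiff H.weight_pos H.nested _ he_factor)
    (fun _ _ _ => rfl)
    (fun p q hp hq => ⟨(hF_ne p hp).2, fun h => hq (by rw [hψ, if_pos (h.trans (hF_ne p hp).1)])⟩)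
    (fun p q hp => by
      rw [hψ, cellIndicator_apply, if_pos (hF_ne p hp).1]
      split_ifs <;> simp)
  rw [normSq_zero, Real.sqrt_zero, zero_add, normSq_cellIndicator] at form_le
  rw [lhs_eq]
  exact le_sq_mul_of_le_mul_sqrt_mul_sqrt (normSq_nonneg H.weight_pos F)
    (cellMass_pos H.weight_pos p₀).le
    (form_eq.symm.trans_le form_le)

omit H in
theorem goodDiffSq_nonneg (β : P → 𝕜) (l : ℕ) : 0 ≤ goodDiffSq w c good β l :=
  fun _ => Set.indicator_nonneg (fun _ _ => sq_nonneg _) _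

omit H in
theorem goodDiffSq_add_le (β₁ β₂ : P → 𝕜) (l : ℕ) (p : P) :
    goodDiffSq w c good (β₁ + β₂) l p ≤
      2 * ‖cellDiff w c l β₁ p‖ ^ 2 + 2 * goodDiffSq w c good β₂ l p := by
  classical
  simp only [goodDiffSq, Set.indicator_apply, map_add, Pi.add_apply]
  split_ifs
  · calc ‖cellDiff w c l β₁ p + cellDiff w c l β₂ p‖ ^ 2
        ≤ (‖cellDiff w c l β₁ p‖ + ‖cellDiff w c l β₂ p‖) ^ 2 := by
          gcongr
          exact norm_add_le _ _
      _ ≤ _ := by linarith [add_sq_le (a := ‖cellDiff w c l β₁ p‖) (b := ‖cellDiff w c l β₂ p‖)]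
  · positivity

theorem sum_goodDiffSq_formOp_one_le (p₀ : P) {n l : ℕ} (hl : l ≤ n) :
    ∑ p with c (n + r + 1) p = c (n + r + 1) p₀,
      w p * goodDiffSq w c good (formOp w b 1) l p ≤
      2 * normSq w (cellDiff w c l (formOp w b (cellIndicator (c (n + r + 1)) p₀))) +
        2 * (C ^ 2 * θ ^ (n - l) * cellMass w (c (n + r + 1)) p₀) := by
  obtain ⟨k, rfl⟩ := Nat.exists_eq_add_of_le hl
  have outside := H.sum_goodDiffSq_formOp_compl_le p₀ l (Nat.le_add_left r k)
  have level : l + 1 + (k + r) = l + k + r + 1 := by ring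
  rw [level] at outside
  set J := l + k + r + 1
  set φ : P → 𝕜 := cellIndicator (c J) p₀
  have hw := fun p => (H.weight_pos p).le
  have hm := cellMass_pos (c := c J) H.weight_pos p₀
  have inside : ∑ p with c J p = c J p₀, w p * ‖cellDiff w c l (formOp w b φ) p‖ ^ 2 ≤
      normSq w (cellDiff w c l (formOp w b φ)) :=
    Finset.sum_le_sum_of_subset_of_nonneg (Finset.filter_subset _ _)
      fun p _ _ => mul_nonneg (hw p) (sq_nonneg _)
  have decay : (C * θ ^ (k + r)) ^ 2 ≤ C ^ 2 * θ ^ (l + k - l) := by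
    rw [mul_pow, ← pow_mul, Nat.add_sub_cancel_left]
    exact mul_le_mul_of_nonneg_left
      (pow_le_pow_of_le_one H.θ_nonneg H.θ_lt_one.le (by lia)) (sq_nonneg C)
  calc ∑ p with c J p = c J p₀, w p * goodDiffSq w c good (formOp w b 1) l p
      ≤ ∑ p with c J p = c J p₀, (2 * (w p * ‖cellDiff w c l (formOp w b φ) p‖ ^ 2) +
          2 * (w p * goodDiffSq w c good (formOp w b (1 - φ)) l p)) := by
        refine Finset.sum_le_sum fun p _ => ?_
        have h := mul_le_mul_of_nonneg_left
          (goodDiffSq_add_le (w := w) (c := c) (good := good) (formOp w b φ) (formOp w b (1 - φ))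
            l p) (hw p)
        rw [← map_add, add_sub_cancel] at h
        linarith
    _ ≤ _ := by
        rw [Finset.sum_add_distrib, ← Finset.mul_sum, ← Finset.mul_sum]
        gcongr
        exact outside.trans (mul_le_mul_of_nonneg_right decay hm.le)

theorem carleson_condition (n : ℕ) (p₀ : P) :
    cellAvg w (c (n + r + 1))
      (∑ l ∈ Finset.range (n + 1), goodDiffSq w c good (formOp w b 1) l) p₀ ≤
      carlesonConst a C θ := by
  set J := n + r + 1
  set m := cellMass w (c J) p₀
  have hm : 0 < m := cellMass_pos H.weight_pos p₀
  have inside := (sum_normSq_cellDiff_le H.weight_pos H.nested (n + 1) _).trans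
    ((H.testing_transpose J).normSq_formOp_cellIndicator_le H.weight_pos p₀)
  have := H.C_pos
  have geom : ∑ l ∈ Finset.range (n + 1), θ ^ (n - l) ≤ (1 - θ)⁻¹ :=
    (Finset.sum_range_reflect (θ ^ ·) (n + 1)).trans_le
      (geom_sum_le_inv_one_sub H.θ_nonneg H.θ_lt_one _)
  rw [cellAvg_real_apply, inv_mul_le_iff₀ hm]
  calc ∑ p with c J p = c J p₀,
        w p * (∑ l ∈ Finset.range (n + 1), goodDiffSq w c good (formOp w b 1) l) p
      = ∑ l ∈ Finset.range (n + 1), ∑ p with c J p = c J p₀,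
          w p * goodDiffSq w c good (formOp w b 1) l p := by
        rw [Finset.sum_comm]
        simp only [Finset.sum_apply, Finset.mul_sum]
    _ ≤ ∑ l ∈ Finset.range (n + 1),
          (2 * normSq w (cellDiff w c l (formOp w b (cellIndicator (c J) p₀))) +
            2 * (C ^ 2 * θ ^ (n - l) * m)) := by
        refine Finset.sum_le_sum fun l hl => H.sum_goodDiffSq_formOp_one_le p₀ ?_
        exact Nat.lt_succ_iff.mp (Finset.mem_range.mp hl)
    _ = 2 * ∑ l ∈ Finset.range (n + 1),
          normSq w (cellDiff w c l (formOp w b (cellIndicator (c J) p₀))) +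
            2 * (C ^ 2 * (∑ l ∈ Finset.range (n + 1), θ ^ (n - l)) * m) := by
        simp only [Finset.sum_add_distrib, Finset.mul_sum, Finset.sum_mul]
    _ ≤ 2 * (a ^ 2 * m) + 2 * (C ^ 2 * (1 - θ)⁻¹ * m) := by gcongr
    _ = m * carlesonConst a C θ := by
        rw [carlesonConst]
        ring

theorem norm_bilin_paraproduct_le {f : P → 𝕜} (hf : IsGoodFunction w c good f) (g : P → 𝕜)
    (n : ℕ) :
    ‖bilin b (cellAvg w (c (n + r + 1)) g * cellDiff w c n f) 1‖ ≤ √(normSq w (cellDiff w c n f)) *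
      √(∑ p, w p * (goodDiffSq w c good (formOp w b 1) n p *
        ‖cellAvg w (c (n + r + 1)) g p‖ ^ 2)) := by
  have hw := H.weight_pos
  have hcoeff := goodDiffSq_nonneg (w := w) (c := c) (good := good) (formOp w b 1) n
  rw [bilin_mul_cellDiff hw H.nested f 1 fun p q h =>
    cellAvg_factorsThrough g (H.nested.factorsThrough (by lia) h)]
  refine (norm_sum_le _ _).trans (sum_le_sqrt_sum_mul_sqrt_sum _
    (fun p _ => mul_nonneg (hw p).le (sq_nonneg _))
    (fun p _ => mul_nonneg (hw p).le (mul_nonneg (hcoeff p) (sq_nonneg _))) fun p _ => ?_)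
  rcases eq_or_ne (cellDiff w c n f p) 0 with h0 | h0
  · simp [h0]
  · rw [goodDiffSq, Set.indicator_of_mem (s := {p | good (n + 1) p}) (hf n p h0), norm_mul,
      norm_mul, norm_mul, RCLike.norm_ofReal, abs_of_pos (hw p)]
    exact le_of_eq (by ring)

theorem norm_sum_bilin_paraproduct_le {f : P → 𝕜} (hf : IsGoodFunction w c good f) (g : P → 𝕜)
    (N : ℕ) :
    ‖∑ n ∈ Finset.range N, bilin b (cellAvg w (c (n + r + 1)) g * cellDiff w c n f) 1‖ ≤
      √(4 * carlesonConst a C θ) * (√(normSq w f) * √(normSq w g)) := by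
  have hw := H.weight_pos
  have hcoeff := goodDiffSq_nonneg (w := w) (c := c) (good := good) (formOp w b 1)
  have nested : NestedCells fun n => c (n + r + 1) := fun n =>
    H.nested.factorsThrough (by lia)
  have carleson := carleson_embedding hw nested H.carlesonConst_pos hcoeff
    H.carleson_condition g N
  calc _ ≤ ∑ n ∈ Finset.range N, √(normSq w (cellDiff w c n f)) *
        √(∑ p, w p * (goodDiffSq w c good (formOp w b 1) n p *
          ‖cellAvg w (c (n + r + 1)) g p‖ ^ 2)) :=
        norm_sum_le_of_le _ fun n _ => H.norm_bilin_paraproduct_le hf g n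
    _ ≤ √(normSq w f) * √(4 * carlesonConst a C θ * normSq w g) := by
        refine (Real.sum_sqrt_mul_sqrt_le _ (fun n => normSq_nonneg hw _) (fun n =>
          Finset.sum_nonneg fun p _ => mul_nonneg (hw p).le
            (mul_nonneg (hcoeff n p) (sq_nonneg _)))).trans ?_
        gcongr
        exact sum_normSq_cellDiff_le hw H.nested N f
    _ = _ := by
        rw [Real.sqrt_mul (by linarith [H.carlesonConst_pos])]
        ring

omit H in
theorem cellAvg_sub_cellAvg_eq_sum {N : ℕ} (hc : NestedCells c) (hN : ∀ p q, c N p = c N q)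
    (g : P → 𝕜) (n : ℕ) (p q : P) :
    cellAvg w (c n) g q - cellAvg w (c n) g p =
      ∑ j ∈ Finset.range N, (cellDiff w c (n + j) g q - cellDiff w c (n + j) g p) := by
  have top : cellAvg w (c (n + N)) g q = cellAvg w (c (n + N)) g p :=
    cellAvg_factorsThrough g (hc.factorsThrough (Nat.le_add_left N n) (hN q p))
  rw [cellAvg_eq_sum_cellDiff n N g, Finset.sum_sub_distrib]
  simp only [Pi.add_apply, Finset.sum_apply, top, add_sub_add_right_eq_sub]

omit H in
theorem bilin_cellDiff_cellAvg {N : ℕ} (hc : NestedCells c) (hN : ∀ p q, c N p = c N q)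
    (f g : P → 𝕜) (n r : ℕ) :
    bilin b (cellDiff w c n f) (cellAvg w (c n) g) =
      ∑ k ∈ Finset.range (r + 1), bilin b (cellDiff w c n f) (cellDiff w c (k + n) g) +
      (∑ j ∈ Finset.range N, pairing b (fun p q => cellDiff w c n f p *
        (cellDiff w c (n + 1 + (r + j)) g q - cellDiff w c (n + 1 + (r + j)) g p)) +
      bilin b (cellAvg w (c (n + r + 1)) g * cellDiff w c n f) 1) := by
  rw [cellAvg_eq_sum_cellDiff n (r + 1) g, map_add, map_sum, ← add_assoc n r 1,
    bilin_eq_pairing_sub_add _ (cellAvg _ _ g), ← map_sum (pairing b)]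
  simp only [add_comm _ n]
  congr 3
  funext p q
  simp only [Finset.sum_apply, ← Finset.mul_sum, cellAvg_sub_cellAvg_eq_sum hc hN]
  congr 1
  refine Finset.sum_congr rfl fun j _ => ?_
  rw [show n + r + 1 + j = n + 1 + (r + j) by ring]

theorem norm_sum_bilin_cellDiff_cellAvg_le {N : ℕ} (hN : ∀ p q, c N p = c N q) {f : P → 𝕜}
    (hf : IsGoodFunction w c good f) (g : P → 𝕜) :
    ‖∑ n ∈ Finset.range N, bilin b (cellDiff w c n f) (cellAvg w (c n) g)‖ ≤
      upperConst r K a C θ * (√(normSq w f) * √(normSq w g)) := by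
  set Z := √(normSq w f) * √(normSq w g)
  have comparable : ‖∑ k ∈ Finset.range (r + 1), ∑ n ∈ Finset.range N,
      bilin b (cellDiff w c n f) (cellDiff w c (k + n) g)‖ ≤ (r + 1) * (a * √K + C) * Z := by
    refine (norm_sum_le_of_le _ fun k _ => H.norm_sum_bilin_cellDiff_le f g N k).trans_eq ?_
    rw [Finset.sum_const, Finset.card_range, nsmul_eq_mul, Nat.cast_succ, mul_assoc]
  have separated : ‖∑ j ∈ Finset.range N, ∑ n ∈ Finset.range N, pairing b fun p q =>
      cellDiff w c n f p * (cellDiff w c (n + 1 + (r + j)) g q -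
        cellDiff w c (n + 1 + (r + j)) g p)‖ ≤ 2 * C * (1 - θ)⁻¹ * Z := by
    refine (norm_sum_le_of_le _ fun j _ =>
      H.norm_sum_pairing_cellDiff_sub_le hf g N j).trans ?_
    rw [← Finset.sum_mul, ← Finset.mul_sum]
    have := H.C_pos
    gcongr
    exact geom_sum_le_inv_one_sub H.θ_nonneg H.θ_lt_one N
  have paraproduct := H.norm_sum_bilin_paraproduct_le hf g N
  simp only [bilin_cellDiff_cellAvg H.nested hN f g _ r, Finset.sum_add_distrib]
  rw [Finset.sum_comm] at comparable separated
  refine (norm_add_le_of_le comparable (norm_add_le_of_le separated paraproduct)).trans_eq ?_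
  rw [upperConst]
  ring

theorem norm_bilin_cellAvg_top_le {N : ℕ} (hN : ∀ p q, c N p = c N q) (f g : P → 𝕜) :
    ‖bilin b (cellAvg w (c N) f) (cellAvg w (c N) g)‖ ≤ a * (√(normSq w f) * √(normSq w g)) := by
  have ha := H.a_nonneg
  have single_cell : (c N '' {_p | True}).ncard ≤ 1 := by
    rw [Set.ncard_le_one_iff]
    rintro _ _ ⟨p, -, rfl⟩ ⟨q, -, rfl⟩
    exact hN p q
  have h := (H.testing N).norm_pairing_ite_le H.weight_pos ha (K := 1) (R := fun _ _ => True)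
    (fun _ _ _ => rfl) (fun _ => single_cell)
    (cellAvg_factorsThrough (w := w) f) (cellAvg w (c N) g)
  simp only [if_true, Nat.cast_one, Real.sqrt_one, mul_one] at h
  refine h.trans ?_
  gcongr
  · exact normSq_cellAvg_le H.weight_pos f
  · exact normSq_cellAvg_le H.weight_pos g

end IsUpperT1Form

theorem bilin_cellAvg_telescope (f g : P → 𝕜) (N : ℕ) :
    bilin b (cellAvg w (c 0) f) (cellAvg w (c 0) g) =
      bilin b (cellAvg w (c N) f) (cellAvg w (c N) g) +
      (∑ n ∈ Finset.range N, bilin b (cellDiff w c n f) (cellAvg w (c n) g) +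
        ∑ n ∈ Finset.range N, bilin bᵀ (cellDiff w c n g) (cellAvg w (c n) f) -
        ∑ n ∈ Finset.range N, bilin b (cellDiff w c n f) (cellDiff w c n g)) := by
  have h := Finset.sum_range_sub' (fun n => bilin b (cellAvg w (c n) f) (cellAvg w (c n) g)) N
  rw [← sub_eq_iff_eq_add', ← h, ← Finset.sum_add_distrib, ← Finset.sum_sub_distrib]
  refine Finset.sum_congr rfl fun n _ => ?_
  simp only [bilin_transpose, cellDiff_apply, map_sub, LinearMap.sub_apply]
  ring

theorem norm_bilin_le_of_isUpperT1Form (H : IsUpperT1Form w c b near good r K a C θ)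
    (H' : IsUpperT1Form w c bᵀ near good r K a C θ) (hinj : Function.Injective (c 0)) {N : ℕ}
    (hN : ∀ p q, c N p = c N q) {f g : P → 𝕜} (hf : IsGoodFunction w c good f)
    (hg : IsGoodFunction w c good g) :
    ‖bilin b f g‖ ≤ (a + 2 * upperConst r K a C θ + (a * √K + C)) *
      (√(normSq w f) * √(normSq w g)) := by
  have finest : ∀ h : P → 𝕜, cellAvg w (c 0) h = h := fun h =>
    cellAvg_of_factorsThrough H.weight_pos (hinj.factorsThrough h)
  have top := H.norm_bilin_cellAvg_top_le hN f g
  have upper := H.norm_sum_bilin_cellDiff_cellAvg_le hN hf g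
  have lower := H'.norm_sum_bilin_cellDiff_cellAvg_le hN hg f
  have diagonal := H.norm_sum_bilin_cellDiff_le f g N 0
  simp only [zero_add] at diagonal
  have telescope := bilin_cellAvg_telescope (w := w) (c := c) (b := b) f g N
  rw [finest, finest] at telescope
  rw [telescope]
  refine (norm_add_le_of_le top (norm_sub_le_of_le (norm_add_le_of_le upper lower)
    diagonal)).trans_eq ?_
  ring

/-- The martingale transform of `f` with multipliers `e n`. -/
noncomputable def martTransform (w : P → ℝ) (c : ℕ → P → ι) (e : ℕ → P → 𝕜) (N : ℕ)
    (f : P → 𝕜) : P → 𝕜 :=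
  ∑ n ∈ Finset.range N, e n * cellDiff w c n f

theorem cellAvg_martTransform (hw : ∀ p, 0 < w p) (hc : NestedCells c) {e : ℕ → P → 𝕜}
    (he : ∀ n, (e n).FactorsThrough (c (n + 1))) (N m : ℕ) (f : P → 𝕜) :
    cellAvg w (c m) (martTransform w c e N f) =
      ∑ n ∈ Finset.range N, if m ≤ n then e n * cellDiff w c n f else 0 := by
  rw [martTransform, map_sum]
  refine Finset.sum_congr rfl fun n _ => ?_
  split_ifs with h
  · exact cellAvg_of_factorsThrough hw fun p q hpq =>
      mul_cellDiff_factorsThrough hc f (he n) (hc.factorsThrough h hpq)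
  · rw [← cellAvg_cellAvg_of_factorsThrough hw (hc.factorsThrough (Nat.lt_of_not_le h)),
      cellAvg_mul_cellDiff hw hc f (he n), map_zero]

theorem cellDiff_martTransform (hw : ∀ p, 0 < w p) (hc : NestedCells c) {e : ℕ → P → 𝕜}
    (he : ∀ n, (e n).FactorsThrough (c (n + 1))) {N m : ℕ} (hm : m < N) (f : P → 𝕜) :
    cellDiff w c m (martTransform w c e N f) = e m * cellDiff w c m f := by
  rw [cellDiff_apply, cellAvg_martTransform hw hc he, cellAvg_martTransform hw hc he,
    ← Finset.sum_sub_distrib, Finset.sum_eq_single_of_mem m (Finset.mem_range.mpr hm)]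
  · simp
  · intro n _ hn
    by_cases h : m ≤ n
    · rw [if_pos h, if_pos (by lia), sub_self]
    · rw [if_neg h, if_neg (by lia), sub_self]

theorem normSq_martTransform (hw : ∀ p, 0 < w p) (hc : NestedCells c)
    (hinj : Function.Injective (c 0)) {e : ℕ → P → 𝕜}
    (he : ∀ n, (e n).FactorsThrough (c (n + 1))) (N : ℕ) (f : P → 𝕜) :
    normSq w (martTransform w c e N f) =
      ∑ n ∈ Finset.range N, normSq w (e n * cellDiff w c n f) := by
  have finest : cellAvg w (c 0) (martTransform w c e N f) = martTransform w c e N f :=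
    cellAvg_of_factorsThrough hw (hinj.factorsThrough _)
  have coarsest : cellAvg w (c N) (martTransform w c e N f) = 0 := by
    rw [cellAvg_martTransform hw hc he]
    exact Finset.sum_eq_zero fun n hn => if_neg (by simpa using hn)
  rw [← finest, normSq_cellAvg_eq_sum hw hc N, coarsest, normSq_zero, add_zero]
  refine Finset.sum_congr rfl fun n hn => ?_
  rw [cellDiff_martTransform hw hc he (Finset.mem_range.mp hn)]

/-- The part of `f` made of its martingale differences on bad cells at the levels below `N`. -/
noncomputable def badPart (w : P → ℝ) (c : ℕ → P → ι) (good : ℕ → P → Prop) (N : ℕ) :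
    (P → 𝕜) → P → 𝕜 :=
  martTransform w c (fun n => {p | ¬good (n + 1) p}.indicator 1) N

omit [Fintype P] [DecidableEq ι] in
theorem indicator_not_good_factorsThrough (hgood : ∀ n, (good n).FactorsThrough (c n)) (n : ℕ) :
    ({p | ¬good n p}.indicator (1 : P → 𝕜)).FactorsThrough (c n) := fun p q h => by
  classical
  simp only [Set.indicator_apply, Set.mem_ofPred_eq, Pi.one_apply, hgood _ h]

theorem normSq_badPart (hw : ∀ p, 0 < w p) (hc : NestedCells c)
    (hinj : Function.Injective (c 0)) (hgood : ∀ n, (good n).FactorsThrough (c n)) (N : ℕ)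
    (f : P → 𝕜) :
    normSq w (badPart w c good N f) = ∑ n ∈ Finset.range N, ∑ p, w p *
      {p | ¬good (n + 1) p}.indicator (fun p => ‖cellDiff w c n f p‖ ^ 2) p := by
  classical
  rw [badPart, normSq_martTransform hw hc hinj
    (fun n => indicator_not_good_factorsThrough hgood (n + 1))]
  refine Finset.sum_congr rfl fun n _ => Finset.sum_congr rfl fun p _ => ?_
  rw [Pi.mul_apply, Set.indicator_apply, Set.indicator_apply]
  split_ifs <;> simp

theorem isGoodFunction_sub_badPart (hw : ∀ p, 0 < w p) (hc : NestedCells c)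
    (hgood : ∀ n, (good n).FactorsThrough (c n)) {N : ℕ} (hN : ∀ p q, c N p = c N q)
    (f : P → 𝕜) : IsGoodFunction w c good (f - badPart w c good N f) := by
  intro n p hp
  contrapose! hp
  rcases lt_or_ge n N with hn | hn
  · rw [badPart, map_sub, cellDiff_martTransform hw hc
      (fun n => indicator_not_good_factorsThrough hgood (n + 1)) hn, Pi.sub_apply, Pi.mul_apply,
      Set.indicator_of_mem hp, Pi.one_apply, one_mul, sub_self]
  · have const : ∀ m, N ≤ m → ∀ q, c m q = c m p := fun m hm q =>
      hc.factorsThrough hm (hN q p)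
    simp only [cellDiff_apply, Pi.sub_apply, cellAvg_apply, cellMass, const n hn,
      const (n + 1) (by lia), sub_self]

end TreeTheorem

section RandomShift

variable {P 𝕜 : Type*} {d M : ℕ}

/-- The index of the dyadic cell of level `n` of the point `p` in the grid shifted by `a`. -/
def cellIdx (pos : P → Fin d → ℕ) (a : Fin d → ℕ) (n : ℕ) (p : P) : Fin d → ℕ :=
  fun k => (pos p k + a k) / 2 ^ n

/-- The residues modulo `2 ^ j` that are within about `2 ^ (j / 2)` of `0`: the positions of the
cells close to the boundary of a cell that is `j` levels coarser. -/
def boundaryResidues (j : ℕ) : Finset ℕ :=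
  Finset.range (2 ^ (j / 2)) ∪ Finset.Ico (2 ^ j - 2 ^ (j / 2)) (2 ^ j)

/-- The cell of level `n` of `p` is far from the boundaries of the cells that contain it and are
at least `r` levels coarser, up to level `M`. -/
def IsGoodCell (r M : ℕ) (pos : P → Fin d → ℕ) (a : Fin d → ℕ) (n : ℕ) (p : P) : Prop :=
  ∀ j, r ≤ j → n + j ≤ M → ∀ k, cellIdx pos a n p k % 2 ^ j ∉ boundaryResidues j

/-- Two cell indices differ by at most `κ` in every coordinate. -/
def NearIdx (κ : ℕ) (v v' : Fin d → ℕ) : Prop := ∀ k, v k ≤ v' k + κ ∧ v' k ≤ v k + κ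

/-- The natural number representatives of a shift in the discrete torus. -/
def shiftVal (a : Fin d → ZMod (2 ^ M)) : Fin d → ℕ := fun k => (a k).val

/-- A bound for the proportion of shifts for which a given cell is bad. -/
noncomputable def badProb (d r : ℕ) : ℝ := d * (2 * (√(1 / 2) ^ r / (1 - √(1 / 2))))

theorem cellIdx_add (pos : P → Fin d → ℕ) (a : Fin d → ℕ) (m n : ℕ) (p : P) :
    cellIdx pos a (m + n) p = fun k => cellIdx pos a m p k / 2 ^ n := by
  ext k
  rw [cellIdx, cellIdx, pow_add, Nat.div_div_eq_div_mul]

theorem cellIdx_add_pow_smul (pos : P → Fin d → ℕ) (a v : Fin d → ℕ) (n : ℕ) (p : P) :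
    cellIdx pos (a + 2 ^ n • v) n p = cellIdx pos a n p + v := by
  ext k
  rw [cellIdx, Pi.add_apply, Pi.smul_apply, smul_eq_mul, ← add_assoc,
    Nat.add_mul_div_left _ _ (by positivity), Pi.add_apply, cellIdx]

theorem nestedCells_cellIdx (pos : P → Fin d → ℕ) (a : Fin d → ℕ) :
    NestedCells (cellIdx pos a) :=
  fun n p q h => by rw [cellIdx_add, cellIdx_add, h]

theorem cellIdx_zero_injective {pos : P → Fin d → ℕ} (hpos : Function.Injective pos)
    (a : Fin d → ℕ) : Function.Injective (cellIdx pos a 0) :=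
  fun p q h => hpos <| funext fun k => by simpa [cellIdx] using congrFun h k

theorem cellIdx_eq_zero {pos : P → Fin d → ℕ} {a : Fin d → ℕ} (hpos : ∀ p k, pos p k < 2 ^ M)
    (ha : ∀ k, a k < 2 ^ M) {n : ℕ} (hn : M + 1 ≤ n) (p : P) : cellIdx pos a n p = 0 := by
  ext k
  refine Nat.div_eq_of_lt ?_
  calc pos p k + a k < 2 ^ M + 2 ^ M := add_lt_add (hpos p k) (ha k)
    _ = 2 ^ (M + 1) := by ring
    _ ≤ 2 ^ n := Nat.pow_le_pow_right two_pos hn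

theorem isGoodCell_factorsThrough (r M : ℕ) (pos : P → Fin d → ℕ) (a : Fin d → ℕ) (n : ℕ) :
    (IsGoodCell r M pos a n).FactorsThrough (cellIdx pos a n) :=
  fun p q h => by simp only [IsGoodCell, h]

theorem ncard_cellIdx_nearIdx_le (pos : P → Fin d → ℕ) (a : Fin d → ℕ) (κ n : ℕ) (q : P) :
    (cellIdx pos a n '' {p | NearIdx κ (cellIdx pos a (n + 1) p) (cellIdx pos a (n + 1) q)}).ncard
      ≤ (4 * κ + 2) ^ d := by
  set V := cellIdx pos a (n + 1) q
  set B := Fintype.piFinset fun k => Finset.Icc (2 * V k - 2 * κ) (2 * V k + 2 * κ + 1)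
  have sub_box : cellIdx pos a n '' {p | NearIdx κ (cellIdx pos a (n + 1) p) V} ⊆ B := by
    rintro _ ⟨p, hp, rfl⟩
    refine Finset.mem_coe.mpr (Fintype.mem_piFinset.mpr fun k => Finset.mem_Icc.mpr ?_)
    have h := hp k
    simp only [cellIdx_add, pow_one] at h
    lia
  refine (Set.ncard_le_ncard sub_box B.finite_toSet).trans ?_
  rw [Set.ncard_coe_finset, Fintype.card_piFinset]
  refine (Finset.prod_le_pow_card _ _ (4 * κ + 2) fun k _ => ?_).trans_eq (by simp)
  rw [Nat.card_Icc]
  lia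

theorem exists_shiftVal_add_single (a : Fin d → ZMod (2 ^ M)) (k : Fin d) (x : ℕ) :
    ∃ E : ℕ, shiftVal (a + Pi.single k (x : ZMod (2 ^ M))) + Pi.single k (2 ^ M * E) =
      shiftVal a + Pi.single k x := by
  refine ⟨((a k).val + x) / 2 ^ M, ?_⟩
  ext i
  rcases eq_or_ne i k with rfl | hi
  · simp only [shiftVal, Pi.add_apply, Pi.single_eq_same, ZMod.val_add, ZMod.val_natCast,
      Nat.add_mod_mod, Nat.mod_add_div]
  · simp [shiftVal, hi]

theorem exists_cellIdx_shiftVal_add_single (pos : P → Fin d → ℕ) {n s e : ℕ}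
    (hM : n + s + e = M) (k : Fin d) (a : Fin d → ZMod (2 ^ M)) (v : ℕ) :
    ∃ E : ℕ, ∀ p, cellIdx pos (shiftVal (a + Pi.single k ((2 ^ (n + s) * v : ℕ) : ZMod (2 ^ M))))
        n p + Pi.single k (2 ^ (s + e) * E) =
      cellIdx pos (shiftVal a) n p + Pi.single k (2 ^ s * v) := by
  obtain ⟨E, hE⟩ := exists_shiftVal_add_single a k (2 ^ (n + s) * v)
  refine ⟨E, fun p => ?_⟩
  rw [← cellIdx_add_pow_smul, ← cellIdx_add_pow_smul, ← Pi.single_smul, ← Pi.single_smul,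
    smul_eq_mul, smul_eq_mul, ← mul_assoc, ← mul_assoc, ← pow_add, ← pow_add, ← add_assoc, hM, hE]

theorem cellIdx_shiftVal_add_single_eq_iff (pos : P → Fin d → ℕ) {n n' : ℕ} (hn : n' ≤ n)
    (hnM : n ≤ M) (k : Fin d) (a : Fin d → ZMod (2 ^ M)) (v : ℕ) (p q : P) :
    cellIdx pos (shiftVal (a + Pi.single k ((2 ^ n * v : ℕ) : ZMod (2 ^ M)))) n' q =
      cellIdx pos (shiftVal (a + Pi.single k ((2 ^ n * v : ℕ) : ZMod (2 ^ M)))) n' p ↔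
    cellIdx pos (shiftVal a) n' q = cellIdx pos (shiftVal a) n' p := by
  obtain ⟨s, rfl⟩ := Nat.exists_eq_add_of_le hn
  obtain ⟨e, he⟩ := Nat.exists_eq_add_of_le hnM
  obtain ⟨E, hE⟩ := exists_cellIdx_shiftVal_add_single pos he.symm k a v
  rw [← add_left_inj, hE, hE, add_left_inj]

theorem cellIdx_shiftVal_add_single_mod (pos : P → Fin d → ℕ) {n j : ℕ} (hnj : n + j ≤ M)
    (k : Fin d) (a : Fin d → ZMod (2 ^ M)) (v : ℕ) (p : P) :
    cellIdx pos (shiftVal (a + Pi.single k ((2 ^ n * v : ℕ) : ZMod (2 ^ M)))) n p k % 2 ^ j =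
      (cellIdx pos (shiftVal a) n p k + v) % 2 ^ j := by
  obtain ⟨e, he⟩ := Nat.exists_eq_add_of_le hnj
  obtain ⟨E, hE⟩ := exists_cellIdx_shiftVal_add_single (n := n) (s := 0) (e := j + e) pos
    (by rw [he]; ring) k a v
  have h := congrFun (hE p) k
  simp only [Pi.add_apply, Pi.single_eq_same, add_zero, zero_add, pow_zero, one_mul] at h
  rw [← h, pow_add, mul_assoc, Nat.add_mul_mod_self_left]

theorem card_filter_add_mod_le (m x : ℕ) (Z : Finset ℕ) :
    ((Finset.range m).filter fun v => (x + v) % m ∈ Z).card ≤ Z.card := by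
  refine Finset.card_le_card_of_injOn (fun v => (x + v) % m)
    (fun v hv => (Finset.mem_filter.mp hv).2) fun v hv v' hv' h => ?_
  exact (Nat.ModEq.add_left_cancel' x h).eq_of_lt_of_lt
    (Finset.mem_range.mp (Finset.mem_filter.mp hv).1)
    (Finset.mem_range.mp (Finset.mem_filter.mp hv').1)

/- Averaging over the translations of the shift by multiples of `2 ^ n` makes the position of a
cell of level `n` inside the cell of level `n + j` equidistributed. -/
theorem sum_indicator_cellIdx_mod_mem_le (pos : P → Fin d → ℕ) {n j : ℕ} (hnj : n + j ≤ M)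
    (k : Fin d) (p : P) (Z : Finset ℕ) {F : (Fin d → ZMod (2 ^ M)) → ℝ} (hF : 0 ≤ F)
    (hinv : ∀ a (v : ℕ), F (a + Pi.single k ((2 ^ n * v : ℕ) : ZMod (2 ^ M))) = F a) :
    2 ^ j * ∑ a, {a | cellIdx pos (shiftVal a) n p k % 2 ^ j ∈ Z}.indicator F a ≤
      Z.card * ∑ a, F a := by
  have translate : ∀ v : ℕ,
      ∑ a, {a | cellIdx pos (shiftVal a) n p k % 2 ^ j ∈ Z}.indicator F a =
        ∑ a, {a | (cellIdx pos (shiftVal a) n p k + v) % 2 ^ j ∈ Z}.indicator F a := fun v => by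
    rw [← Equiv.sum_comp (Equiv.addRight (Pi.single k ((2 ^ n * v : ℕ) : ZMod (2 ^ M))))]
    simp only [Equiv.coe_addRight, Set.indicator_apply, Set.mem_ofPred_eq, hinv,
      cellIdx_shiftVal_add_single_mod pos hnj]
  calc 2 ^ j * ∑ a, {a | cellIdx pos (shiftVal a) n p k % 2 ^ j ∈ Z}.indicator F a
      = ∑ v ∈ Finset.range (2 ^ j),
          ∑ a, {a | (cellIdx pos (shiftVal a) n p k + v) % 2 ^ j ∈ Z}.indicator F a := by
        rw [← Finset.sum_congr rfl fun v _ => translate v, Finset.sum_const, Finset.card_range,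
          nsmul_eq_mul, Nat.cast_pow, Nat.cast_ofNat]
    _ = ∑ a, ((Finset.range (2 ^ j)).filter fun v =>
          (cellIdx pos (shiftVal a) n p k + v) % 2 ^ j ∈ Z).card * F a := by
        rw [Finset.sum_comm]
        simp only [Set.indicator_apply, Set.mem_ofPred_eq, ← Finset.sum_filter, Finset.sum_const,
          nsmul_eq_mul]
    _ ≤ ∑ a, Z.card * F a := Finset.sum_le_sum fun a _ =>
        mul_le_mul_of_nonneg_right (mod_cast card_filter_add_mod_le _ _ Z) (hF a)
    _ = Z.card * ∑ a, F a := (Finset.mul_sum _ _ _).symm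

theorem card_boundaryResidues_le (j : ℕ) : (boundaryResidues j).card ≤ 2 * 2 ^ (j / 2) := by
  refine (Finset.card_union_le _ _).trans ?_
  rw [Finset.card_range, Nat.card_Ico]
  lia

theorem two_pow_half_div_two_pow_le (j : ℕ) : (2 : ℝ) ^ (j / 2) / 2 ^ j ≤ √(1 / 2) ^ j := by
  refine le_of_sq_le_sq ?_ (by positivity)
  calc ((2 : ℝ) ^ (j / 2) / 2 ^ j) ^ 2 = 2 ^ (j / 2 * 2) / (2 ^ j * 2 ^ j) := by
        rw [div_pow, ← pow_mul, sq ((2 : ℝ) ^ j)]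
    _ ≤ 2 ^ j / (2 ^ j * 2 ^ j) := by
        gcongr
        · exact one_le_two
        · exact Nat.div_mul_le_self j 2
    _ = (√(1 / 2) ^ j) ^ 2 := by
        rw [← pow_mul, mul_comm j, pow_mul, Real.sq_sqrt (by norm_num), one_div_pow]
        field_simp

theorem sqrt_half_lt_one : √(1 / 2) < 1 := (Real.sqrt_lt' one_pos).mpr (by norm_num)

theorem badProb_nonneg (d r : ℕ) : 0 ≤ badProb d r := by
  have := sub_pos.mpr sqrt_half_lt_one
  unfold badProb
  positivity

theorem tendsto_badProb (d : ℕ) : Filter.Tendsto (badProb d) Filter.atTop (nhds 0) := by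
  have h := tendsto_pow_atTop_nhds_zero_of_lt_one (Real.sqrt_nonneg (1 / 2)) sqrt_half_lt_one
  have h' := ((h.div_const (1 - √(1 / 2))).const_mul 2).const_mul (d : ℝ)
  simp only [zero_div, mul_zero] at h'
  exact h'

theorem sum_card_boundaryResidues_div_le (d r m : ℕ) :
    ∑ j ∈ Finset.Ico r m, (d : ℝ) * ((boundaryResidues j).card / 2 ^ j) ≤ badProb d r := by
  have term : ∀ j, ((boundaryResidues j).card / 2 ^ j : ℝ) ≤ 2 * √(1 / 2) ^ j := fun j =>
    calc ((boundaryResidues j).card / 2 ^ j : ℝ) ≤ 2 * 2 ^ (j / 2) / 2 ^ j := by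
          gcongr
          exact_mod_cast card_boundaryResidues_le j
      _ ≤ 2 * √(1 / 2) ^ j := by
          rw [mul_div_assoc]
          gcongr
          exact two_pow_half_div_two_pow_le j
  calc ∑ j ∈ Finset.Ico r m, (d : ℝ) * ((boundaryResidues j).card / 2 ^ j)
      ≤ ∑ j ∈ Finset.Ico r m, d * (2 * √(1 / 2) ^ j) := by
        gcongr
        exact term _
    _ ≤ badProb d r := by
        rw [← Finset.mul_sum, ← Finset.mul_sum, badProb]
        gcongr
        exact geom_sum_Ico_le_of_lt_one (Real.sqrt_nonneg _) sqrt_half_lt_one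

theorem indicator_not_isGoodCell_le (pos : P → Fin d → ℕ) (r n : ℕ) (p : P)
    {F : (Fin d → ZMod (2 ^ M)) → ℝ} (hF : 0 ≤ F) :
    {a | ¬IsGoodCell r M pos (shiftVal a) n p}.indicator F ≤ ∑ j ∈ Finset.Ico r (M + 1 - n),
      ∑ k, {a | cellIdx pos (shiftVal a) n p k % 2 ^ j ∈ boundaryResidues j}.indicator F := by
  set B : ℕ → Fin d → (Fin d → ZMod (2 ^ M)) → ℝ := fun j k =>
    {a | cellIdx pos (shiftVal a) n p k % 2 ^ j ∈ boundaryResidues j}.indicator F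
  have hB : ∀ j k, 0 ≤ B j k := fun j k => Set.indicator_nonneg fun a _ => hF a
  have hBsum : ∀ j, 0 ≤ ∑ k, B j k := fun j => Finset.sum_nonneg fun k _ => hB j k
  refine Set.indicator_le' (fun a ha => ?_) fun a _ => Finset.sum_nonneg (fun j _ => hBsum j) a
  simp only [IsGoodCell, Set.mem_ofPred_eq, not_forall, not_not] at ha
  obtain ⟨j, hj, hjM, k, hk⟩ := ha
  have hk_le : B j k ≤ ∑ k, B j k :=
    Finset.single_le_sum (fun k _ => hB j k) (Finset.mem_univ k)
  have hj_le : ∑ k, B j k ≤ ∑ j ∈ Finset.Ico r (M + 1 - n), ∑ k, B j k :=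
    Finset.single_le_sum (f := fun j => ∑ k, B j k) (fun j _ => hBsum j)
      (Finset.mem_Ico.mpr ⟨hj, by lia⟩)
  have hFB : F a = B j k a :=
    (Set.indicator_of_mem (s := {a | cellIdx pos (shiftVal a) n p k % 2 ^ j ∈ boundaryResidues j})
      hk F).symm
  exact hFB.trans_le ((hk_le.trans hj_le) a)

theorem sum_indicator_not_isGoodCell_le (pos : P → Fin d → ℕ) (r n : ℕ) (p : P)
    {F : (Fin d → ZMod (2 ^ M)) → ℝ} (hF : 0 ≤ F)
    (hinv : n ≤ M → ∀ k a (v : ℕ), F (a + Pi.single k ((2 ^ n * v : ℕ) : ZMod (2 ^ M))) = F a) :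
    ∑ a, {a | ¬IsGoodCell r M pos (shiftVal a) n p}.indicator F a ≤ badProb d r * ∑ a, F a := by
  set bad : ℕ → Fin d → Set (Fin d → ZMod (2 ^ M)) := fun j k =>
    {a | cellIdx pos (shiftVal a) n p k % 2 ^ j ∈ boundaryResidues j}
  set J := Finset.Ico r (M + 1 - n)
  have hJ : ∀ j ∈ J, n + j ≤ M := fun j hj => by
    have := (Finset.mem_Ico.mp hj).2
    lia
  have single_le : ∀ j ∈ J, ∀ k,
      ∑ a, (bad j k).indicator F a ≤ (boundaryResidues j).card / 2 ^ j * ∑ a, F a := by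
    intro j hj k
    rw [div_mul_eq_mul_div, le_div_iff₀' (by positivity)]
    exact sum_indicator_cellIdx_mod_mem_le pos (hJ j hj) k p _ hF
      (hinv ((Nat.le_add_right n j).trans (hJ j hj)) k)
  calc ∑ a, {a | ¬IsGoodCell r M pos (shiftVal a) n p}.indicator F a
      ≤ ∑ a, ∑ j ∈ J, ∑ k, (bad j k).indicator F a := Finset.sum_le_sum fun a _ => by
        simpa only [Finset.sum_apply] using indicator_not_isGoodCell_le pos r n p hF a
    _ = ∑ j ∈ J, ∑ k, ∑ a, (bad j k).indicator F a := by
        rw [Finset.sum_comm]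
        exact Finset.sum_congr rfl fun j _ => Finset.sum_comm
    _ ≤ ∑ j ∈ J, ∑ _k : Fin d, (boundaryResidues j).card / 2 ^ j * ∑ a, F a :=
        Finset.sum_le_sum fun j hj => Finset.sum_le_sum fun k _ => single_le j hj k
    _ = (∑ j ∈ J, (d : ℝ) * ((boundaryResidues j).card / 2 ^ j)) * ∑ a, F a := by
        simp only [Finset.sum_const, Finset.card_univ, Fintype.card_fin, nsmul_eq_mul, mul_assoc,
          Finset.sum_mul]
    _ ≤ badProb d r * ∑ a, F a := mul_le_mul_of_nonneg_right
        (sum_card_boundaryResidues_div_le d r _) (Finset.sum_nonneg fun a _ => hF a)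

variable [Fintype P] [RCLike 𝕜] {w : P → ℝ}

theorem cellAvg_congr_cells {ι ι' : Type*} [DecidableEq ι] [DecidableEq ι'] {c : P → ι}
    {c' : P → ι'} (f : P → 𝕜) {p : P} (h : ∀ q, c q = c p ↔ c' q = c' p) :
    cellAvg w c f p = cellAvg w c' f p := by
  simp only [cellAvg_apply, cellMass, h]

theorem cellDiff_shiftVal_add_single (pos : P → Fin d → ℕ) {n : ℕ} (hn : n + 1 ≤ M) (k : Fin d)
    (a : Fin d → ZMod (2 ^ M)) (v : ℕ) (f : P → 𝕜) (p : P) :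
    cellDiff w (cellIdx pos
      (shiftVal (a + Pi.single k ((2 ^ (n + 1) * v : ℕ) : ZMod (2 ^ M))))) n f p =
    cellDiff w (cellIdx pos (shiftVal a)) n f p := by
  simp only [cellDiff_apply, Pi.sub_apply]
  congr 1
  · exact cellAvg_congr_cells f fun q =>
      cellIdx_shiftVal_add_single_eq_iff pos n.le_succ hn k a v p q
  · exact cellAvg_congr_cells f fun q =>
      cellIdx_shiftVal_add_single_eq_iff pos le_rfl hn k a v p q

theorem sum_normSq_badPart_le (hw : ∀ p, 0 < w p) {pos : P → Fin d → ℕ}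
    (hpos : Function.Injective pos) (r N : ℕ) (f : P → 𝕜) :
    ∑ a : Fin d → ZMod (2 ^ M),
      normSq w (badPart w (cellIdx pos (shiftVal a)) (IsGoodCell r M pos (shiftVal a)) N f) ≤
      badProb d r * (Fintype.card (Fin d → ZMod (2 ^ M)) * normSq w f) := by
  set c : (Fin d → ZMod (2 ^ M)) → ℕ → P → Fin d → ℕ := fun a => cellIdx pos (shiftVal a)
  set bad : ℕ → P → Set (Fin d → ZMod (2 ^ M)) := fun n p =>
    {a | ¬IsGoodCell r M pos (shiftVal a) (n + 1) p}
  set D : ℕ → P → (Fin d → ZMod (2 ^ M)) → ℝ := fun n p a => ‖cellDiff w (c a) n f p‖ ^ 2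
  have hc : ∀ a, NestedCells (c a) := fun a => nestedCells_cellIdx _ _
  calc _ = ∑ a, ∑ n ∈ Finset.range N, ∑ p, w p * (bad n p).indicator (D n p) a :=
        Finset.sum_congr rfl fun a _ => normSq_badPart hw (hc a) (cellIdx_zero_injective hpos _)
          (isGoodCell_factorsThrough r M pos _) N f
    _ = ∑ n ∈ Finset.range N, ∑ p, w p * ∑ a, (bad n p).indicator (D n p) a := by
        rw [Finset.sum_comm]
        refine Finset.sum_congr rfl fun n _ => ?_
        rw [Finset.sum_comm]
        simp only [Finset.mul_sum]
    _ ≤ ∑ n ∈ Finset.range N, ∑ p, w p * (badProb d r * ∑ a, D n p a) := by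
        gcongr with n _ p
        · exact (hw p).le
        · exact sum_indicator_not_isGoodCell_le pos r (n + 1) p (fun a => sq_nonneg _)
            fun hn k a v => by simp only [D, c, cellDiff_shiftVal_add_single pos hn k a v f p]
    _ = badProb d r * ∑ a, ∑ n ∈ Finset.range N, normSq w (cellDiff w (c a) n f) := by
        conv_rhs => rw [Finset.sum_comm, Finset.mul_sum]
        refine Finset.sum_congr rfl fun n _ => ?_
        conv_rhs => simp only [normSq]; rw [Finset.sum_comm, Finset.mul_sum]
        refine Finset.sum_congr rfl fun p _ => ?_
        rw [← Finset.mul_sum]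
        ring
    _ ≤ badProb d r * ∑ _a : Fin d → ZMod (2 ^ M), normSq w f :=
        mul_le_mul_of_nonneg_left
          (Finset.sum_le_sum fun a _ => sum_normSq_cellDiff_le hw (hc a) N f) (badProb_nonneg d r)
    _ = _ := by rw [Finset.sum_const, nsmul_eq_mul, Finset.card_univ]

theorem exists_le_two_mul_of_sum_le {α : Type*} [Fintype α] [Nonempty α] {u v : α → ℝ}
    (hu : 0 ≤ u) (hv : 0 ≤ v) {x y s : ℝ} (hx : 0 < x) (hy : 0 < y)
    (hux : ∑ a, u a ≤ s * (Fintype.card α * x)) (hvy : ∑ a, v a ≤ s * (Fintype.card α * y)) :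
    ∃ a, u a ≤ 2 * s * x ∧ v a ≤ 2 * s * y := by
  obtain ⟨a, -, ha⟩ := Finset.exists_le_of_sum_le (s := Finset.univ)
    (f := fun a => u a / x + v a / y) (g := fun _ => 2 * s) Finset.univ_nonempty (by
      rw [Finset.sum_add_distrib, ← Finset.sum_div, ← Finset.sum_div, Finset.sum_const,
        nsmul_eq_mul, Finset.card_univ]
      rw [← mul_assoc, ← div_le_iff₀ hx] at hux
      rw [← mul_assoc, ← div_le_iff₀ hy] at hvy
      linarith)
  have hua := div_nonneg (hu a) hx.le
  have hva := div_nonneg (hv a) hy.le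
  exact ⟨a, (div_le_iff₀ hx).mp (by linarith), (div_le_iff₀ hy).mp (by linarith)⟩

theorem exists_shift_normSq_badPart_le (hw : ∀ p, 0 < w p) {pos : P → Fin d → ℕ}
    (hpos : Function.Injective pos) (r M N : ℕ) {f g : P → 𝕜} (hf : 0 < normSq w f)
    (hg : 0 < normSq w g) :
    ∃ a : Fin d → ZMod (2 ^ M), ∀ h ∈ ({f, g} : Set (P → 𝕜)),
      normSq w (badPart w (cellIdx pos (shiftVal a)) (IsGoodCell r M pos (shiftVal a)) N h) ≤
        2 * badProb d r * normSq w h := by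
  obtain ⟨a, hfa, hga⟩ := exists_le_two_mul_of_sum_le (fun _ => normSq_nonneg hw _)
    (fun _ => normSq_nonneg hw _) hf hg (sum_normSq_badPart_le (M := M) hw hpos r N f)
    (sum_normSq_badPart_le hw hpos r N g)
  refine ⟨a, ?_⟩
  rintro h (rfl | rfl)
  exacts [hfa, hga]

end RandomShift

section Growth

theorem rpow_neg_le_tsum_indicator_ball {E : Type*} [PseudoMetricSpace E] {x y : E} {ρ β : ℝ}
    (hρ : 0 < ρ) (hβ : 0 ≤ β) (hy : ρ ≤ dist x y) :
    ENNReal.ofReal (dist x y ^ (-β)) ≤ ∑' k : ℕ, (ball x (2 ^ (k + 1) * ρ)).indicator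
      (fun _ => ENNReal.ofReal ((2 ^ k * ρ) ^ (-β))) y := by
  obtain ⟨k, hk, hk'⟩ := exists_nat_pow_near (x := dist x y / ρ) (y := 2)
    ((one_le_div hρ).mpr hy) one_lt_two
  rw [le_div_iff₀ hρ] at hk
  rw [div_lt_iff₀ hρ] at hk'
  refine le_trans ?_ (ENNReal.le_tsum k)
  rw [indicator_of_mem (mem_ball'.mpr hk')]
  exact ENNReal.ofReal_le_ofReal
    (Real.rpow_le_rpow_of_nonpos (by positivity) hk (neg_nonpos.mpr hβ))

theorem two_pow_mul_rpow_neg_mul_rpow {ρ c m τ : ℝ} (hρ : 0 < ρ) (hc : 0 ≤ c) (k : ℕ) :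
    (2 ^ k * ρ) ^ (-(m + τ)) * (c * (2 ^ k * ρ)) ^ m = c ^ m * ρ ^ (-τ) * (2 ^ (-τ)) ^ k := by
  have hpow : ((2 : ℝ) ^ k) ^ (-τ) = (2 ^ (-τ)) ^ k := by
    exact Real.rpow_pow_comm zero_le_two _ _ |>.symm
  rw [Real.mul_rpow hc (by positivity), neg_add, Real.rpow_add (by positivity),
    Real.rpow_neg (by positivity) m, Real.mul_rpow (z := -τ) (by positivity) hρ.le, hpow]
  have : ((2 : ℝ) ^ k * ρ) ^ m ≠ 0 := by positivity
  field_simp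

theorem lintegral_indicator_ball_rpow_neg_le {E : Type*} [PseudoMetricSpace E] [MeasurableSpace E]
    [OpensMeasurableSpace E] {μ : Measure E} {x : E} {D m τ ρ : ℝ} (hρ : 0 < ρ)
    (hD : D ≤ 16 * ρ) (hgrow : ∀ r, D < r → μ (ball x r) ≤ ENNReal.ofReal (r ^ m)) (k : ℕ) :
    ∫⁻ y, (ball x (2 ^ (k + 1) * ρ)).indicator
        (fun _ => ENNReal.ofReal ((2 ^ k * ρ) ^ (-(m + τ)))) y ∂μ ≤
      ENNReal.ofReal (32 ^ m * ρ ^ (-τ) * (2 ^ (-τ)) ^ k) := by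
  have hk : ρ ≤ 2 ^ k * ρ := le_mul_of_one_le_left hρ.le (one_le_pow₀ one_le_two)
  -- The ball is enlarged to radius `32 * (2 ^ k * ρ) > D`, where the growth bound is available.
  have hmass : μ (ball x (2 ^ (k + 1) * ρ)) ≤ ENNReal.ofReal ((32 * (2 ^ k * ρ)) ^ m) := by
    refine (measure_mono (ball_subset_ball ?_)).trans (hgrow _ (by linarith))
    rw [pow_succ]
    linarith
  rw [lintegral_indicator_const measurableSet_ball]
  refine (mul_le_mul_right hmass _).trans_eq ?_
  rw [← ENNReal.ofReal_mul (by positivity), two_pow_mul_rpow_neg_mul_rpow hρ (by norm_num)]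

theorem lintegral_dist_rpow_neg_le {E : Type*} [PseudoMetricSpace E] [MeasurableSpace E]
    [OpensMeasurableSpace E] (μ : Measure E) (x : E) {D m τ s : ℝ} (hm : 0 < m)
    (hτ : 0 < τ) (hs : 0 < s)
    (hgrow : ∀ r, D < r → μ (ball x r) ≤ ENNReal.ofReal (r ^ m)) :
    ∫⁻ y, (if s ≤ dist x y ∧ D ≤ 16 * dist x y then
      ENNReal.ofReal (dist x y ^ (-(m + τ))) else 0) ∂μ ≤
      ENNReal.ofReal (32 ^ m / (1 - 2 ^ (-τ)) * s ^ (-τ)) := by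
  set ρ := max s (D / 16)
  have hρ0 : 0 < ρ := lt_max_of_lt_left hs
  have hq : (2 : ℝ) ^ (-τ) < 1 := Real.rpow_lt_one_of_one_lt_of_neg one_lt_two (by linarith)
  have hq0 : (0 : ℝ) < 2 ^ (-τ) := by positivity
  have hpt : ∀ y, (if s ≤ dist x y ∧ D ≤ 16 * dist x y then
      ENNReal.ofReal (dist x y ^ (-(m + τ))) else 0) ≤
      ∑' k : ℕ, (ball x (2 ^ (k + 1) * ρ)).indicator
        (fun _ => ENNReal.ofReal ((2 ^ k * ρ) ^ (-(m + τ)))) y := by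
    intro y
    split_ifs with h
    · exact rpow_neg_le_tsum_indicator_ball hρ0 (by positivity)
        (max_le h.1 (by linarith [h.2]))
    · exact zero_le
  have hterm : ∀ k : ℕ, ∫⁻ y, (ball x (2 ^ (k + 1) * ρ)).indicator
        (fun _ => ENNReal.ofReal ((2 ^ k * ρ) ^ (-(m + τ)))) y ∂μ ≤
      ENNReal.ofReal (32 ^ m * s ^ (-τ) * (2 ^ (-τ)) ^ k) := fun k => by
    have hρs : ρ ^ (-τ) ≤ s ^ (-τ) :=
      Real.rpow_le_rpow_of_nonpos hs (le_max_left _ _) (by linarith)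
    refine (lintegral_indicator_ball_rpow_neg_le hρ0 (by linarith [le_max_right s (D / 16)])
      hgrow k).trans ?_
    gcongr
  calc _ ≤ ∫⁻ y, ∑' k : ℕ, (ball x (2 ^ (k + 1) * ρ)).indicator
        (fun _ => ENNReal.ofReal ((2 ^ k * ρ) ^ (-(m + τ)))) y ∂μ := lintegral_mono hpt
    _ = ∑' k : ℕ, ∫⁻ y, (ball x (2 ^ (k + 1) * ρ)).indicator
        (fun _ => ENNReal.ofReal ((2 ^ k * ρ) ^ (-(m + τ)))) y ∂μ :=
        lintegral_tsum fun k => (measurable_const.indicator measurableSet_ball).aemeasurable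
    _ ≤ ∑' k : ℕ, ENNReal.ofReal (32 ^ m * s ^ (-τ) * (2 ^ (-τ)) ^ k) := ENNReal.tsum_le_tsum hterm
    _ = ENNReal.ofReal (∑' k : ℕ, 32 ^ m * s ^ (-τ) * (2 ^ (-τ)) ^ k) :=
        (ENNReal.ofReal_tsum_of_nonneg (fun k => by positivity)
          ((summable_geometric_of_lt_one hq0.le hq).mul_left _)).symm
    _ = _ := by
        rw [tsum_mul_left, tsum_geometric_of_lt_one hq0.le hq]
        congr 1
        ring

end Growth

section MulKernel

variable {E 𝕜 : Type*} [RCLike 𝕜] {S : Set E} {φ : E → E → ℝ} {k : E → E → 𝕜}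

open Classical in
/-- The kernel `k` multiplied by a real function `φ` and restricted to `S × S` off the diagonal. -/
noncomputable def mulKernel (S : Set E) (φ : E → E → ℝ) (k : E → E → 𝕜) (x y : E) : 𝕜 :=
  if x ∈ S ∧ y ∈ S ∧ x ≠ y then (φ x y : 𝕜) * k x y else 0

theorem norm_mulKernel_le (h0 : ∀ x y, 0 ≤ φ x y) (h1 : ∀ x y, φ x y ≤ 1) (x y : E) :
    ‖mulKernel S φ k x y‖ ≤ ‖k x y‖ := by
  rw [mulKernel]
  split_ifs
  · rw [norm_mul, RCLike.norm_ofReal, abs_of_nonneg (h0 x y)]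
    exact mul_le_of_le_one_left (norm_nonneg _) (h1 x y)
  · rw [norm_zero]
    exact norm_nonneg _

theorem mulKernel_swap (hφ : ∀ x y, φ x y = φ y x) (x y : E) :
    mulKernel S φ (fun x y => k y x) x y = mulKernel S φ k y x := by
  rw [mulKernel, mulKernel, hφ x y]
  congr 1
  rw [ne_comm, and_left_comm]

end MulKernel

section Suppression

variable {E : Type*} [MetricSpace E] {𝕜 : Type*} [RCLike 𝕜]

/-- A Calderón–Zygmund kernel `k` on `S` with a `1`-Lipschitz scale function `δ` (a truncation of
the distance to the complement of `H`) such that `k x y` has size at most `(δ x ^ m)⁻¹`. -/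
structure IsScaledKernel (S : Set E) (δ : E → ℝ) (m C τ : ℝ) (k : E → E → 𝕜) : Prop where
  nonneg : ∀ x, 0 ≤ δ x
  lipschitz : ∀ x y, δ x ≤ δ y + dist x y
  size : ∀ x ∈ S, ∀ y ∈ S, x ≠ y → ‖k x y‖ ≤ C / dist x y ^ m
  smooth : ∀ x ∈ S, ∀ x' ∈ S, ∀ y ∈ S, x ≠ y → dist x x' ≤ 1 / 2 * dist x y →
    ‖k y x - k y x'‖ + ‖k x y - k x' y‖ ≤ C * (dist x x' ^ τ / dist x y ^ (m + τ))
  bound : ∀ x ∈ S, ∀ y ∈ S, δ x ^ m * ‖k x y‖ ≤ 1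

/-- A cutoff that vanishes at distances below `(δ x + δ y) / 8` and equals `1` at distances above
twice that. Suppressing a kernel by it keeps the smoothness, because `δ` is Lipschitz. -/
noncomputable def cutoff (δ : E → ℝ) (x y : E) : ℝ :=
  min 1 (2 * (1 - min ((δ x + δ y) / 8) (dist x y) / dist x y))

/-- The weight in the smoothness estimate of a suppressed kernel: `dist x y ^ (-(m + τ))`, cut off
at small distances, where `μ` need not have growth of order `m`. -/
noncomputable def smoothWeight (δ : E → ℝ) (m τ : ℝ) (x y : E) : ℝ :=
  if δ x + δ y ≤ 16 * dist x y then dist x y ^ (-(m + τ)) else 0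

variable {δ : E → ℝ} {m C τ : ℝ}

theorem cutoff_comm (x y : E) : cutoff δ x y = cutoff δ y x := by
  rw [cutoff, cutoff, dist_comm, add_comm]

theorem smoothWeight_comm (x y : E) : smoothWeight δ m τ x y = smoothWeight δ m τ y x := by
  rw [smoothWeight, smoothWeight, dist_comm, add_comm]

theorem smoothWeight_nonneg (x y : E) : 0 ≤ smoothWeight δ m τ x y := by
  rw [smoothWeight]
  split_ifs <;> positivity

theorem cutoff_nonneg (x y : E) : 0 ≤ cutoff δ x y := by
  have h : min ((δ x + δ y) / 8) (dist x y) / dist x y ≤ 1 :=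
    div_le_one_of_le₀ (min_le_right _ _) dist_nonneg
  exact le_min zero_le_one (by linarith)

theorem cutoff_le_one (x y : E) : cutoff δ x y ≤ 1 := min_le_left _ _

theorem lt_of_cutoff_ne_zero {x y : E} (hxy : x ≠ y) (h : cutoff δ x y ≠ 0) :
    (δ x + δ y) / 8 < dist x y := by
  by_contra! hle
  refine h ?_
  rw [cutoff, min_eq_right hle, div_self (dist_ne_zero.mpr hxy)]
  norm_num

theorem lt_of_cutoff_ne_one {x y : E} (hxy : x ≠ y) (h : cutoff δ x y ≠ 1) :
    dist x y < (δ x + δ y) / 4 := by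
  by_contra! hle
  refine h ?_
  have hpos : 0 < dist x y := dist_pos.mpr hxy
  rw [cutoff, min_eq_left]
  have h2 : min ((δ x + δ y) / 8) (dist x y) / dist x y ≤ 1 / 2 := by
    rw [div_le_iff₀ hpos]
    exact (min_le_left _ _).trans (by linarith)
  linarith

theorem abs_div_sub_div_le {a a' b b' t : ℝ} (hb : 0 < b) (hb' : 0 < b') (ha'0 : 0 ≤ a')
    (ha' : a' ≤ b') (hta : |a - a'| ≤ t) (htb : |b - b'| ≤ t) :
    |a / b - a' / b'| ≤ 2 * (t / b) := by
  have e : a / b - a' / b' = (a - a') / b + a' / b' * ((b' - b) / b) := by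
    field_simp
    ring
  have h1 : |a' / b'| ≤ 1 := by
    rw [abs_of_nonneg (by positivity)]
    exact div_le_one_of_le₀ ha' hb'.le
  calc |a / b - a' / b'|
      ≤ |(a - a') / b| + |a' / b' * ((b' - b) / b)| := e ▸ abs_add_le _ _
    _ = |a - a'| / b + |a' / b'| * (|b - b'| / b) := by
        rw [abs_div, abs_mul, abs_div (b' - b), abs_of_pos hb, abs_sub_comm b' b]
    _ ≤ t / b + 1 * (t / b) := by gcongr
    _ = 2 * (t / b) := by ring

theorem abs_cutoff_sub_le (hδ0 : ∀ x, 0 ≤ δ x) (hδ : ∀ x y, δ x ≤ δ y + dist x y) {x x' y : E}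
    (hxy : x ≠ y) (hx : dist x x' ≤ 1 / 2 * dist x y) :
    |cutoff δ x y - cutoff δ x' y| ≤ 4 * (dist x x' / dist x y) := by
  have hpos : 0 < dist x y := dist_pos.mpr hxy
  have hpos' : 0 < dist x' y := by linarith [dist_triangle x x' y]
  have hdist : |dist x y - dist x' y| ≤ dist x x' := abs_dist_sub_le x x' y
  have hscale : |(δ x + δ y) / 8 - (δ x' + δ y) / 8| ≤ dist x x' := by
    have h := hδ x' x
    rw [dist_comm x' x] at h
    rw [abs_le]
    constructor <;> linarith [hδ x x', dist_nonneg (x := x) (y := x')]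
  have key := abs_div_sub_div_le hpos hpos'
    (le_min (by have := hδ0 x'; have := hδ0 y; positivity) hpos'.le) (min_le_right _ _)
    ((abs_min_sub_min_le_max _ _ _ _).trans (max_le hscale hdist)) hdist
  rw [cutoff, cutoff]
  refine (abs_min_sub_min_le_max _ _ _ _).trans (max_le ?_ ?_)
  · rw [sub_self, abs_zero]
    positivity
  · rw [← mul_sub, sub_sub_sub_cancel_left, abs_mul, abs_two, abs_sub_comm]
    linarith

/-- The suppressed kernel: the part of `k` at distances above the scale `δ`. -/
noncomputable abbrev farKernel (S : Set E) (δ : E → ℝ) (k : E → E → 𝕜) : E → E → 𝕜 :=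
  mulKernel S (cutoff δ) k

/-- The part of `k` at distances below the scale `δ`, to which Schur's test applies. -/
noncomputable abbrev localKernel (S : Set E) (δ : E → ℝ) (k : E → E → 𝕜) : E → E → 𝕜 :=
  mulKernel S (fun x y => 1 - cutoff δ x y) k

variable {S : Set E} {k : E → E → 𝕜}

theorem farKernel_add_localKernel {x y : E} (hx : x ∈ S) (hy : y ∈ S) (hxy : x ≠ y) :
    farKernel S δ k x y + localKernel S δ k x y = k x y := by
  rw [farKernel, localKernel, mulKernel, mulKernel, if_pos ⟨hx, hy, hxy⟩, if_pos ⟨hx, hy, hxy⟩]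
  push_cast
  ring

theorem norm_localKernel_le (x y : E) : ‖localKernel S δ k x y‖ ≤ ‖k x y‖ :=
  norm_mulKernel_le (fun x y => sub_nonneg.mpr (cutoff_le_one x y))
    (fun x y => sub_le_self _ (cutoff_nonneg x y)) x y

theorem farKernel_swap (x y : E) :
    farKernel S δ (fun x y => k y x) x y = farKernel S δ k y x :=
  mulKernel_swap cutoff_comm x y

theorem localKernel_swap (x y : E) :
    localKernel S δ (fun x y => k y x) x y = localKernel S δ k y x :=
  mulKernel_swap (fun x y => by rw [cutoff_comm]) x y

theorem IsScaledKernel.norm_localKernel_le (hk : IsScaledKernel S δ m C τ k) (x y : E) :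
    ‖localKernel S δ k x y‖ ≤ if dist x y < δ x then (δ x ^ m)⁻¹ else 0 := by
  have hrhs : (0 : ℝ) ≤ if dist x y < δ x then (δ x ^ m)⁻¹ else 0 := by
    have := hk.nonneg x
    split_ifs <;> positivity
  by_cases hzero : localKernel S δ k x y = 0
  · rwa [hzero, norm_zero]
  obtain ⟨hx, hy, hxy⟩ : x ∈ S ∧ y ∈ S ∧ x ≠ y := by
    by_contra h
    exact hzero (if_neg h)
  have hcut : cutoff δ x y ≠ 1 := by
    intro h
    exact hzero (by simp [mulKernel, h])
  have hpos : 0 < dist x y := dist_pos.mpr hxy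
  have hlip := hk.lipschitz y x
  rw [dist_comm] at hlip
  have hlt : dist x y < δ x := by linarith [lt_of_cutoff_ne_one hxy hcut]
  have hδ : 0 < δ x ^ m := Real.rpow_pos_of_pos (hpos.trans hlt) m
  rw [if_pos hlt, ← one_div, le_div_iff₀' hδ]
  exact (mul_le_mul_of_nonneg_left (_root_.norm_localKernel_le x y) hδ.le).trans
    (hk.bound x hx y hy)

theorem IsScaledKernel.cutoff_eq_zero (hk : IsScaledKernel S δ m C τ k) {x x' y : E} (hxy : x ≠ y)
    (hd : dist x x' ≤ 1 / 2 * dist x y) (h : 16 * dist x y < δ x + δ y) :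
    cutoff δ x' y = 0 := by
  have hx'y : x' ≠ y := by
    rintro rfl
    linarith [dist_pos.mpr hxy]
  by_contra hne
  have htri := dist_triangle x' x y
  rw [dist_comm x' x] at htri
  linarith [lt_of_cutoff_ne_zero hx'y hne, hk.lipschitz x x', dist_pos.mpr hxy]

theorem IsScaledKernel.norm_cutoff_mul_sub_le (hk : IsScaledKernel S δ m C τ k)
    (hτ1 : τ ≤ 1) {x x' y : E} (hx : x ∈ S) (hx' : x' ∈ S) (hy : y ∈ S) (hxy : x ≠ y)
    (hd : dist x x' ≤ 1 / 2 * dist x y) :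
    ‖(cutoff δ x y : 𝕜) * k x y - (cutoff δ x' y : 𝕜) * k x' y‖ ≤
      5 * C * dist x x' ^ τ * dist x y ^ (-(m + τ)) := by
  have hpos : 0 < dist x y := dist_pos.mpr hxy
  set ρ := dist x y
  set t := dist x x'
  have ht0 : 0 ≤ t := dist_nonneg
  have hk' : ‖k x y - k x' y‖ ≤ C * (t ^ τ / ρ ^ (m + τ)) := by
    linarith [hk.smooth x hx x' hx' y hy hxy hd, norm_nonneg (k y x - k y x')]
  have hratio : t / ρ ≤ (t / ρ) ^ τ := by
    rcases ht0.eq_or_lt with h0 | h0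
    · rw [← h0, zero_div]
      positivity
    · exact Real.self_le_rpow_of_le_one (by positivity)
        ((div_le_one hpos).mpr (by linarith)) hτ1
  have hcut : |cutoff δ x y - cutoff δ x' y| ≤ 4 * (t / ρ) ^ τ :=
    (abs_cutoff_sub_le hk.nonneg hk.lipschitz hxy hd).trans (by linarith)
  calc ‖(cutoff δ x y : 𝕜) * k x y - (cutoff δ x' y : 𝕜) * k x' y‖
      = ‖(cutoff δ x' y : 𝕜) * (k x y - k x' y) +
          ((cutoff δ x y - cutoff δ x' y : ℝ) : 𝕜) * k x y‖ := by
        push_cast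
        ring_nf
    _ ≤ |cutoff δ x' y| * ‖k x y - k x' y‖ + |cutoff δ x y - cutoff δ x' y| * ‖k x y‖ := by
        refine (norm_add_le _ _).trans_eq ?_
        rw [norm_mul, norm_mul, RCLike.norm_ofReal, RCLike.norm_ofReal]
    _ ≤ 1 * (C * (t ^ τ / ρ ^ (m + τ))) + 4 * (t / ρ) ^ τ * (C / ρ ^ m) := by
        have hle : |cutoff δ x' y| ≤ 1 := by
          rw [abs_of_nonneg (cutoff_nonneg x' y)]
          exact cutoff_le_one x' y
        have hsize := hk.size x hx y hy hxy
        gcongr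
    _ = 5 * C * t ^ τ * ρ ^ (-(m + τ)) := by
        rw [Real.rpow_neg hpos.le, Real.rpow_add hpos, Real.div_rpow ht0 hpos.le]
        field_simp
        ring

theorem IsScaledKernel.norm_farKernel_sub_le (hk : IsScaledKernel S δ m C τ k)
    (hτ1 : τ ≤ 1) {x x' y : E} (hx : x ∈ S) (hx' : x' ∈ S) (hy : y ∈ S) (hxy : x ≠ y)
    (hd : dist x x' ≤ 1 / 2 * dist x y) :
    ‖farKernel S δ k x y - farKernel S δ k x' y‖ ≤
      5 * C * dist x x' ^ τ * smoothWeight δ m τ x y := by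
  have hx'y : x' ≠ y := by
    rintro rfl
    linarith [dist_pos.mpr hxy]
  rw [farKernel, mulKernel, mulKernel, if_pos ⟨hx, hy, hxy⟩, if_pos ⟨hx', hy, hx'y⟩, smoothWeight]
  split_ifs with hw
  · exact hk.norm_cutoff_mul_sub_le hτ1 hx hx' hy hxy hd
  · rw [not_le] at hw
    rw [hk.cutoff_eq_zero hxy hd hw,
      hk.cutoff_eq_zero (x' := x) hxy (by rw [dist_self]; positivity) hw]
    simp

end Suppression

section Measurability

variable {E : Type*} [MetricSpace E] {𝕜 : Type*} [RCLike 𝕜] {S : Set E} {δ : E → ℝ} {m C τ : ℝ}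
  {k : E → E → 𝕜}

theorem IsScaledKernel.swap (hk : IsScaledKernel S δ m C τ k)
    (hb : ∀ x ∈ S, ∀ y ∈ S, δ y ^ m * ‖k x y‖ ≤ 1) :
    IsScaledKernel S δ m C τ fun x y => k y x where
  nonneg := hk.nonneg
  lipschitz := hk.lipschitz
  size x hx y hy hxy := by
    rw [dist_comm]
    exact hk.size y hy x hx hxy.symm
  smooth x hx x' hx' y hy hxy hd := by
    rw [add_comm]
    exact hk.smooth x hx x' hx' y hy hxy hd
  bound x hx y hy := hb y hy x hx

theorem IsScaledKernel.continuous_scale (hk : IsScaledKernel S δ m C τ k) : Continuous δ := by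
  refine LipschitzWith.continuous (K := 1) (LipschitzWith.of_dist_le_mul fun x y => ?_)
  rw [NNReal.coe_one, one_mul, Real.dist_eq, abs_le]
  have h1 := hk.lipschitz x y
  have h2 := hk.lipschitz y x
  rw [dist_comm y x] at h2
  constructor <;> linarith

theorem IsScaledKernel.norm_sub_le_of_dist_lt (hk : IsScaledKernel S δ m C τ k) (hC : 0 ≤ C)
    (hm : 0 < m) (hτ : 0 < τ) {x x₀ y y₀ : E} (hx : x ∈ S) (hx₀ : x₀ ∈ S) (hy : y ∈ S)
    (hy₀ : y₀ ∈ S) (hne : x₀ ≠ y₀) (hdx : dist x₀ x < dist x₀ y₀ / 4)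
    (hdy : dist y₀ y < dist x₀ y₀ / 4) :
    ‖k x y - k x₀ y₀‖ ≤ C * (dist x₀ x ^ τ / (dist x₀ y₀ / 2) ^ (m + τ)) +
      C * (dist y₀ y ^ τ / dist x₀ y₀ ^ (m + τ)) := by
  have hpos : 0 < dist x₀ y₀ := dist_pos.mpr hne
  have htri := dist_triangle x₀ y y₀
  rw [dist_comm y y₀] at htri
  have hxy : dist x₀ y₀ / 2 ≤ dist x₀ y := by linarith
  have hxyne : x₀ ≠ y := dist_pos.mp (by linarith)
  have h1 := hk.smooth x₀ hx₀ x hx y hy hxyne (by linarith)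
  have h2 := hk.smooth y₀ hy₀ y hy x₀ hx₀ hne.symm (by rw [dist_comm y₀ x₀]; linarith)
  rw [dist_comm y₀ x₀] at h2
  have h3 : C * (dist x₀ x ^ τ / dist x₀ y ^ (m + τ)) ≤
      C * (dist x₀ x ^ τ / (dist x₀ y₀ / 2) ^ (m + τ)) := by gcongr
  have h4 := norm_sub_le_norm_sub_add_norm_sub (k x y) (k x₀ y) (k x₀ y₀)
  rw [norm_sub_rev (k x y) (k x₀ y), norm_sub_rev (k x₀ y) (k x₀ y₀)] at h4
  linarith [norm_nonneg (k y x₀ - k y x), norm_nonneg (k y₀ x₀ - k y x₀)]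

theorem IsScaledKernel.continuousOn (hk : IsScaledKernel S δ m C τ k) (hC : 0 ≤ C) (hm : 0 < m)
    (hτ : 0 < τ) :
    ContinuousOn (fun z : E × E => k z.1 z.2) {z | z.1 ∈ S ∧ z.2 ∈ S ∧ z.1 ≠ z.2} := by
  rintro ⟨x₀, y₀⟩ ⟨hx₀, hy₀, hne⟩
  have hpos : 0 < dist x₀ y₀ / 4 := div_pos (dist_pos.mpr hne) four_pos
  have hbound : Continuous (fun z : E × E =>
      C * (dist x₀ z.1 ^ τ / (dist x₀ y₀ / 2) ^ (m + τ)) +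
        C * (dist y₀ z.2 ^ τ / dist x₀ y₀ ^ (m + τ))) := by
    refine ((Continuous.div_const ?_ _).const_mul C).add
      ((Continuous.div_const ?_ _).const_mul C)
    · exact (continuous_const.dist continuous_fst).rpow_const fun _ => Or.inr hτ.le
    · exact (continuous_const.dist continuous_snd).rpow_const fun _ => Or.inr hτ.le
  have hlim := hbound.tendsto (x₀, y₀)
  simp only [dist_self, Real.zero_rpow hτ.ne', zero_div, mul_zero, add_zero] at hlim
  rw [ContinuousWithinAt, tendsto_iff_norm_sub_tendsto_zero]
  refine squeeze_zero' (Filter.Eventually.of_forall fun _ => norm_nonneg _) ?_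
    (hlim.mono_left nhdsWithin_le_nhds)
  filter_upwards [nhdsWithin_le_nhds (ball_mem_nhds (x₀, y₀) hpos), self_mem_nhdsWithin]
  rintro ⟨x, y⟩ hz ⟨hx, hy, -⟩
  rw [mem_ball', Prod.dist_eq, max_lt_iff] at hz
  exact hk.norm_sub_le_of_dist_lt hC hm hτ hx hx₀ hy hy₀ hne hz.1 hz.2

theorem continuousOn_cutoff (hδ : Continuous δ) :
    ContinuousOn (fun z : E × E => cutoff δ z.1 z.2) {z | z.1 ≠ z.2} := by
  have h1 : Continuous fun z : E × E => (δ z.1 + δ z.2) / 8 := by fun_prop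
  have h2 : Continuous fun z : E × E => dist z.1 z.2 := by fun_prop
  refine ContinuousOn.inf continuousOn_const (continuousOn_const.mul
    (continuousOn_const.sub ((h1.min h2).continuousOn.div h2.continuousOn fun z hz => ?_)))
  exact dist_ne_zero.mpr hz

/-- The weight `D * smoothWeight` cut off below the distance `s`; it dominates the interaction of
a mean zero function on a cell of size about `s` with functions far from that cell. -/
noncomputable def truncWeight (δ : E → ℝ) (m τ D s : ℝ) (x y : E) : ℝ≥0∞ :=
  if s ≤ dist x y then ENNReal.ofReal (D * smoothWeight δ m τ x y) else 0

theorem truncWeight_comm (D s : ℝ) (x y : E) :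
    truncWeight δ m τ D s x y = truncWeight δ m τ D s y x := by
  rw [truncWeight, truncWeight, dist_comm, smoothWeight_comm]

variable [MeasurableSpace E] [BorelSpace E]

theorem lintegral_truncWeight_le {μ : Measure E} (hδ0 : ∀ x, 0 ≤ δ x) (hm : 0 < m) (hτ : 0 < τ)
    {D s : ℝ} (hD : 0 ≤ D) (hs : 0 < s) (x : E)
    (hgrow : ∀ r, δ x < r → μ (ball x r) ≤ ENNReal.ofReal (r ^ m)) :
    ∫⁻ y, truncWeight δ m τ D s x y ∂μ ≤
      ENNReal.ofReal (D * (32 ^ m / (1 - 2 ^ (-τ)) * s ^ (-τ))) := by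
  rw [ENNReal.ofReal_mul hD]
  refine le_trans ?_ (mul_le_mul_right (lintegral_dist_rpow_neg_le μ x hm hτ hs hgrow) _)
  rw [← lintegral_const_mul']
  · refine lintegral_mono fun y => ?_
    rw [truncWeight, smoothWeight]
    by_cases h1 : s ≤ dist x y
    · by_cases h2 : δ x + δ y ≤ 16 * dist x y
      · rw [if_pos h1, if_pos h2, if_pos ⟨h1, by linarith [hδ0 y]⟩, ENNReal.ofReal_mul hD]
      · simp [h2]
    · simp [h1]
  · exact ENNReal.ofReal_ne_top

theorem IsScaledKernel.lintegral_localKernel_le (hk : IsScaledKernel S δ m C τ k) {μ : Measure E}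
    (x : E) (hgrow : ∀ r, δ x < r → μ (ball x r) ≤ ENNReal.ofReal (r ^ m)) :
    ∫⁻ y, ‖localKernel S δ k x y‖ₑ ∂μ ≤ ENNReal.ofReal (2 ^ m) := by
  have hle : ∀ y, ‖localKernel S δ k x y‖ₑ ≤
      (ball x (δ x)).indicator (fun _ => ENNReal.ofReal (δ x ^ m)⁻¹) y := by
    intro y
    rw [← ofReal_norm]
    refine (ENNReal.ofReal_le_ofReal (hk.norm_localKernel_le x y)).trans ?_
    by_cases h : dist x y < δ x
    · rw [if_pos h, indicator_of_mem (by rwa [mem_ball, dist_comm])]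
    · rw [if_neg h]
      simp
  refine (lintegral_mono hle).trans ?_
  rw [lintegral_indicator_const measurableSet_ball]
  rcases (hk.nonneg x).eq_or_lt with h0 | h0
  · simp [← h0]
  · calc _ ≤ ENNReal.ofReal (δ x ^ m)⁻¹ * ENNReal.ofReal ((2 * δ x) ^ m) := by
          refine mul_le_mul_right ?_ _
          exact (measure_mono (ball_subset_ball (by linarith))).trans (hgrow _ (by linarith))
      _ = ENNReal.ofReal (2 ^ m) := by
          rw [← ENNReal.ofReal_mul (by positivity), Real.mul_rpow zero_le_two h0.le]
          congr 1
          have : δ x ^ m ≠ 0 := by positivity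
          field_simp

variable [SecondCountableTopology E]

theorem stronglyMeasurable_indicator_of_continuousOn {α : Type*} [TopologicalSpace α]
    [MeasurableSpace α] [OpensMeasurableSpace α] {f : α → 𝕜} {s : Set α} (hs : MeasurableSet s)
    (hf : ContinuousOn f s) : StronglyMeasurable (s.indicator f) := by
  classical
  borelize 𝕜
  rw [← piecewise_eq_indicator]
  exact (hf.measurable_piecewise continuousOn_const hs).stronglyMeasurable

theorem measurableSet_offDiag_of_isClosed (hS : IsClosed S) :
    MeasurableSet {z : E × E | z.1 ∈ S ∧ z.2 ∈ S ∧ z.1 ≠ z.2} := by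
  refine (measurable_fst hS.measurableSet).inter
    ((measurable_snd hS.measurableSet).inter (MeasurableSet.compl ?_))
  exact (isClosed_eq continuous_fst continuous_snd).measurableSet

theorem IsScaledKernel.stronglyMeasurable_mulKernel (hk : IsScaledKernel S δ m C τ k)
    (hC : 0 ≤ C) (hm : 0 < m) (hτ : 0 < τ) (hS : IsClosed S) {φ : E → E → ℝ}
    (hφ : ContinuousOn (fun z : E × E => φ z.1 z.2) {z | z.1 ≠ z.2}) :
    StronglyMeasurable (Function.uncurry (mulKernel S φ k)) := by
  have h := stronglyMeasurable_indicator_of_continuousOn (measurableSet_offDiag_of_isClosed hS)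
    (f := fun z : E × E => (φ z.1 z.2 : 𝕜) * k z.1 z.2)
    ((RCLike.continuous_ofReal.comp_continuousOn (hφ.mono fun z hz => hz.2.2)).mul
      (hk.continuousOn hC hm hτ))
  convert h using 1
  ext ⟨x, y⟩
  simp [mulKernel, indicator]

theorem IsScaledKernel.stronglyMeasurable_farKernel (hk : IsScaledKernel S δ m C τ k)
    (hC : 0 ≤ C) (hm : 0 < m) (hτ : 0 < τ) (hS : IsClosed S) :
    StronglyMeasurable (Function.uncurry (farKernel S δ k)) :=
  hk.stronglyMeasurable_mulKernel hC hm hτ hS (continuousOn_cutoff hk.continuous_scale)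

theorem IsScaledKernel.stronglyMeasurable_localKernel (hk : IsScaledKernel S δ m C τ k)
    (hC : 0 ≤ C) (hm : 0 < m) (hτ : 0 < τ) (hS : IsClosed S) :
    StronglyMeasurable (Function.uncurry (localKernel S δ k)) :=
  hk.stronglyMeasurable_mulKernel hC hm hτ hS
    (continuousOn_const.sub (continuousOn_cutoff hk.continuous_scale))

theorem measurable_truncWeight (hδ : Continuous δ) (D s : ℝ) :
    Measurable (Function.uncurry (truncWeight δ m τ D s)) := by
  have h2 : Measurable fun z : E × E => dist z.1 z.2 := measurable_dist
  have h1 : Measurable fun z : E × E => δ z.1 + δ z.2 :=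
    (hδ.measurable.comp measurable_fst).add (hδ.measurable.comp measurable_snd)
  refine Measurable.ite (measurableSet_le measurable_const h2)
    (ENNReal.measurable_ofReal.comp (Measurable.const_mul (Measurable.ite
      (measurableSet_le h1 (h2.const_mul 16)) (h2.pow_const _) measurable_const) D))
    measurable_const

end Measurability

section CellKernel

open Function

theorem norm_bilin_le_of_sum_eq_zero {P 𝕜 : Type*} [Fintype P] [RCLike 𝕜] {w : P → ℝ}
    {b : Matrix P P 𝕜} {u : P → P → ℝ} (ν : P → 𝕜) {h g : P → 𝕜}
    (hmean : ∑ p, (w p : 𝕜) * h p = 0)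
    (hb : ∀ p q, h p ≠ 0 → g q ≠ 0 → ‖b p q - w p * ν q‖ ≤ u p q) :
    ‖bilin b h g‖ ≤ ∑ p, ∑ q, u p q * (‖h p‖ * ‖g q‖) := by
  have hzero : ∑ p, ∑ q, w p * ν q * (h p * g q) = 0 := by
    calc ∑ p, ∑ q, w p * ν q * (h p * g q) = (∑ p, w p * h p) * ∑ q, ν q * g q := by
          rw [Finset.sum_mul_sum]
          exact Finset.sum_congr rfl fun p _ => Finset.sum_congr rfl fun q _ => by ring
      _ = 0 := by rw [hmean, zero_mul]
  rw [bilin_apply, ← sub_zero (∑ p, ∑ q, _), ← hzero]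
  simp only [← Finset.sum_sub_distrib, ← sub_mul]
  refine norm_sum_le_of_le _ fun p _ => norm_sum_le_of_le _ fun q _ => ?_
  rw [norm_mul, norm_mul]
  by_cases hp : h p = 0
  · simp [hp]
  by_cases hq : g q = 0
  · simp [hq]
  exact mul_le_mul_of_nonneg_right (hb p q hp hq) (by positivity)

variable {E P ι 𝕜 : Type*} [MeasurableSpace E] [RCLike 𝕜] {μ : Measure E} {cell : P → Set E}

theorem sum_setLIntegral_le [Fintype P] (hcell : ∀ p, MeasurableSet (cell p))
    (hdisj : Pairwise (Disjoint on cell)) (F : E → ℝ≥0∞) :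
    ∑ p, ∫⁻ x in cell p, F x ∂μ ≤ ∫⁻ x, F x ∂μ := by
  rw [← lintegral_biUnion_finset (fun p _ q _ h => hdisj h) (fun p _ => hcell p)]
  exact setLIntegral_le_lintegral _ _

theorem ae_restrict_mem_inter {A S : Set E} (hA : MeasurableSet A) (hS : ∀ᵐ x ∂μ, x ∈ S) :
    ∀ᵐ x ∂μ.restrict A, x ∈ A ∩ S :=
  (ae_restrict_mem hA).and (ae_restrict_of_ae hS)

/-- The integral of a weight over a product of cells. -/
noncomputable def cellWeight (μ : Measure E) (cell : P → Set E) (V : E → E → ℝ≥0∞) (p q : P) : ℝ :=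
  (∫⁻ x in cell q, ∫⁻ y in cell p, V x y ∂μ ∂μ).toReal

/-- The matrix of the integrals of a kernel over products of cells. The column index is the cell of
the output variable, so that `bilin` integrates the kernel against `f y` and `g x`. -/
noncomputable def cellIntegral (μ : Measure E) (cell : P → Set E) (K : E → E → 𝕜) :
    Matrix P P 𝕜 :=
  fun p q => ∫ x in cell q, ∫ y in cell p, K x y ∂μ ∂μ

theorem cellWeight_nonneg (V : E → E → ℝ≥0∞) (p q : P) : 0 ≤ cellWeight μ cell V p q :=
  ENNReal.toReal_nonneg

variable [IsFiniteMeasure μ]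

theorem integrableOn_of_norm_le_on_inter {A S : Set E} (hA : MeasurableSet A)
    (hS : ∀ᵐ x ∂μ, x ∈ S) {f : E → 𝕜} (hf : StronglyMeasurable f) {B : ℝ}
    (hB : ∀ x ∈ A ∩ S, ‖f x‖ ≤ B) : IntegrableOn f A μ :=
  Measure.integrableOn_of_bounded (measure_ne_top _ _) hf.aestronglyMeasurable
    ((ae_restrict_mem_inter hA hS).mono hB)

section Weight

variable {V : E → E → ℝ≥0∞} {C : ℝ}

theorem lintegral_lintegral_cell_ne_top (hrow : ∀ x, ∫⁻ y, V x y ∂μ ≤ ENNReal.ofReal C) (p q : P) :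
    ∫⁻ x in cell q, ∫⁻ y in cell p, V x y ∂μ ∂μ ≠ ⊤ := by
  refine ne_top_of_le_ne_top ?_ (lintegral_mono fun x =>
    (setLIntegral_le_lintegral (cell p) (V x)).trans (hrow x))
  rw [lintegral_const]
  exact ENNReal.mul_ne_top ENNReal.ofReal_ne_top (measure_ne_top _ _)

theorem norm_integral_integral_le_cellWeight
    (hrow : ∀ x, ∫⁻ y, V x y ∂μ ≤ ENNReal.ofReal C) {K : E → E → 𝕜} {p q : P}
    (hK : ∀ᵐ x ∂μ.restrict (cell q), ∀ᵐ y ∂μ.restrict (cell p), ‖K x y‖ₑ ≤ V x y) :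
    ‖∫ x in cell q, ∫ y in cell p, K x y ∂μ ∂μ‖ ≤ cellWeight μ cell V p q := by
  rw [cellWeight, ← toReal_enorm]
  refine ENNReal.toReal_mono (lintegral_lintegral_cell_ne_top hrow p q) ?_
  refine (enorm_integral_le_lintegral_enorm _).trans (lintegral_mono_ae ?_)
  filter_upwards [hK] with x hx
  exact (enorm_integral_le_lintegral_enorm _).trans (lintegral_mono_ae hx)

variable [Fintype P]

theorem sum_cellWeight_left_le (hcell : ∀ p, MeasurableSet (cell p))
    (hdisj : Pairwise (Disjoint on cell)) (hV : Measurable (uncurry V)) (hC : 0 ≤ C)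
    (hrow : ∀ x, ∫⁻ y, V x y ∂μ ≤ ENNReal.ofReal C) (q : P) :
    ∑ p, cellWeight μ cell V p q ≤ C * μ.real (cell q) := by
  simp only [cellWeight]
  rw [← ENNReal.toReal_sum fun p _ => lintegral_lintegral_cell_ne_top hrow p q,
    ← lintegral_finsetSum Finset.univ fun p _ =>
      (show Measurable fun x => ∫⁻ y in cell p, V x y ∂μ from hV.lintegral_prod_right')]
  refine ENNReal.toReal_le_of_le_ofReal (by positivity) ?_
  calc ∫⁻ x in cell q, ∑ p, ∫⁻ y in cell p, V x y ∂μ ∂μ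
      ≤ ∫⁻ _ in cell q, ENNReal.ofReal C ∂μ :=
        lintegral_mono fun x => (sum_setLIntegral_le hcell hdisj (V x)).trans (hrow x)
    _ = ENNReal.ofReal (C * μ.real (cell q)) := by
        rw [setLIntegral_const, ENNReal.ofReal_mul hC, ofReal_measureReal]

theorem sum_cellWeight_right_le (hcell : ∀ p, MeasurableSet (cell p))
    (hdisj : Pairwise (Disjoint on cell)) (hV : Measurable (uncurry V)) (hC : 0 ≤ C)
    (hcol : ∀ y, ∫⁻ x, V x y ∂μ ≤ ENNReal.ofReal C) (p : P) :
    ∑ q, cellWeight μ cell V p q ≤ C * μ.real (cell p) := by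
  have hswap : ∀ q, cellWeight μ cell V p q = cellWeight μ cell (swap V) q p := fun q => by
    rw [cellWeight, cellWeight, lintegral_lintegral_swap hV.aemeasurable]
  simp only [hswap]
  exact sum_cellWeight_left_le (V := swap V) hcell hdisj (hV.comp measurable_swap) hC hcol p

end Weight

theorem norm_cellIntegral_sub_le (hcell : ∀ p, MeasurableSet (cell p)) {S : Set E}
    (hS : ∀ᵐ x ∂μ, x ∈ S) {K : E → E → 𝕜} (hK : StronglyMeasurable (uncurry K))
    {V : E → E → ℝ≥0∞} {C B : ℝ} (hrow : ∀ x, ∫⁻ y, V x y ∂μ ≤ ENNReal.ofReal C) {p q : P} {y₀ : E}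
    (hB : ∀ x ∈ cell q ∩ S, ∀ y ∈ cell p ∩ S, ‖K x y‖ ≤ B)
    (hB₀ : ∀ x ∈ cell q ∩ S, ‖K x y₀‖ ≤ B)
    (hsm : ∀ x ∈ cell q ∩ S, ∀ y ∈ cell p ∩ S, ‖K x y - K x y₀‖ₑ ≤ V x y) :
    ‖cellIntegral μ cell K p q - μ.real (cell p) * ∫ x in cell q, K x y₀ ∂μ‖ ≤
      cellWeight μ cell V p q := by
  have hae (p : P) := ae_restrict_mem_inter (hcell p) hS
  have hinner : ∀ x ∈ cell q ∩ S, IntegrableOn (K x) (cell p) μ := fun x hx =>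
    integrableOn_of_norm_le_on_inter (hcell p) hS (hK.comp_measurable measurable_prodMk_left)
      (hB x hx)
  have houter : IntegrableOn (fun x => ∫ y in cell p, K x y ∂μ) (cell q) μ :=
    integrableOn_of_norm_le_on_inter (hcell q) hS hK.integral_prod_right fun x hx =>
      norm_setIntegral_le_of_norm_le_const_ae (measure_lt_top _ _) ((hae p).mono (hB x hx))
  have hcenter : IntegrableOn (fun x => K x y₀) (cell q) μ :=
    integrableOn_of_norm_le_on_inter (hcell q) hS (hK.comp_measurable measurable_prodMk_right) hB₀
  have heq : cellIntegral μ cell K p q - μ.real (cell p) * ∫ x in cell q, K x y₀ ∂μ =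
      ∫ x in cell q, ∫ y in cell p, (K x y - K x y₀) ∂μ ∂μ := by
    rw [cellIntegral, ← integral_const_mul, ← integral_sub houter (hcenter.const_mul _)]
    refine integral_congr_ae ?_
    filter_upwards [hae q] with x hx
    rw [integral_sub (hinner x hx) (integrable_const _), setIntegral_const,
      RCLike.real_smul_eq_coe_mul]
  rw [heq]
  refine norm_integral_integral_le_cellWeight hrow ?_
  filter_upwards [hae q] with x hx
  exact (hae p).mono (hsm x hx)

omit [IsFiniteMeasure μ] in
theorem exists_mem_inter_of_measureReal_pos {A S : Set E} (hA : 0 < μ.real A)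
    (hS : ∀ᵐ x ∂μ, x ∈ S) : ∃ y, y ∈ A ∩ S :=
  nonempty_of_measure_ne_zero (μ := μ) <| by
    rw [measure_inter_conull (t := S) hS]
    exact (ENNReal.toReal_pos_iff.mp hA).1.ne'

variable [Fintype P]

theorem decouples_of_kernel (hcell : ∀ p, MeasurableSet (cell p))
    (hdisj : Pairwise (Disjoint on cell)) (hpos : ∀ p, 0 < μ.real (cell p))
    {S : Set E} (hS : ∀ᵐ x ∂μ, x ∈ S) {K : E → E → 𝕜} (hK : StronglyMeasurable (uncurry K))
    {V : E → E → ℝ≥0∞} (hV : Measurable (uncurry V)) {C B : ℝ} (hC : 0 ≤ C)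
    (hrow : ∀ x, ∫⁻ y, V x y ∂μ ≤ ENNReal.ofReal C)
    (hcol : ∀ y, ∫⁻ x, V x y ∂μ ≤ ENNReal.ofReal C) {c : P → ι} {R : P → P → Prop}
    {b : Matrix P P 𝕜}
    (hb : ∀ p₀ p q, c p = c p₀ → R p₀ q → b p q = cellIntegral μ cell K p q)
    (hB : ∀ p₀ p q, c p = c p₀ → R p₀ q → ∀ x ∈ cell q ∩ S, ∀ y ∈ cell p ∩ S, ‖K x y‖ ≤ B)
    (hsm : ∀ p₀ p q, c p = c p₀ → R p₀ q → ∀ x ∈ cell q ∩ S, ∀ y ∈ cell p ∩ S,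
      ∀ y' ∈ cell p₀ ∩ S, ‖K x y - K x y'‖ₑ ≤ V x y) :
    Decouples (fun p => μ.real (cell p)) c b R C := by
  refine ⟨cellWeight μ cell V, cellWeight_nonneg V,
    sum_cellWeight_right_le hcell hdisj hV hC hcol,
    sum_cellWeight_left_le hcell hdisj hV hC hrow, fun p₀ h g hh hmean hg => ?_⟩
  obtain ⟨y₀, hy₀⟩ := exists_mem_inter_of_measureReal_pos (hpos p₀) hS
  refine norm_bilin_le_of_sum_eq_zero (fun q => ∫ x in cell q, K x y₀ ∂μ) hmean fun p q hp hq => ?_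
  have hc := hh p hp
  have hR := hg q hq
  rw [hb p₀ p q hc hR]
  exact norm_cellIntegral_sub_le hcell hS hK hrow (hB p₀ p q hc hR)
    (fun x hx => hB p₀ p₀ q rfl hR x hx y₀ hy₀)
    fun x hx y hy => hsm p₀ p q hc hR x hx y hy y₀ hy₀

theorem norm_bilin_cellIntegral_le (hcell : ∀ p, MeasurableSet (cell p))
    (hdisj : Pairwise (Disjoint on cell)) {K : E → E → 𝕜} (hK : StronglyMeasurable (uncurry K))
    {C : ℝ} (hC : 0 ≤ C) (hrow : ∀ x, ∫⁻ y, ‖K x y‖ₑ ∂μ ≤ ENNReal.ofReal C)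
    (hcol : ∀ y, ∫⁻ x, ‖K x y‖ₑ ∂μ ≤ ENNReal.ofReal C) (f g : P → 𝕜) :
    ‖bilin (cellIntegral μ cell K) f g‖ ≤
      C * (√(normSq (fun p => μ.real (cell p)) f) * √(normSq (fun p => μ.real (cell p)) g)) := by
  refine le_trans ?_ (schur_test Finset.univ Finset.univ (cellWeight_nonneg _) hC
    (fun p _ => sum_cellWeight_right_le hcell hdisj (V := fun x y => ‖K x y‖ₑ) hK.enorm hC hcol p)
    (fun q _ => sum_cellWeight_left_le hcell hdisj (V := fun x y => ‖K x y‖ₑ) hK.enorm hC hrow q)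
    (fun p => ‖f p‖) (fun q => ‖g q‖))
  refine norm_sum_le_of_le _ fun p _ => norm_sum_le_of_le _ fun q _ => ?_
  rw [norm_mul, norm_mul]
  exact mul_le_mul_of_nonneg_right (norm_integral_integral_le_cellWeight hrow
    (.of_forall fun x => .of_forall fun y => le_rfl)) (by positivity)

end CellKernel

section StepFunctions

open Function Matrix

variable {E : Type*} [MeasurableSpace E] {μ : Measure E} [IsFiniteMeasure μ] {P ι 𝕜 : Type*}
  [Fintype P] [RCLike 𝕜] {cell : P → Set E}

/-- The indicator function of a measurable set as an element of `L²`. -/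
noncomputable def setLp (𝕜 : Type*) [RCLike 𝕜] (μ : Measure E) [IsFiniteMeasure μ] {Q : Set E}
    (hQ : MeasurableSet Q) : Lp 𝕜 2 μ :=
  indicatorConstLp 2 hQ (measure_ne_top μ Q) (1 : 𝕜)

/-- The step function with the values `f p` on the cells. -/
noncomputable def stepLp (μ : Measure E) [IsFiniteMeasure μ] (hcell : ∀ p, MeasurableSet (cell p)) :
    (P → 𝕜) →ₗ[𝕜] Lp 𝕜 2 μ :=
  Fintype.linearCombination 𝕜 fun p => setLp 𝕜 μ (hcell p)

/-- The matrix of an operator with respect to the indicator functions of the cells. -/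
noncomputable def opMatrix (hcell : ∀ p, MeasurableSet (cell p)) (T : Lp 𝕜 2 μ →L[𝕜] Lp 𝕜 2 μ) :
    Matrix P P 𝕜 :=
  fun p q => inner 𝕜 (setLp 𝕜 μ (hcell q)) (T (setLp 𝕜 μ (hcell p)))

theorem inner_setLp_setLp {Q Q' : Set E} (hQ : MeasurableSet Q) (hQ' : MeasurableSet Q') :
    inner 𝕜 (setLp 𝕜 μ hQ) (setLp 𝕜 μ hQ') = (μ.real (Q ∩ Q') : 𝕜) :=
  L2.inner_indicatorConstLp_one_indicatorConstLp_one hQ hQ' _ _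

theorem norm_setLp_sq {Q : Set E} (hQ : MeasurableSet Q) : ‖setLp 𝕜 μ hQ‖ ^ 2 = μ.real Q := by
  have h := inner_setLp_setLp (𝕜 := 𝕜) (μ := μ) hQ hQ
  rw [inner_self_eq_norm_sq_to_K, inter_self] at h
  exact_mod_cast h

theorem inner_stepLp_stepLp (hcell : ∀ p, MeasurableSet (cell p))
    (T : Lp 𝕜 2 μ →L[𝕜] Lp 𝕜 2 μ) (f g : P → 𝕜) :
    inner 𝕜 (stepLp μ hcell (star g)) (T (stepLp μ hcell f)) = bilin (opMatrix hcell T) f g := by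
  simp only [stepLp, Fintype.linearCombination_apply, map_sum, map_smul, sum_inner, inner_sum,
    inner_smul_left, inner_smul_right, Pi.star_apply, RCLike.star_def, RCLike.conj_conj,
    bilin_apply, opMatrix, Finset.mul_sum]
  exact Finset.sum_congr rfl fun p _ => Finset.sum_congr rfl fun q _ => by ring

variable (hcell : ∀ p, MeasurableSet (cell p)) (hdisj : Pairwise (Disjoint on cell))
include hdisj

theorem norm_stepLp_sq (f : P → 𝕜) :
    ‖stepLp μ hcell f‖ ^ 2 = normSq (fun p => μ.real (cell p)) f := by
  have h := inner_stepLp_stepLp (μ := μ) hcell (ContinuousLinearMap.id 𝕜 _) f (star f)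
  rw [star_star, ContinuousLinearMap.id_apply, inner_self_eq_norm_sq_to_K] at h
  have hdiag : bilin (opMatrix hcell (ContinuousLinearMap.id 𝕜 (Lp 𝕜 2 μ))) f (star f) =
      (normSq (fun p => μ.real (cell p)) f : ℝ) := by
    rw [bilin_apply, ← sum_mul_mul_star_eq_normSq]
    refine Finset.sum_congr rfl fun p _ => ?_
    rw [Finset.sum_eq_single_of_mem p (Finset.mem_univ p) fun q _ hqp => ?_]
    · rw [opMatrix, ContinuousLinearMap.id_apply, inner_setLp_setLp, inter_self, Pi.star_apply,
        mul_assoc]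
    · simp [opMatrix, inner_setLp_setLp, (hdisj hqp).inter_eq]
  rw [hdiag] at h
  exact_mod_cast h

theorem norm_stepLp (f : P → 𝕜) :
    ‖stepLp μ hcell f‖ = √(normSq (fun p => μ.real (cell p)) f) := by
  rw [← norm_stepLp_sq hcell hdisj, Real.sqrt_sq (norm_nonneg _)]

theorem norm_bilin_opMatrix_le_norm_mul_norm (T : Lp 𝕜 2 μ →L[𝕜] Lp 𝕜 2 μ) (f g : P → 𝕜) :
    ‖bilin (opMatrix hcell T) f g‖ ≤
      ‖T (stepLp μ hcell f)‖ * √(normSq (fun p => μ.real (cell p)) g) := by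
  rw [← inner_stepLp_stepLp, mul_comm, ← normSq_star g, ← norm_stepLp hcell hdisj]
  exact norm_inner_le_norm _ _

theorem norm_bilin_opMatrix_le (T : Lp 𝕜 2 μ →L[𝕜] Lp 𝕜 2 μ) (f g : P → 𝕜) :
    ‖bilin (opMatrix hcell T) f g‖ ≤
      ‖T‖ * (√(normSq (fun p => μ.real (cell p)) f) * √(normSq (fun p => μ.real (cell p)) g)) := by
  refine (norm_bilin_opMatrix_le_norm_mul_norm hcell hdisj T f g).trans ?_
  rw [← mul_assoc, ← norm_stepLp hcell hdisj f]
  gcongr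
  exact T.le_opNorm _

theorem ae_stepLp_apply_of_mem (f : P → 𝕜) :
    ∀ᵐ x ∂μ, ∀ p, x ∈ cell p → stepLp μ hcell f x = f p := by
  have hterm : ∀ᵐ x ∂μ, ∀ q, (f q • setLp 𝕜 μ (hcell q) : Lp 𝕜 2 μ) x =
      f q * (cell q).indicator 1 x := by
    rw [Filter.eventually_all]
    intro q
    filter_upwards [Lp.coeFn_smul (f q) (setLp 𝕜 μ (hcell q)),
      indicatorConstLp_coeFn (p := 2) (hs := hcell q) (hμs := measure_ne_top μ (cell q))
        (c := (1 : 𝕜))] with x hx hx'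
    rw [hx, Pi.smul_apply, setLp, hx', smul_eq_mul]
    rfl
  filter_upwards [hterm, Lp.coeFn_finsetSum Finset.univ fun q => f q • setLp 𝕜 μ (hcell q)]
    with x hx hsum p hp
  rw [stepLp, Fintype.linearCombination_apply, hsum, Finset.sum_apply,
    Finset.sum_congr rfl fun q _ => hx q, Finset.sum_eq_single_of_mem p (Finset.mem_univ p),
    indicator_of_mem hp, Pi.one_apply, mul_one]
  intro q _ hqp
  rw [indicator_of_notMem fun hq => disjoint_left.mp (hdisj hqp) hq hp, mul_zero]

variable (hcover : ∀ᵐ x ∂μ, ∃ p, x ∈ cell p)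
include hcover

theorem stepLp_cellIndicator {Q : Set E} (hQ : MeasurableSet Q) {c : P → ι} {p₀ : P}
    (hcQ : ∀ p, ∀ x ∈ cell p, x ∈ Q ↔ c p = c p₀) :
    stepLp μ hcell (cellIndicator c p₀) = setLp 𝕜 μ hQ := by
  classical
  refine Lp.ext ?_
  filter_upwards [ae_stepLp_apply_of_mem hcell hdisj (cellIndicator c p₀ : P → 𝕜), hcover,
    indicatorConstLp_coeFn (p := 2) (hs := hQ) (hμs := measure_ne_top μ Q) (c := (1 : 𝕜))]
    with x hx ⟨p, hp⟩ hx'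
  rw [hx p hp, setLp, hx', indicator_apply, cellIndicator_apply]
  simp only [hcQ p x hp]

variable [DecidableEq ι] {c : P → ι} {Q : P → Set E} (hQ : ∀ p, MeasurableSet (Q p))
  (hcQ : ∀ p₀ p, ∀ x ∈ cell p, x ∈ Q p₀ ↔ c p = c p₀) {T : Lp 𝕜 2 μ →L[𝕜] Lp 𝕜 2 μ} {a : ℝ}
include hcQ

include hQ hcell in
theorem cellMass_measureReal_cell (p₀ : P) :
    cellMass (fun p => μ.real (cell p)) c p₀ = μ.real (Q p₀) := by
  rw [← normSq_cellIndicator (𝕜 := ℝ), ← norm_stepLp_sq hcell hdisj,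
    stepLp_cellIndicator hcell hdisj hcover (hQ p₀) (hcQ p₀), norm_setLp_sq]

theorem cellTesting_opMatrix (hT : ∀ p, ‖T (setLp 𝕜 μ (hQ p))‖ ≤ a * √(μ.real (Q p))) :
    CellTesting (fun p => μ.real (cell p)) c (opMatrix hcell T) a := by
  intro p₀ g
  rw [cellMass_measureReal_cell hcell hdisj hcover hQ hcQ, ← mul_assoc]
  refine (norm_bilin_opMatrix_le_norm_mul_norm hcell hdisj T _ g).trans ?_
  rw [stepLp_cellIndicator hcell hdisj hcover (hQ p₀) (hcQ p₀)]
  gcongr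
  exact hT p₀

theorem cellTesting_transpose_opMatrix
    (hT : ∀ p, ‖ContinuousLinearMap.adjoint T (setLp 𝕜 μ (hQ p))‖ ≤ a * √(μ.real (Q p))) :
    CellTesting (fun p => μ.real (cell p)) c (opMatrix hcell T)ᵀ a := by
  intro p₀ g
  have hstar : star (cellIndicator c p₀ : P → 𝕜) = cellIndicator c p₀ := by
    ext p
    simp only [Pi.star_apply, cellIndicator_apply, apply_ite star, star_one, star_zero]
  rw [bilin_transpose, ← inner_stepLp_stepLp, hstar,
    stepLp_cellIndicator hcell hdisj hcover (hQ p₀) (hcQ p₀),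
    cellMass_measureReal_cell hcell hdisj hcover hQ hcQ, ← mul_assoc,
    ← ContinuousLinearMap.adjoint_inner_left]
  refine (norm_inner_le_norm _ _).trans ?_
  rw [norm_stepLp hcell hdisj]
  gcongr
  exact hT p₀

end StepFunctions

section CellTesting

variable {P ι 𝕜 : Type*} [Fintype P] [DecidableEq ι] [RCLike 𝕜] {w : P → ℝ} {b b' : Matrix P P 𝕜}
  {a a' : ℝ} {c : P → ι}

theorem CellTesting.of_norm_bilin_le
    (h : ∀ f g : P → 𝕜, ‖bilin b f g‖ ≤ a * (√(normSq w f) * √(normSq w g))) (c : P → ι) :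
    CellTesting w c b a := by
  intro p₀ g
  rw [← normSq_cellIndicator (𝕜 := 𝕜)]
  exact h _ g

theorem CellTesting.sub (h : CellTesting w c b a) (h' : CellTesting w c b' a') :
    CellTesting w c (b - b') (a + a') := by
  intro p₀ g
  rw [bilin_sub, add_mul]
  exact (norm_sub_le _ _).trans (add_le_add (h p₀ g) (h' p₀ g))

end CellTesting

section Operator

variable {d : ℕ} {𝕜 : Type*} [RCLike 𝕜] {μ : Measure (EuclideanSpace ℝ (Fin d))}
  [IsFiniteMeasure μ] {k : EuclideanSpace ℝ (Fin d) → EuclideanSpace ℝ (Fin d) → 𝕜}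
  {T : Lp 𝕜 2 μ →L[𝕜] Lp 𝕜 2 μ} {F G : Set (EuclideanSpace ℝ (Fin d))}

theorem IsCZOperator.ae_apply_setLp (hT : IsCZOperator μ k T) (hF : MeasurableSet F) :
    ∀ᵐ x ∂μ, x ∉ closure F → T (setLp 𝕜 μ hF) x = ∫ y in F, k x y ∂μ := by
  have hcoe : setLp 𝕜 μ hF =ᵐ[μ] F.indicator fun _ => (1 : 𝕜) := indicatorConstLp_coeFn
  have hset : {y | setLp 𝕜 μ hF y ≠ 0} =ᵐ[μ] F := by
    filter_upwards [hcoe] with y hy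
    refine propext ?_
    change setLp 𝕜 μ hF y ≠ 0 ↔ y ∈ F
    rw [hy]
    simp
  filter_upwards [hT (setLp 𝕜 μ hF)] with x hx hxF
  rw [hx, ← integral_indicator hF]
  · refine integral_congr_ae ?_
    filter_upwards [hcoe] with y hy
    rw [hy]
    by_cases h : y ∈ F <;> simp [h]
  · rw [essSupport, Measure.restrict_congr_set hset]
    exact fun h => hxF (Measure.support_restrict_subset h).1

theorem IsCZOperator.inner_setLp (hT : IsCZOperator μ k T) (hF : MeasurableSet F)
    (hG : MeasurableSet G) {s : ℝ} (hs : 0 < s) (hFG : ∀ x ∈ G, ∀ y ∈ F, s ≤ dist x y) :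
    inner 𝕜 (setLp 𝕜 μ hG) (T (setLp 𝕜 μ hF)) = ∫ x in G, ∫ y in F, k x y ∂μ ∂μ := by
  rw [setLp, L2.inner_indicatorConstLp_one]
  refine setIntegral_congr_ae hG ?_
  filter_upwards [hT.ae_apply_setLp hF] with x hx hxG
  refine hx fun hcl => ?_
  obtain ⟨y, hy, hxy⟩ := Metric.mem_closure_iff.mp hcl s hs
  exact absurd (hFG x hxG y hy) (not_le.mpr hxy)

end Operator

section Grid

variable {d : ℕ}

/-- The point with the coordinates `-R + η * y i`. -/
noncomputable def gridPoint (R η : ℝ) (y : Fin d → ℝ) : EuclideanSpace ℝ (Fin d) :=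
  WithLp.toLp 2 fun i => -R + η * y i

/-- The cells of side length `η` of the grid with corner `(-R, …, -R)`. -/
def gridCell (R η : ℝ) (z : Fin d → ℕ) : Set (EuclideanSpace ℝ (Fin d)) :=
  cube (gridPoint R η fun i => z i) η

/-- The cubes of side length `2 ^ n * η` of the grid shifted by `-a`. -/
def shiftedCube (R η : ℝ) (a : Fin d → ℕ) (n : ℕ) (v : Fin d → ℕ) :
    Set (EuclideanSpace ℝ (Fin d)) :=
  cube (gridPoint R η fun i => 2 ^ n * v i - a i) (η * 2 ^ n)

theorem measurableSet_gridCell (R η : ℝ) (z : Fin d → ℕ) : MeasurableSet (gridCell R η z) :=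
  measurableSet_cube _ _

theorem measurableSet_shiftedCube (R η : ℝ) (a : Fin d → ℕ) (n : ℕ) (v : Fin d → ℕ) :
    MeasurableSet (shiftedCube R η a n v) :=
  measurableSet_cube _ _

theorem dist_le_of_forall_abs_sub_le {x y : EuclideanSpace ℝ (Fin d)} {l : ℝ}
    (h : ∀ i, |x i - y i| ≤ l) : dist x y ≤ d * l := by
  calc dist x y = √(∑ i, dist (x i) (y i) ^ 2) := EuclideanSpace.dist_eq x y
    _ ≤ ∑ i, dist (x i) (y i) :=
        Real.sqrt_le_iff.mpr ⟨Finset.sum_nonneg fun _ _ => dist_nonneg,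
          Finset.sum_sq_le_sq_sum_of_nonneg fun _ _ => dist_nonneg⟩
    _ ≤ ∑ _i : Fin d, l := Finset.sum_le_sum fun i _ => h i
    _ = d * l := by simp

variable {R η : ℝ} (hη : 0 < η)
include hη

theorem mem_cube_gridPoint {y : Fin d → ℝ} {l : ℝ} {x : EuclideanSpace ℝ (Fin d)} :
    x ∈ cube (gridPoint R η y) (η * l) ↔
      ∀ i, y i ≤ (x i + R) / η ∧ (x i + R) / η < y i + l := by
  refine forall_congr' fun i => ?_
  rw [mem_Ico, le_div_iff₀ hη, div_lt_iff₀ hη, gridPoint]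
  change -R + η * y i ≤ x i ∧ x i < -R + η * y i + η * l ↔ _
  constructor <;> rintro ⟨h1, h2⟩ <;> constructor <;> linarith

theorem mem_gridCell {z : Fin d → ℕ} {x : EuclideanSpace ℝ (Fin d)} :
    x ∈ gridCell R η z ↔ ∀ i, (z i : ℝ) ≤ (x i + R) / η ∧ (x i + R) / η < z i + 1 := by
  have h := mem_cube_gridPoint (R := R) hη (y := fun i => (z i : ℝ)) (l := 1) (x := x)
  rwa [mul_one] at h

theorem disjoint_gridCell {z z' : Fin d → ℕ} (h : z ≠ z') :
    Disjoint (gridCell R η z) (gridCell R η z') := by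
  rw [disjoint_left]
  intro x hx hx'
  refine h (funext fun i => ?_)
  obtain ⟨h1, h1'⟩ := (mem_gridCell hη).mp hx i
  obtain ⟨h2, h2'⟩ := (mem_gridCell hη).mp hx' i
  have h3 : (z i : ℝ) < z' i + 1 := h1.trans_lt h2'
  have h4 : (z' i : ℝ) < z i + 1 := h2.trans_lt h1'
  norm_cast at h3 h4
  lia

theorem exists_mem_gridCell {M : ℕ} (hM : η * 2 ^ M = 2 * R) {x : EuclideanSpace ℝ (Fin d)}
    (hx : x ∈ ball 0 R) : ∃ z : Fin d → Fin (2 ^ M), x ∈ gridCell R η fun i => (z i : ℕ) := by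
  have hxi : ∀ i, |x i| < R := fun i =>
    (PiLp.norm_apply_le x i).trans_lt (mem_ball_zero_iff.mp hx)
  have h0 : ∀ i, 0 ≤ (x i + R) / η := fun i =>
    div_nonneg (by linarith [(abs_lt.mp (hxi i)).1]) hη.le
  have h1 : ∀ i, ⌊(x i + R) / η⌋₊ < 2 ^ M := fun i => by
    rw [Nat.floor_lt (h0 i), div_lt_iff₀ hη]
    push_cast
    linarith [(abs_lt.mp (hxi i)).2]
  exact ⟨fun i => ⟨_, h1 i⟩, (mem_gridCell hη).mpr fun i =>
    ⟨Nat.floor_le (h0 i), Nat.lt_floor_add_one _⟩⟩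

theorem ae_exists_mem_gridCell {μ : Measure (EuclideanSpace ℝ (Fin d))} [IsFiniteMeasure μ]
    {M : ℕ} (hM : η * 2 ^ M = 2 * R) (hR : μ.support ⊆ ball 0 R) :
    ∀ᵐ x ∂μ, ∃ p : {z : Fin d → Fin (2 ^ M) // 0 < μ.real (gridCell R η fun i => (z i : ℕ))},
      x ∈ gridCell R η fun i => (p.1 i : ℕ) := by
  have hpos : ∀ᵐ x ∂μ, ∀ z : Fin d → Fin (2 ^ M),
      x ∈ gridCell R η (fun i => (z i : ℕ)) → 0 < μ.real (gridCell R η fun i => (z i : ℕ)) := by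
    rw [Filter.eventually_all]
    intro z
    rcases (measureReal_nonneg (μ := μ)
      (s := gridCell R η fun i => (z i : ℕ))).eq_or_lt' with hz | hz
    · have h0 := (measureReal_eq_zero_iff (measure_ne_top μ _)).mp hz
      exact (measure_eq_zero_iff_ae_notMem.mp h0).mono fun _ hx hxz => absurd hxz hx
    · exact .of_forall fun _ _ => hz
  filter_upwards [hpos, Measure.support_mem_ae] with x hx hxS
  obtain ⟨z, hz⟩ := exists_mem_gridCell hη hM (hR hxS)
  exact ⟨⟨z, hx z hz⟩, hz⟩

variable {P : Type*} {pos : P → Fin d → ℕ} {a : Fin d → ℕ} {n : ℕ} {p q : P}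

theorem mem_shiftedCube_iff {v : Fin d → ℕ} {x : EuclideanSpace ℝ (Fin d)}
    (hx : x ∈ gridCell R η (pos p)) :
    x ∈ shiftedCube R η a n v ↔ cellIdx pos a n p = v := by
  rw [shiftedCube, mem_cube_gridPoint hη, funext_iff]
  refine forall_congr' fun i => ?_
  obtain ⟨h1, h2⟩ := (mem_gridCell hη).mp hx i
  rw [cellIdx, Nat.div_eq_iff (by positivity), mul_comm (v i)]
  constructor
  · rintro ⟨h3, h4⟩
    have h5 : (2 ^ n * v i : ℝ) < pos p i + a i + 1 := by linarith
    have h6 : (pos p i + a i : ℝ) < 2 ^ n * v i + 2 ^ n := by linarith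
    norm_cast at h5 h6
    lia
  · rintro ⟨h3, h4⟩
    have h5 : (2 ^ n * v i : ℝ) ≤ pos p i + a i := by exact_mod_cast h3
    have h6 : pos p i + a i + 1 ≤ 2 ^ n * v i + 2 ^ n := by
      have : 0 < 2 ^ n := by positivity
      lia
    have h7 : (pos p i + a i + 1 : ℝ) ≤ 2 ^ n * v i + 2 ^ n := by exact_mod_cast h6
    constructor <;> linarith

theorem coord_mem_of_mem_gridCell (a : Fin d → ℕ) (n : ℕ) {x : EuclideanSpace ℝ (Fin d)}
    (hx : x ∈ gridCell R η (pos p)) (i : Fin d) :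
    x i + R + η * a i ∈ Ico (η * 2 ^ n * cellIdx pos a n p i)
      (η * 2 ^ n * (cellIdx pos a n p i + 1)) := by
  have h := (mem_cube_gridPoint hη).mp ((mem_shiftedCube_iff (a := a) (n := n) hη hx).mpr rfl) i
  rw [le_div_iff₀ hη, div_lt_iff₀ hη] at h
  constructor <;> linarith [h.1, h.2]

variable {x y : EuclideanSpace ℝ (Fin d)} (hx : x ∈ gridCell R η (pos p))
  (hy : y ∈ gridCell R η (pos q))
include hx hy

theorem dist_le_of_cellIdx_eq (h : cellIdx pos a n p = cellIdx pos a n q) :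
    dist x y ≤ d * (η * 2 ^ n) := by
  refine dist_le_of_forall_abs_sub_le fun i => ?_
  obtain ⟨hx₁, hx₂⟩ := coord_mem_of_mem_gridCell hη a n hx i
  obtain ⟨hy₁, hy₂⟩ := coord_mem_of_mem_gridCell hη a n hy i
  rw [h] at hx₁ hx₂
  exact abs_le.mpr ⟨by linarith, by linarith⟩

theorem le_dist_of_cellIdx_add_lt {σ : ℕ} {i : Fin d}
    (h : cellIdx pos a n p i + σ < cellIdx pos a n q i) : σ * (η * 2 ^ n) ≤ dist x y := by
  have hx₁ := (coord_mem_of_mem_gridCell hη a n hx i).2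
  have hy₁ := (coord_mem_of_mem_gridCell hη a n hy i).1
  have hidx : (cellIdx pos a n p i + σ + 1 : ℝ) ≤ cellIdx pos a n q i := by exact_mod_cast h
  have hscaled := mul_le_mul_of_nonneg_left hidx (show 0 ≤ η * 2 ^ n by positivity)
  calc σ * (η * 2 ^ n) ≤ y i - x i := by linarith
    _ ≤ dist (x i) (y i) := by
        rw [dist_comm]
        exact le_abs_self _
    _ ≤ dist x y := PiLp.dist_apply_le x y i

theorem le_dist_of_not_nearIdx {σ : ℕ}
    (h : ¬NearIdx σ (cellIdx pos a n p) (cellIdx pos a n q)) : σ * (η * 2 ^ n) ≤ dist x y := by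
  simp only [NearIdx, not_forall, not_and_or, not_le] at h
  obtain ⟨i, h | h⟩ := h
  · rw [dist_comm]
    exact le_dist_of_cellIdx_add_lt hη hy hx h
  · exact le_dist_of_cellIdx_add_lt hη hx hy h

end Grid

theorem IsGoodCell.not_nearIdx {P : Type*} {d r M : ℕ} {pos : P → Fin d → ℕ} {a : Fin d → ℕ}
    {n j : ℕ} {p q : P} (hp : IsGoodCell r M pos a n p) (hj : r ≤ j) (hjM : n + j ≤ M)
    (h : cellIdx pos a (n + j) q ≠ cellIdx pos a (n + j) p) :
    ¬NearIdx (2 ^ (j / 2)) (cellIdx pos a n p) (cellIdx pos a n q) := by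
  obtain ⟨i, hi⟩ := Function.ne_iff.mp h
  rw [cellIdx_add, cellIdx_add] at hi
  intro hnear
  obtain ⟨hpq, hqp⟩ := hnear i
  have hgood := hp j hj hjM i
  simp only [boundaryResidues, Finset.mem_union, Finset.mem_range, Finset.mem_Ico] at hgood
  have hp_div := Nat.div_add_mod (cellIdx pos a n p i) (2 ^ j)
  have hq_div := Nat.div_add_mod (cellIdx pos a n q i) (2 ^ j)
  have hp_mod : cellIdx pos a n p i % 2 ^ j < 2 ^ j := Nat.mod_lt _ (by positivity)
  have hq_mod : cellIdx pos a n q i % 2 ^ j < 2 ^ j := Nat.mod_lt _ (by positivity)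
  rcases Nat.lt_or_gt_of_ne hi with hlt | hlt
  · have := Nat.mul_le_mul_left (2 ^ j) hlt
    lia
  · have := Nat.mul_le_mul_left (2 ^ j) hlt
    lia

theorem exists_norm_sub_stepLp_le {E 𝕜 : Type*} [MetricSpace E] [MeasurableSpace E] [BorelSpace E]
    [LocallyCompactSpace E] [RCLike 𝕜] {μ : Measure E} [IsProbabilityMeasure μ] [μ.Regular]
    (F : Lp 𝕜 2 μ) {ε : ℝ} (hε : 0 < ε) :
    ∃ ρ > 0, ∀ (P : Type) [Fintype P] (cell : P → Set E) (hcell : ∀ p, MeasurableSet (cell p)),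
      Pairwise (Function.onFun Disjoint cell) → (∀ᵐ x ∂μ, ∃ p, x ∈ cell p) →
      (∀ p, (cell p).Nonempty) → (∀ p, ∀ x ∈ cell p, ∀ y ∈ cell p, dist x y < ρ) →
      ∃ f : P → 𝕜, ‖F - stepLp μ hcell f‖ ≤ ε := by
  obtain ⟨g, hgc, hg, hgcont, hgm⟩ := (Lp.memLp F).exists_hasCompactSupport_eLpNorm_sub_le
    (by simp) (ε := ENNReal.ofReal (ε / 2)) (by simpa using hε)
  obtain ⟨ρ, hρ, hu⟩ := Metric.uniformContinuous_iff.mp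
    (hgc.uniformContinuous_of_continuous hgcont) (ε / 2) (by positivity)
  refine ⟨ρ, hρ, fun P _ cell hcell hdisj hcover hne hsmall => ?_⟩
  choose y hy using hne
  have happrox : ‖F - hgm.toLp g‖ ≤ ε / 2 := by
    rw [Lp.norm_def]
    refine ENNReal.toReal_le_of_le_ofReal (by positivity) ?_
    rw [← Lp.toLp_coeFn F (Lp.memLp F), ← MemLp.toLp_sub, eLpNorm_congr_ae (MemLp.coeFn_toLp _)]
    exact hg
  have hstep : ‖hgm.toLp g - stepLp μ hcell fun p => g (y p)‖ ≤ ε / 2 := by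
    refine (Lp.norm_le_of_ae_bound (C := ε / 2) (by positivity) ?_).trans
      (by simp [measureUnivNNReal])
    filter_upwards [Lp.coeFn_sub (hgm.toLp g) (stepLp μ hcell fun p => g (y p)), hgm.coeFn_toLp,
      ae_stepLp_apply_of_mem hcell hdisj fun p => g (y p), hcover] with x hx hx1 hx2 ⟨p, hp⟩
    rw [hx, Pi.sub_apply, hx1, hx2 p hp, ← dist_eq_norm]
    exact (hu (hsmall p x hp _ (hy p))).le
  refine ⟨fun p => g (y p), (norm_sub_le_norm_sub_add_norm_sub _ (hgm.toLp g) _).trans ?_⟩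
  linarith

section OffDiagonal

/-- The matrix `b` agrees with the integrals of the kernel `K` on pairs of cells at a positive
distance from each other. -/
def RepresentsOffDiag {E P 𝕜 : Type*} [MetricSpace E] [MeasurableSpace E] [RCLike 𝕜]
    (μ : Measure E) (cell : P → Set E) (K : E → E → 𝕜) (b : Matrix P P 𝕜) : Prop :=
  ∀ p q s, 0 < s → (∀ x ∈ cell q, ∀ y ∈ cell p, s ≤ dist x y) → b p q = cellIntegral μ cell K p q

/-- A scaled kernel on the support of `μ` whose size bound holds for the scales of both variables,
where `μ` has growth of order `m` above the scale `δ`. -/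
structure IsSuppressibleKernel {E 𝕜 : Type*} [MetricSpace E] [MeasurableSpace E] [RCLike 𝕜]
    (μ : Measure E) (δ : E → ℝ) (m C τ : ℝ) (k : E → E → 𝕜) : Prop where
  kernel : IsScaledKernel μ.support δ m C τ k
  kernel_swap : IsScaledKernel μ.support δ m C τ fun x y => k y x
  growth : ∀ x r, δ x < r → μ (ball x r) ≤ ENNReal.ofReal (r ^ m)
  C_pos : 0 < C
  m_pos : 0 < m
  τ_pos : 0 < τ
  τ_le_one : τ ≤ 1

/-- The constant in the interaction of a mean zero function on a cell with the functions that are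
far from the cell, in units of the `τ`-th power of the relative distance. -/
noncomputable def farConst (m C τ : ℝ) : ℝ := 5 * C * (32 ^ m / (1 - 2 ^ (-τ)))

theorem farConst_pos {m C τ : ℝ} (hC : 0 < C) (hτ : 0 < τ) : 0 < farConst m C τ := by
  have : 0 < 1 - (2 : ℝ) ^ (-τ) :=
    sub_pos.mpr (Real.rpow_lt_one_of_one_lt_of_neg one_lt_two (neg_lt_zero.mpr hτ))
  unfold farConst
  positivity

theorem IsScaledKernel.norm_mulKernel_le_of_le_dist {E 𝕜 : Type*} [MetricSpace E] [RCLike 𝕜]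
    {S : Set E} {δ : E → ℝ} {m C τ : ℝ} {k : E → E → 𝕜} {φ : E → E → ℝ}
    (hk : IsScaledKernel S δ m C τ k) (hC : 0 ≤ C) (hm : 0 < m) (h0 : ∀ x y, 0 ≤ φ x y)
    (h1 : ∀ x y, φ x y ≤ 1) {s : ℝ} (hs : 0 < s) {x y : E} (h : s ≤ dist x y) :
    ‖mulKernel S φ k x y‖ ≤ C / s ^ m := by
  by_cases hxy : x ∈ S ∧ y ∈ S
  · calc ‖mulKernel S φ k x y‖ ≤ ‖k x y‖ := norm_mulKernel_le h0 h1 x y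
      _ ≤ C / dist x y ^ m := hk.size x hxy.1 y hxy.2 (dist_pos.mp (hs.trans_le h))
      _ ≤ C / s ^ m := by gcongr
  · rw [mulKernel, if_neg fun h => hxy ⟨h.1, h.2.1⟩, norm_zero]
    positivity

namespace IsSuppressibleKernel

variable {E P ι 𝕜 : Type*} [MetricSpace E] [MeasurableSpace E] [RCLike 𝕜] {μ : Measure E}
  {δ : E → ℝ} {m C τ : ℝ} {k : E → E → 𝕜} {cell : P → Set E}

theorem swap (hk : IsSuppressibleKernel μ δ m C τ k) :
    IsSuppressibleKernel μ δ m C τ fun x y => k y x :=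
  { hk with kernel := hk.kernel_swap, kernel_swap := hk.kernel }

variable (hk : IsSuppressibleKernel μ δ m C τ k)
include hk

theorem norm_farKernel_le_of_le_dist {s : ℝ} (hs : 0 < s) {x y : E} (h : s ≤ dist x y) :
    ‖farKernel μ.support δ k x y‖ ≤ C / s ^ m :=
  hk.kernel.norm_mulKernel_le_of_le_dist hk.C_pos.le hk.m_pos cutoff_nonneg cutoff_le_one hs h

theorem norm_localKernel_le_of_le_dist {s : ℝ} (hs : 0 < s) {x y : E} (h : s ≤ dist x y) :
    ‖localKernel μ.support δ k x y‖ ≤ C / s ^ m :=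
  hk.kernel.norm_mulKernel_le_of_le_dist hk.C_pos.le hk.m_pos
    (fun x y => sub_nonneg.mpr (cutoff_le_one x y))
    (fun x y => sub_le_self 1 (cutoff_nonneg x y)) hs h

variable [BorelSpace E]

theorem lintegral_truncWeight_le_ofReal {L s C' : ℝ} (hL : 0 ≤ L) (hs : 0 < s)
    (hC' : farConst m C τ * (L / s) ^ τ ≤ C') (x : E) :
    ∫⁻ y, truncWeight δ m τ (5 * C * L ^ τ) s x y ∂μ ≤ ENNReal.ofReal C' := by
  have hD : 0 ≤ 5 * C * L ^ τ := mul_nonneg (by linarith [hk.C_pos]) (Real.rpow_nonneg hL τ)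
  refine (lintegral_truncWeight_le hk.kernel.nonneg hk.m_pos hk.τ_pos hD hs x (hk.growth x)).trans
    (ENNReal.ofReal_le_ofReal (le_of_eq_of_le ?_ hC'))
  rw [farConst, Real.div_rpow hL hs.le, Real.rpow_neg hs.le]
  ring

variable [SecondCountableTopology E]

theorem stronglyMeasurable_farKernel :
    StronglyMeasurable (Function.uncurry (farKernel μ.support δ k)) :=
  hk.kernel.stronglyMeasurable_farKernel hk.C_pos.le hk.m_pos hk.τ_pos Measure.isClosed_support

theorem stronglyMeasurable_localKernel :
    StronglyMeasurable (Function.uncurry (localKernel μ.support δ k)) :=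
  hk.kernel.stronglyMeasurable_localKernel hk.C_pos.le hk.m_pos hk.τ_pos Measure.isClosed_support

omit [BorelSpace E] [SecondCountableTopology E] in
theorem enorm_farKernel_sub_le_truncWeight {L s : ℝ} (hs : 0 < s) (hLs : L ≤ s / 2) {x y y' : E}
    (hx : x ∈ μ.support) (hy : y ∈ μ.support) (hy' : y' ∈ μ.support) (hxy : s ≤ dist x y)
    (hyy' : dist y y' ≤ L) :
    ‖farKernel μ.support δ k x y - farKernel μ.support δ k x y'‖ₑ ≤
      truncWeight δ m τ (5 * C * L ^ τ) s x y := by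
  have h := hk.kernel_swap.norm_farKernel_sub_le hk.τ_le_one hy hy' hx
    (dist_pos.mp (by rw [dist_comm]; linarith)) (by rw [dist_comm y x]; linarith)
  rw [farKernel_swap (k := k) y x, farKernel_swap (k := k) y' x, smoothWeight_comm] at h
  rw [truncWeight, if_pos hxy, ← ofReal_norm]
  refine ENNReal.ofReal_le_ofReal (h.trans ?_)
  have hC := hk.C_pos
  have hτ := hk.τ_pos
  have hweight := smoothWeight_nonneg (δ := δ) (m := m) (τ := τ) x y
  gcongr

variable [IsFiniteMeasure μ]

theorem decouples [Fintype P] (hcell : ∀ p, MeasurableSet (cell p))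
    (hdisj : Pairwise (Function.onFun Disjoint cell)) (hpos : ∀ p, 0 < μ.real (cell p)) {c : P → ι}
    {R : P → P → Prop} {b : Matrix P P 𝕜}
    (hb : RepresentsOffDiag μ cell (farKernel μ.support δ k) b) {L s C' : ℝ} (hL : 0 ≤ L)
    (hs : 0 < s) (hLs : L ≤ s / 2) (hC' : farConst m C τ * (L / s) ^ τ ≤ C')
    (hdiam : ∀ p p₀, c p = c p₀ → ∀ y ∈ cell p, ∀ y' ∈ cell p₀, dist y y' ≤ L)
    (hsep : ∀ p₀ p q, c p = c p₀ → R p₀ q → ∀ x ∈ cell q, ∀ y ∈ cell p, s ≤ dist x y) :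
    Decouples (fun p => μ.real (cell p)) c b R C' := by
  have hC'0 : 0 ≤ C' :=
    (mul_nonneg (farConst_pos hk.C_pos hk.τ_pos).le (by positivity)).trans hC'
  have hrow := hk.lintegral_truncWeight_le_ofReal hL hs hC'
  refine decouples_of_kernel hcell hdisj hpos Measure.support_mem_ae hk.stronglyMeasurable_farKernel
    (measurable_truncWeight hk.kernel.continuous_scale (5 * C * L ^ τ) s) hC'0 hrow
    (fun y => ?_) (B := C / s ^ m) (fun p₀ p q hp hR => hb p q s hs (hsep p₀ p q hp hR))
    (fun p₀ p q hp hR x hx y hy =>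
      hk.norm_farKernel_le_of_le_dist hs (hsep p₀ p q hp hR x hx.1 y hy.1))
    fun p₀ p q hp hR x hx y hy y' hy' => hk.enorm_farKernel_sub_le_truncWeight hs hLs hx.2 hy.2
      hy'.2 (hsep p₀ p q hp hR x hx.1 y hy.1) (hdiam p p₀ hp y hy.1 y' hy'.1)
  simpa only [truncWeight_comm _ s _ y] using hrow y

theorem norm_bilin_cellIntegral_localKernel_le [Fintype P] (hcell : ∀ p, MeasurableSet (cell p))
    (hdisj : Pairwise (Function.onFun Disjoint cell)) (f g : P → 𝕜) :
    ‖bilin (cellIntegral μ cell (localKernel μ.support δ k)) f g‖ ≤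
      2 ^ m * (√(normSq (fun p => μ.real (cell p)) f) *
        √(normSq (fun p => μ.real (cell p)) g)) := by
  refine norm_bilin_cellIntegral_le hcell hdisj hk.stronglyMeasurable_localKernel
    (by positivity) (fun x => hk.kernel.lintegral_localKernel_le x (hk.growth x)) (fun y => ?_) f g
  have h := hk.kernel_swap.lintegral_localKernel_le y (hk.growth y)
  simpa only [localKernel_swap] using h

end IsSuppressibleKernel

theorem integrable_prod_restrict_of_bound {E 𝕜 : Type*} [MeasurableSpace E] [RCLike 𝕜]
    {μ : Measure E} [IsFiniteMeasure μ] {K : E → E → 𝕜}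
    (hK : StronglyMeasurable (Function.uncurry K)) {F G : Set E} (hF : MeasurableSet F)
    (hG : MeasurableSet G) {B : ℝ} (hB : ∀ x ∈ G, ∀ y ∈ F, ‖K x y‖ ≤ B) :
    Integrable (Function.uncurry K) ((μ.restrict G).prod (μ.restrict F)) := by
  refine Integrable.of_bound hK.aestronglyMeasurable B ?_
  rw [Measure.prod_restrict]
  filter_upwards [ae_restrict_mem (hG.prod hF)] with z hz using hB z.1 hz.1 z.2 hz.2

namespace RepresentsOffDiag

variable {E P 𝕜 : Type*} [MetricSpace E] [MeasurableSpace E] [BorelSpace E]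
  [SecondCountableTopology E] [RCLike 𝕜] {μ : Measure E} [IsFiniteMeasure μ] {cell : P → Set E}
  {δ : E → ℝ} {m C τ : ℝ} {k : E → E → 𝕜} {b : Matrix P P 𝕜}

variable (hk : IsSuppressibleKernel μ δ m C τ k) (hcell : ∀ p, MeasurableSet (cell p))
include hk hcell

theorem sub_localKernel (hb : RepresentsOffDiag μ cell k b) :
    RepresentsOffDiag μ cell (farKernel μ.support δ k)
      (b - cellIntegral μ cell (localKernel μ.support δ k)) := by
  intro p q s hs hpq
  have hf := integrable_prod_restrict_of_bound (μ := μ) hk.stronglyMeasurable_farKernel (hcell p)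
    (hcell q) fun x hx y hy => hk.norm_farKernel_le_of_le_dist hs (hpq x hx y hy)
  have hl := integrable_prod_restrict_of_bound (μ := μ) hk.stronglyMeasurable_localKernel (hcell p)
    (hcell q) fun x hx y hy => hk.norm_localKernel_le_of_le_dist hs (hpq x hx y hy)
  have hsum : cellIntegral μ cell k p q = ∫ x in cell q, ∫ y in cell p,
      (farKernel μ.support δ k x y + localKernel μ.support δ k x y) ∂μ ∂μ := by
    refine integral_congr_ae ?_
    filter_upwards [ae_restrict_mem_inter (S := μ.support) (hcell q) Measure.support_mem_ae]
      with x hx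
    refine integral_congr_ae ?_
    filter_upwards [ae_restrict_mem_inter (S := μ.support) (hcell p) Measure.support_mem_ae]
      with y hy
    rw [farKernel_add_localKernel hx.2 hy.2 (dist_pos.mp (hs.trans_le (hpq x hx.1 y hy.1)))]
  rw [Matrix.sub_apply, hb p q s hs hpq, hsum, sub_eq_iff_eq_add, cellIntegral, cellIntegral,
    integral_integral
      (f := fun x y => farKernel μ.support δ k x y + localKernel μ.support δ k x y) (hf.add hl),
    integral_integral hf, integral_integral hl]
  exact integral_add hf hl

theorem transpose (hb : RepresentsOffDiag μ cell (farKernel μ.support δ k) b) :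
    RepresentsOffDiag μ cell (farKernel μ.support δ fun x y => k y x) b.transpose := by
  intro p q s hs hpq
  have hqp : ∀ x ∈ cell p, ∀ y ∈ cell q, s ≤ dist x y := fun x hx y hy => by
    rw [dist_comm]
    exact hpq y hy x hx
  rw [Matrix.transpose_apply, hb q p s hs hqp, cellIntegral, cellIntegral,
    integral_integral_swap (integrable_prod_restrict_of_bound hk.stronglyMeasurable_farKernel
      (hcell q) (hcell p) fun x hx y hy => hk.norm_farKernel_le_of_le_dist hs (hqp x hx y hy))]
  simp only [farKernel_swap]

end RepresentsOffDiag

end OffDiagonal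

section GridForm

/-- The weights of the cells of a grid. -/
noncomputable abbrev gridWeight {d : ℕ} {P : Type*} (μ : Measure (EuclideanSpace ℝ (Fin d)))
    (R η : ℝ) (pos : P → Fin d → ℕ) (p : P) : ℝ :=
  μ.real (gridCell R η (pos p))

/-- The matrix of an operator with respect to the indicator functions of the cells of a grid. -/
noncomputable abbrev gridMatrix {d : ℕ} {P 𝕜 : Type*} [RCLike 𝕜]
    {μ : Measure (EuclideanSpace ℝ (Fin d))} [IsFiniteMeasure μ] (R η : ℝ) (pos : P → Fin d → ℕ)
    (T : Lp 𝕜 2 μ →L[𝕜] Lp 𝕜 2 μ) : Matrix P P 𝕜 :=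
  opMatrix (fun p => measurableSet_gridCell R η (pos p)) T

/-- The cells of side `η` at the distinct positions `pos p` in a cube of `2 ^ M` cells per axis have
positive measure and cover almost everything. -/
structure IsGrid {d : ℕ} {P : Type*} (μ : Measure (EuclideanSpace ℝ (Fin d))) (R η : ℝ) (M : ℕ)
    (pos : P → Fin d → ℕ) : Prop where
  side_pos : 0 < η
  injective : Function.Injective pos
  pos_lt : ∀ p i, pos p i < 2 ^ M
  weight_pos : ∀ p, 0 < gridWeight μ R η pos p
  ae_cover : ∀ᵐ x ∂μ, ∃ p, x ∈ gridCell R η (pos p)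

/-- The constant in the decoupling of separated cells of a dyadic grid. -/
noncomputable def offDiagConst (d : ℕ) (m C τ : ℝ) : ℝ := farConst m C τ * (2 * d + 1) ^ τ

theorem offDiagConst_pos (d : ℕ) {m C τ : ℝ} (hC : 0 < C) (hτ : 0 < τ) :
    0 < offDiagConst d m C τ :=
  mul_pos (farConst_pos hC hτ) (by positivity)

theorem two_rpow_neg_half_lt_one {τ : ℝ} (hτ : 0 < τ) : (2 : ℝ) ^ (-(τ / 2)) < 1 :=
  Real.rpow_lt_one_of_one_lt_of_neg one_lt_two (by linarith)

theorem inv_two_pow_half_rpow_le {τ : ℝ} (hτ : 0 ≤ τ) (j : ℕ) :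
    (((2 : ℝ) ^ (j / 2))⁻¹) ^ τ ≤ 2 ^ τ * (2 ^ (-(τ / 2))) ^ j := by
  have hj : (j : ℝ) ≤ 2 * (j / 2 : ℕ) + 1 := by exact_mod_cast (by lia : j ≤ 2 * (j / 2) + 1)
  rw [← Real.rpow_natCast, ← Real.rpow_natCast, ← Real.rpow_neg two_pos.le,
    ← Real.rpow_mul two_pos.le, ← Real.rpow_mul two_pos.le, ← Real.rpow_add two_pos]
  exact Real.rpow_le_rpow_of_exponent_le one_le_two (by nlinarith)

theorem farConst_mul_div_two_pow_half_rpow_le (d : ℕ) {m C τ : ℝ} (hC : 0 < C) (hτ : 0 < τ)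
    (j : ℕ) :
    farConst m C τ * (d / (2 ^ (j / 2) : ℕ)) ^ τ ≤
      offDiagConst d m C τ * (2 ^ (-(τ / 2))) ^ j := by
  have hfarConst := farConst_pos (m := m) hC hτ
  rw [offDiagConst, mul_assoc]
  gcongr
  calc ((d : ℝ) / (2 ^ (j / 2) : ℕ)) ^ τ = d ^ τ * ((2 ^ (j / 2) : ℝ)⁻¹) ^ τ := by
        rw [← Real.mul_rpow (by positivity) (by positivity), div_eq_mul_inv]
        push_cast
        rfl
    _ ≤ d ^ τ * (2 ^ τ * (2 ^ (-(τ / 2))) ^ j) := by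
        gcongr
        exact inv_two_pow_half_rpow_le hτ.le j
    _ = (2 * d) ^ τ * (2 ^ (-(τ / 2))) ^ j := by
        rw [Real.mul_rpow (by positivity) (by positivity)]
        ring
    _ ≤ (2 * d + 1) ^ τ * (2 ^ (-(τ / 2))) ^ j := by
        gcongr
        linarith

variable {d : ℕ} {P 𝕜 : Type*} [RCLike 𝕜] {μ : Measure (EuclideanSpace ℝ (Fin d))} {R η : ℝ}
  {M : ℕ} {pos : P → Fin d → ℕ} {δ : EuclideanSpace ℝ (Fin d) → ℝ} {m C τ : ℝ}
  {k : EuclideanSpace ℝ (Fin d) → EuclideanSpace ℝ (Fin d) → 𝕜} {a : Fin d → ℕ} {A : ℝ}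

theorem IsGrid.pairwise_disjoint (hG : IsGrid μ R η M pos) :
    Pairwise (Function.onFun Disjoint fun p => gridCell R η (pos p)) :=
  fun _ _ hpq => disjoint_gridCell hG.side_pos (hG.injective.ne hpq)

variable [IsFiniteMeasure μ] [Fintype P]

theorem IsSuppressibleKernel.decouples_cellIdx (hk : IsSuppressibleKernel μ δ m C τ k)
    (hG : IsGrid μ R η M pos) {b : Matrix P P 𝕜}
    (hb : RepresentsOffDiag μ (fun p => gridCell R η (pos p)) (farKernel μ.support δ k) b)
    {n σ : ℕ} (hσ : 0 < σ) (hdσ : 2 * d ≤ σ) {Rel : P → P → Prop} {C' : ℝ}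
    (hsep : ∀ p₀ p q, cellIdx pos a n p = cellIdx pos a n p₀ → Rel p₀ q →
      ¬NearIdx σ (cellIdx pos a n p) (cellIdx pos a n q))
    (hC' : farConst m C τ * (d / σ) ^ τ ≤ C') :
    Decouples (gridWeight μ R η pos) (cellIdx pos a n) b Rel C' := by
  have hη := hG.side_pos
  have hσ' : (2 * d : ℝ) ≤ σ := by exact_mod_cast hdσ
  have hside : 0 < η * 2 ^ n := by positivity
  refine hk.decouples (fun p => measurableSet_gridCell R η (pos p)) hG.pairwise_disjoint
    hG.weight_pos hb (L := d * (η * 2 ^ n)) (s := σ * (η * 2 ^ n)) (by positivity) (by positivity)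
    (by nlinarith) ?_ (fun p p₀ hp y hy y' hy' => dist_le_of_cellIdx_eq hη hy hy' hp)
    fun p₀ p q hp hR x hx y hy => ?_
  · rwa [mul_div_mul_right _ _ hside.ne']
  · rw [dist_comm]
    exact le_dist_of_not_nearIdx hη hy hx (hsep p₀ p q hp hR)

theorem IsSuppressibleKernel.isUpperT1Form (hk : IsSuppressibleKernel μ δ m C τ k)
    (hG : IsGrid μ R η M pos) (ha : ∀ i, a i < 2 ^ M) {r : ℕ} (hr : 2 * d ≤ 2 ^ (r / 2))
    {b : Matrix P P 𝕜}
    (hb : RepresentsOffDiag μ (fun p => gridCell R η (pos p)) (farKernel μ.support δ k) b)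
    (hA : 0 ≤ A) (h : ∀ n, CellTesting (gridWeight μ R η pos) (cellIdx pos a n) b A)
    (h' : ∀ n, CellTesting (gridWeight μ R η pos) (cellIdx pos a n) b.transpose A) :
    IsUpperT1Form (gridWeight μ R η pos) (cellIdx pos a) b (NearIdx (2 * d + 1))
      (IsGoodCell r M pos a) r ((4 * (2 * d + 1) + 2) ^ d) A (offDiagConst d m C τ)
      (2 ^ (-(τ / 2))) where
  weight_pos := hG.weight_pos
  nested := nestedCells_cellIdx pos a
  good_factorsThrough := isGoodCell_factorsThrough r M pos a
  near_card := ncard_cellIdx_nearIdx_le pos a (2 * d + 1)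
  testing := h
  testing_transpose := h'
  near_far n := by
    refine hk.decouples_cellIdx hG hb (σ := 2 * d + 1) (by lia) (by lia)
      (fun p₀ p q hp hfar => by rwa [hp]) ?_
    have hfarConst := farConst_pos (m := m) hk.C_pos hk.τ_pos
    have hτ := hk.τ_pos
    unfold offDiagConst
    gcongr
    push_cast
    rw [div_le_iff₀ (by positivity)]
    nlinarith [(Nat.cast_nonneg d : (0 : ℝ) ≤ d)]
  good_far n j hj := by
    refine hk.decouples_cellIdx hG hb (σ := 2 ^ (j / 2)) (by positivity)
      (hr.trans (Nat.pow_le_pow_right two_pos (Nat.div_le_div_right hj))) ?_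
      (farConst_mul_div_two_pow_half_rpow_le d hk.C_pos hk.τ_pos j)
    rintro p₀ p q hp ⟨hgood, hne⟩
    have hjM : n + j ≤ M := by
      by_contra! h
      exact hne (by rw [cellIdx_eq_zero hG.pos_lt ha h, cellIdx_eq_zero hG.pos_lt ha h])
    rw [hp]
    exact hgood.not_nearIdx hj hjM hne
  a_nonneg := hA
  C_pos := offDiagConst_pos d hk.C_pos hk.τ_pos
  θ_nonneg := by positivity
  θ_lt_one := two_rpow_neg_half_lt_one hk.τ_pos

end GridForm

section GridOperator

variable {d : ℕ} {P 𝕜 : Type*} [RCLike 𝕜] {μ : Measure (EuclideanSpace ℝ (Fin d))}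
  [IsFiniteMeasure μ] {R η : ℝ} {M : ℕ} {pos : P → Fin d → ℕ} {A : ℝ}
  {T : Lp 𝕜 2 μ →L[𝕜] Lp 𝕜 2 μ}

theorem T1Condition.norm_le (hA : T1Condition μ A T) (hη : 0 < η) (a : Fin d → ℕ) (n : ℕ)
    (v : Fin d → ℕ) :
    ‖T (setLp 𝕜 μ (measurableSet_shiftedCube R η a n v))‖ ≤
      √|A| * √(μ.real (shiftedCube R η a n v)) := by
  rw [← Real.sqrt_mul (abs_nonneg A)]
  refine Real.le_sqrt_of_sq_le ((hA _ (η * 2 ^ n) (by positivity)).trans ?_)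
  exact mul_le_mul_of_nonneg_right (le_abs_self A) measureReal_nonneg

variable [Fintype P]

theorem IsGrid.cellTesting (hG : IsGrid μ R η M pos) (hA : T1Condition μ A T) (a : Fin d → ℕ)
    (n : ℕ) :
    CellTesting (gridWeight μ R η pos) (cellIdx pos a n) (gridMatrix R η pos T) √|A| :=
  cellTesting_opMatrix _ hG.pairwise_disjoint hG.ae_cover
    (fun p => measurableSet_shiftedCube R η a n (cellIdx pos a n p))
    (fun _ _ _ hx => mem_shiftedCube_iff hG.side_pos hx) fun _ => hA.norm_le hG.side_pos a n _

theorem IsGrid.cellTesting_transpose (hG : IsGrid μ R η M pos)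
    (hA : T1Condition μ A (ContinuousLinearMap.adjoint T)) (a : Fin d → ℕ) (n : ℕ) :
    CellTesting (gridWeight μ R η pos) (cellIdx pos a n) (gridMatrix R η pos T).transpose √|A| :=
  cellTesting_transpose_opMatrix _ hG.pairwise_disjoint hG.ae_cover
    (fun p => measurableSet_shiftedCube R η a n (cellIdx pos a n p))
    (fun _ _ _ hx => mem_shiftedCube_iff hG.side_pos hx) fun _ => hA.norm_le hG.side_pos a n _

/-- The bound for the form of the operator on good functions. -/
noncomputable def goodConst (d r : ℕ) (A m C τ : ℝ) : ℝ :=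
  (√|A| + 2 ^ m) +
    2 * upperConst r ((4 * (2 * d + 1) + 2) ^ d) (√|A| + 2 ^ m) (offDiagConst d m C τ)
      (2 ^ (-(τ / 2))) +
    ((√|A| + 2 ^ m) * √((4 * (2 * d + 1) + 2) ^ d : ℕ) + offDiagConst d m C τ) + 2 ^ m

theorem goodConst_nonneg (d r : ℕ) (A m : ℝ) {C τ : ℝ} (hC : 0 < C) (hτ : 0 < τ) :
    0 ≤ goodConst d r A m C τ := by
  have hoffDiag := offDiagConst_pos d (m := m) hC hτ
  have hθ := sub_pos.mpr (two_rpow_neg_half_lt_one hτ)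
  unfold goodConst upperConst
  positivity

variable {δ : EuclideanSpace ℝ (Fin d) → ℝ} {m C τ : ℝ}
  {k : EuclideanSpace ℝ (Fin d) → EuclideanSpace ℝ (Fin d) → 𝕜}

theorem norm_bilin_gridMatrix_le_of_isGoodFunction (hk : IsSuppressibleKernel μ δ m C τ k)
    (hG : IsGrid μ R η M pos) {a : Fin d → ℕ} (ha : ∀ i, a i < 2 ^ M) {r : ℕ}
    (hr : 2 * d ≤ 2 ^ (r / 2)) (hT : IsCZOperator μ k T) (hA : T1Condition μ A T)
    (hA' : T1Condition μ A (ContinuousLinearMap.adjoint T)) {f g : P → 𝕜}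
    (hf : IsGoodFunction (gridWeight μ R η pos) (cellIdx pos a) (IsGoodCell r M pos a) f)
    (hg : IsGoodFunction (gridWeight μ R η pos) (cellIdx pos a) (IsGoodCell r M pos a) g) :
    ‖bilin (gridMatrix R η pos T) f g‖ ≤ goodConst d r A m C τ *
      (√(normSq (gridWeight μ R η pos) f) * √(normSq (gridWeight μ R η pos) g)) := by
  have hcell : ∀ p, MeasurableSet (gridCell R η (pos p)) :=
    fun p => measurableSet_gridCell R η (pos p)
  set bT : Matrix P P 𝕜 := gridMatrix R η pos T
  set bL : Matrix P P 𝕜 :=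
    cellIntegral μ (fun p => gridCell R η (pos p)) (localKernel μ.support δ k)
  have local_le : ∀ f g : P → 𝕜, ‖bilin bL f g‖ ≤ 2 ^ m *
      (√(normSq (gridWeight μ R η pos) f) * √(normSq (gridWeight μ R η pos) g)) :=
    hk.norm_bilin_cellIntegral_localKernel_le hcell hG.pairwise_disjoint
  have local_transpose_le : ∀ f g : P → 𝕜, ‖bilin bL.transpose f g‖ ≤ 2 ^ m *
      (√(normSq (gridWeight μ R η pos) f) * √(normSq (gridWeight μ R η pos) g)) := fun f g => by
    rw [bilin_transpose, mul_comm √(normSq _ f)]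
    exact local_le g f
  have testing : ∀ n, CellTesting (gridWeight μ R η pos) (cellIdx pos a n) (bT - bL)
      (√|A| + 2 ^ m) := fun n => (hG.cellTesting hA a n).sub (.of_norm_bilin_le local_le _)
  have testing_transpose : ∀ n, CellTesting (gridWeight μ R η pos) (cellIdx pos a n)
      (bT - bL).transpose (√|A| + 2 ^ m) := fun n =>
    (hG.cellTesting_transpose hA' a n).sub (.of_norm_bilin_le local_transpose_le _)
  have represents : RepresentsOffDiag μ (fun p => gridCell R η (pos p)) k bT :=
    fun p q s hs hpq => hT.inner_setLp (hcell p) (hcell q) hs hpq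
  have far := represents.sub_localKernel hk hcell
  have far_le := norm_bilin_le_of_isUpperT1Form
    (hk.isUpperT1Form hG ha hr far (by positivity) testing testing_transpose)
    (hk.swap.isUpperT1Form hG ha hr (far.transpose hk hcell) (by positivity) testing_transpose
      testing)
    (cellIdx_zero_injective hG.injective a) (N := M + 1)
    (fun p q => by rw [cellIdx_eq_zero hG.pos_lt ha le_rfl, cellIdx_eq_zero hG.pos_lt ha le_rfl])
    hf hg
  calc ‖bilin bT f g‖ = ‖bilin (bT - bL) f g + bilin bL f g‖ := by rw [bilin_sub, sub_add_cancel]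
    _ ≤ _ := norm_add_le _ _
    _ ≤ _ := add_le_add far_le (local_le f g)
    _ = _ := by rw [goodConst, ← add_mul]

end GridOperator

section Absorption

theorem sqrt_normSq_sub_le {P 𝕜 : Type*} [Fintype P] [RCLike 𝕜] {w : P → ℝ} (hw : ∀ p, 0 < w p)
    (f g : P → 𝕜) : √(normSq w (f - g)) ≤ √(normSq w f) + √(normSq w g) := by
  have norm_eq : ∀ h : P → 𝕜,
      √(normSq w h) = ‖WithLp.toLp 2 fun p => ((√(w p) : ℝ) : 𝕜) * h p‖ := fun h => by
    rw [EuclideanSpace.norm_eq, normSq]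
    simp only [norm_mul, mul_pow, RCLike.norm_ofReal, sq_abs, Real.sq_sqrt (hw _).le]
  rw [norm_eq, norm_eq, norm_eq]
  refine le_of_eq_of_le (congrArg norm ?_) (norm_sub_le _ _)
  ext p
  exact mul_sub _ _ _

theorem norm_bilin_le_add_half {P 𝕜 : Type*} [Fintype P] [RCLike 𝕜] {w : P → ℝ}
    (hw : ∀ p, 0 < w p) {b : Matrix P P 𝕜} {N U : ℝ} (hN : 0 ≤ N) (hU : 0 ≤ U)
    (hb : ∀ f g : P → 𝕜, ‖bilin b f g‖ ≤ N * (√(normSq w f) * √(normSq w g))) {f g f' g' : P → 𝕜}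
    (hf : √(normSq w f') ≤ 1 / 8 * √(normSq w f)) (hg : √(normSq w g') ≤ 1 / 8 * √(normSq w g))
    (hgood : ‖bilin b (f - f') (g - g')‖ ≤ U * (√(normSq w (f - f')) * √(normSq w (g - g')))) :
    ‖bilin b f g‖ ≤ (2 * U + N / 2) * (√(normSq w f) * √(normSq w g)) := by
  have hf' : √(normSq w (f - f')) ≤ 9 / 8 * √(normSq w f) := by
    linarith [sqrt_normSq_sub_le hw f f']
  have hg' : √(normSq w (g - g')) ≤ 9 / 8 * √(normSq w g) := by
    linarith [sqrt_normSq_sub_le hw g g']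
  have good_good : ‖bilin b (f - f') (g - g')‖ ≤
      U * ((9 / 8 * √(normSq w f)) * (9 / 8 * √(normSq w g))) := hgood.trans (by gcongr)
  have good_bad : ‖bilin b (f - f') g'‖ ≤
      N * ((9 / 8 * √(normSq w f)) * (1 / 8 * √(normSq w g))) := (hb _ _).trans (by gcongr)
  have bad_all : ‖bilin b f' g‖ ≤ N * ((1 / 8 * √(normSq w f)) * √(normSq w g)) :=
    (hb _ _).trans (by gcongr)
  have hsplit : bilin b f g =
      bilin b (f - f') (g - g') + bilin b (f - f') g' + bilin b f' g := by
    simp only [map_sub, LinearMap.sub_apply]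
    ring
  have hU' : 0 ≤ U * (√(normSq w f) * √(normSq w g)) := by positivity
  have hN' : 0 ≤ N * (√(normSq w f) * √(normSq w g)) := by positivity
  rw [hsplit]
  refine norm_add₃_le.trans ?_
  linarith

theorem opNorm_le_of_forall_exists_norm_inner_le {𝕜 F G : Type*} [RCLike 𝕜]
    [NormedAddCommGroup F] [InnerProductSpace 𝕜 F] [NormedAddCommGroup G] [InnerProductSpace 𝕜 G]
    (T : F →L[𝕜] G) {c : ℝ} (hc : 0 ≤ c)
    (h : ∀ ε > 0, ∀ (f : F) (g : G), ∃ f' g', ‖f - f'‖ ≤ ε ∧ ‖g - g'‖ ≤ ε ∧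
      ‖inner 𝕜 g' (T f')‖ ≤ c * (‖f'‖ * ‖g'‖)) : ‖T‖ ≤ c := by
  have hclosed : IsClosed {z : F × G | ‖inner 𝕜 z.2 (T z.1)‖ ≤ c * (‖z.1‖ * ‖z.2‖)} :=
    isClosed_le (by fun_prop) (by fun_prop)
  have hdense : Dense {z : F × G | ‖inner 𝕜 z.2 (T z.1)‖ ≤ c * (‖z.1‖ * ‖z.2‖)} := by
    refine fun z => Metric.mem_closure_iff.mpr fun ε hε => ?_
    obtain ⟨f', g', hf, hg, hfg⟩ := h (ε / 2) (by positivity) z.1 z.2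
    refine ⟨(f', g'), hfg, ?_⟩
    rw [Prod.dist_eq, dist_eq_norm, dist_eq_norm]
    exact max_lt (by linarith) (by linarith)
  have hall : ∀ (f : F) (g : G), ‖inner 𝕜 g (T f)‖ ≤ c * (‖f‖ * ‖g‖) := fun f g =>
    hclosed.closure_subset (hdense (f, g))
  refine T.opNorm_le_of_re_inner_le hc fun f g hf hg => (RCLike.re_le_norm _).trans ?_
  rw [norm_inner_symm]
  simpa only [hf, hg, mul_one] using hall f g

variable {d : ℕ} {𝕜 : Type*} [RCLike 𝕜] {μ : Measure (EuclideanSpace ℝ (Fin d))}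
  {δ : EuclideanSpace ℝ (Fin d) → ℝ} {m C τ : ℝ}
  {k : EuclideanSpace ℝ (Fin d) → EuclideanSpace ℝ (Fin d) → 𝕜} {A : ℝ}
  {T : Lp 𝕜 2 μ →L[𝕜] Lp 𝕜 2 μ} {r : ℕ}

theorem norm_bilin_gridMatrix_le_add_half [IsFiniteMeasure μ] {P : Type*} [Fintype P] {R η : ℝ}
    {M : ℕ} {pos : P → Fin d → ℕ} (hk : IsSuppressibleKernel μ δ m C τ k)
    (hG : IsGrid μ R η M pos) (hr : 2 * d ≤ 2 ^ (r / 2)) (hbad : badProb d r ≤ 1 / 128)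
    (hT : IsCZOperator μ k T) (hA : T1Condition μ A T)
    (hA' : T1Condition μ A (ContinuousLinearMap.adjoint T)) (f g : P → 𝕜) :
    ‖bilin (gridMatrix R η pos T) f g‖ ≤ (2 * goodConst d r A m C τ + ‖T‖ / 2) *
      (√(normSq (gridWeight μ R η pos) f) * √(normSq (gridWeight μ R η pos) g)) := by
  have hw := hG.weight_pos
  have hbd := norm_bilin_opMatrix_le (fun p => measurableSet_gridCell R η (pos p))
    hG.pairwise_disjoint T
  by_cases hfg : 0 < normSq (gridWeight μ R η pos) f ∧ 0 < normSq (gridWeight μ R η pos) g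
  · obtain ⟨a, ha⟩ := exists_shift_normSq_badPart_le hw hG.injective r M (M + 1) hfg.1 hfg.2
    have ha_lt : ∀ i, shiftVal a i < 2 ^ M := fun i => ZMod.val_lt _
    have hN : ∀ p q, cellIdx pos (shiftVal a) (M + 1) p = cellIdx pos (shiftVal a) (M + 1) q :=
      fun p q => by rw [cellIdx_eq_zero hG.pos_lt ha_lt le_rfl,
        cellIdx_eq_zero hG.pos_lt ha_lt le_rfl]
    have isGood := isGoodFunction_sub_badPart (𝕜 := 𝕜) hw (nestedCells_cellIdx pos (shiftVal a))
      (isGoodCell_factorsThrough r M pos (shiftVal a)) hN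
    have bad_le : ∀ h ∈ ({f, g} : Set (P → 𝕜)), √(normSq (gridWeight μ R η pos)
        (badPart (gridWeight μ R η pos) (cellIdx pos (shiftVal a))
          (IsGoodCell r M pos (shiftVal a)) (M + 1) h)) ≤
        1 / 8 * √(normSq (gridWeight μ R η pos) h) := fun h hh => by
      refine Real.sqrt_le_iff.mpr ⟨by positivity, (ha h hh).trans ?_⟩
      rw [mul_pow, Real.sq_sqrt (normSq_nonneg hw h)]
      nlinarith [normSq_nonneg hw h]
    exact norm_bilin_le_add_half hw (norm_nonneg T) (goodConst_nonneg d r A m hk.C_pos hk.τ_pos)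
      hbd (bad_le f (by simp)) (bad_le g (by simp))
      (norm_bilin_gridMatrix_le_of_isGoodFunction hk hG ha_lt hr hT hA hA' (isGood f) (isGood g))
  · have hzero : √(normSq (gridWeight μ R η pos) f) * √(normSq (gridWeight μ R η pos) g) = 0 := by
      rcases not_and_or.mp hfg with h | h
      · rw [Real.sqrt_eq_zero_of_nonpos (not_lt.mp h), zero_mul]
      · rw [Real.sqrt_eq_zero_of_nonpos (not_lt.mp h), mul_zero]
    simpa only [hzero, mul_zero] using hbd f g

theorem exists_isGrid [IsFiniteMeasure μ] (hcpt : IsCompact μ.support) {ρ : ℝ} (hρ : 0 < ρ) :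
    ∃ (P : Type) (_ : Fintype P) (R η : ℝ) (M : ℕ) (pos : P → Fin d → ℕ),
      IsGrid μ R η M pos ∧ d * η < ρ := by
  obtain ⟨R₀, hR₀⟩ := hcpt.isBounded.subset_ball 0
  obtain ⟨R, hR, hR'⟩ : ∃ R : ℝ, 0 < R ∧ μ.support ⊆ ball 0 R :=
    ⟨max R₀ 1, by positivity, hR₀.trans (ball_subset_ball (le_max_left _ _))⟩
  obtain ⟨M, hM⟩ : ∃ M : ℕ, d * (2 * R) / ρ < 2 ^ M := pow_unbounded_of_one_lt _ one_lt_two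
  have hη : 0 < 2 * R / 2 ^ M := by positivity
  refine ⟨{z : Fin d → Fin (2 ^ M) // 0 < μ.real (gridCell R (2 * R / 2 ^ M) fun i => (z i : ℕ))},
    Fintype.ofFinite _, R, 2 * R / 2 ^ M, M, fun p i => p.1 i,
    ⟨hη, fun p q h => Subtype.ext (funext fun i => Fin.ext (congrFun h i)),
      fun p i => (p.1 i).isLt, fun p => p.2,
      ae_exists_mem_gridCell hη (div_mul_cancel₀ _ (by positivity)) hR'⟩, ?_⟩
  rwa [← mul_div_assoc, div_lt_iff₀ (by positivity), mul_comm ρ, ← div_lt_iff₀ hρ]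

theorem IsSuppressibleKernel.opNorm_le [IsProbabilityMeasure μ]
    (hk : IsSuppressibleKernel μ δ m C τ k) (hcpt : IsCompact μ.support)
    (hr : 2 * d ≤ 2 ^ (r / 2)) (hbad : badProb d r ≤ 1 / 128) (hT : IsCZOperator μ k T)
    (hA : T1Condition μ A T) (hA' : T1Condition μ A (ContinuousLinearMap.adjoint T)) :
    ‖T‖ ≤ 4 * goodConst d r A m C τ := by
  suffices h : ‖T‖ ≤ 2 * goodConst d r A m C τ + ‖T‖ / 2 by linarith
  have hconst := goodConst_nonneg d r A m hk.C_pos hk.τ_pos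
  refine opNorm_le_of_forall_exists_norm_inner_le T (by positivity) fun ε hε F G => ?_
  obtain ⟨ρ, hρ, hF⟩ := exists_norm_sub_stepLp_le F hε
  obtain ⟨ρ', hρ', hG⟩ := exists_norm_sub_stepLp_le G hε
  obtain ⟨P, _, R, η, M, pos, hgrid, hη⟩ := exists_isGrid hcpt (lt_min hρ hρ')
  have hcell : ∀ p, MeasurableSet (gridCell R η (pos p)) :=
    fun p => measurableSet_gridCell R η (pos p)
  have hne : ∀ p, (gridCell R η (pos p)).Nonempty := fun p =>
    nonempty_of_measureReal_ne_zero (hgrid.weight_pos p).ne'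
  have hdiam : ∀ p, ∀ x ∈ gridCell R η (pos p), ∀ y ∈ gridCell R η (pos p),
      dist x y < min ρ ρ' := fun p x hx y hy =>
    (dist_le_of_cellIdx_eq hgrid.side_pos (a := 0) (n := 0) hx hy rfl).trans_lt
      (by rwa [pow_zero, mul_one])
  obtain ⟨f, hf⟩ := hF P _ hcell hgrid.pairwise_disjoint hgrid.ae_cover hne
    fun p x hx y hy => (hdiam p x hx y hy).trans_le (min_le_left _ _)
  obtain ⟨g, hg⟩ := hG P _ hcell hgrid.pairwise_disjoint hgrid.ae_cover hne
    fun p x hx y hy => (hdiam p x hx y hy).trans_le (min_le_right _ _)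
  refine ⟨_, _, hf, hg, ?_⟩
  have h := norm_bilin_gridMatrix_le_add_half hk hgrid hr hbad hT hA hA' f (star g)
  rwa [← inner_stepLp_stepLp, star_star, normSq_star, ← norm_stepLp hcell hgrid.pairwise_disjoint,
    ← norm_stepLp hcell hgrid.pairwise_disjoint] at h

end Absorption

section Scale

variable {d : ℕ} {𝕜 : Type*} [RCLike 𝕜] {μ : Measure (EuclideanSpace ℝ (Fin d))}
  [IsProbabilityMeasure μ] {X H : Set (EuclideanSpace ℝ (Fin d))} {m C τ : ℝ}
  {k : EuclideanSpace ℝ (Fin d) → EuclideanSpace ℝ (Fin d) → 𝕜}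

theorem HasBergmanBound.infDist_rpow_mul_norm_le (hB : HasBergmanBound X H m k)
    {x y z : EuclideanSpace ℝ (Fin d)} (hx : x ∈ X) (hy : y ∈ X) (hz : z = x ∨ z = y) :
    infDist z Hᶜ ^ m * ‖k x y‖ ≤ 1 := by
  have hmax : infEDist z Hᶜ ^ m ≤ max (infEDist x Hᶜ ^ m) (infEDist y Hᶜ ^ m) := by
    rcases hz with rfl | rfl
    · exact le_max_left _ _
    · exact le_max_right _ _
  have hmul : ‖k x y‖ₑ * infEDist z Hᶜ ^ m ≤ 1 :=
    ENNReal.mul_le_of_le_div ((hB x hx y hy).trans (ENNReal.div_le_div_left hmax 1))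
  have hreal := ENNReal.toReal_mono ENNReal.one_ne_top hmul
  rwa [ENNReal.toReal_mul, toReal_enorm, ← ENNReal.toReal_rpow, ENNReal.toReal_one, mul_comm]
    at hreal

theorem HasBergmanBound.eq_zero_of_compl_eq_empty (hB : HasBergmanBound X H m k) (hm : 0 < m)
    (hH : Hᶜ = ∅) {x y : EuclideanSpace ℝ (Fin d)} (hx : x ∈ X) (hy : y ∈ X) : k x y = 0 := by
  have h := hB x hx y hy
  rwa [hH, infEDist_empty, infEDist_empty, ENNReal.top_rpow_of_pos hm, max_self, ENNReal.div_top,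
    nonpos_iff_eq_zero, enorm_eq_zero] at h

omit [IsProbabilityMeasure μ] in
theorem IsCZKernel.isSuppressibleKernel (hk : IsCZKernel X m C τ k) (hX : μ.support ⊆ X)
    {δ : EuclideanSpace ℝ (Fin d) → ℝ} (hm : 0 < m) (hC : 0 < C) (hτ : 0 < τ) (hτ1 : τ ≤ 1)
    (hnonneg : ∀ x, 0 ≤ δ x) (hlip : ∀ x y, δ x ≤ δ y + dist x y)
    (hbound : ∀ x ∈ X, ∀ y ∈ X, ∀ z, z = x ∨ z = y → δ z ^ m * ‖k x y‖ ≤ 1)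
    (hgrowth : ∀ x r, δ x < r → μ (ball x r) ≤ ENNReal.ofReal (r ^ m)) :
    IsSuppressibleKernel μ δ m C τ k := by
  have hscaled : IsScaledKernel μ.support δ m C τ k :=
    ⟨hnonneg, hlip, fun x hx y hy => hk.size x (hX hx) y (hX hy),
      fun x hx x' hx' y hy => hk.smooth x (hX hx) x' (hX hx') y (hX hy),
      fun x hx y hy => hbound x (hX hx) y (hX hy) x (.inl rfl)⟩
  exact ⟨hscaled, hscaled.swap fun x hx y hy => hbound x (hX hx) y (hX hy) y (.inr rfl), hgrowth,
    hC, hm, hτ, hτ1⟩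

theorem exists_isSuppressibleKernel (hm : 0 < m) (hC : 0 < C) (hτ : 0 < τ) (hτ1 : τ ≤ 1)
    (hX : μ.support ⊆ X) (hk : IsCZKernel X m C τ k) (hH : NonAhlforsBallsIn μ m H)
    (hB : HasBergmanBound X H m k) :
    ∃ δ : EuclideanSpace ℝ (Fin d) → ℝ, IsSuppressibleKernel μ δ m C τ k := by
  rcases Hᶜ.eq_empty_or_nonempty with hempty | hne
  · refine ⟨fun _ => 1, hk.isSuppressibleKernel hX hm hC hτ hτ1 (fun _ => zero_le_one)
      (fun _ _ => le_add_of_nonneg_right dist_nonneg) (fun x hx y hy _ _ => ?_) fun x r hr => ?_⟩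
    · rw [hB.eq_zero_of_compl_eq_empty hm hempty hx hy, norm_zero, mul_zero]
      exact zero_le_one
    · exact prob_le_one.trans (ENNReal.one_le_ofReal.mpr (Real.one_le_rpow hr.le hm.le))
  · refine ⟨fun x => infDist x Hᶜ, hk.isSuppressibleKernel hX hm hC hτ hτ1
      (fun _ => infDist_nonneg) (fun _ _ => infDist_le_infDist_add_dist)
      (fun x hx y hy z hz => hB.infDist_rpow_mul_norm_le hx hy hz) fun x r hr => ?_⟩
    by_contra! hball
    obtain ⟨y, hy, hxy⟩ := (infDist_lt_iff hne).mp hr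
    exact hy (hH x r (infDist_nonneg.trans_lt hr) hball (mem_ball'.mpr hxy))

end Scale

theorem exists_two_mul_le_and_badProb_le (d : ℕ) {ε : ℝ} (hε : 0 < ε) :
    ∃ r : ℕ, 2 * d ≤ 2 ^ (r / 2) ∧ badProb d r ≤ ε := by
  have hbad := (tendsto_badProb d).eventually_le_const hε
  obtain ⟨r, hr, hrd⟩ := (hbad.and (Filter.eventually_ge_atTop (4 * d))).exists
  refine ⟨r, ?_, hr⟩
  calc 2 * d ≤ 2 ^ (2 * d) := Nat.lt_two_pow_self.le
    _ ≤ 2 ^ (r / 2) := Nat.pow_le_pow_right two_pos (by lia)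

theorem theorem1_general {𝕜 : Type*} [RCLike 𝕜] (d : ℕ) {m C_CZ τ : ℝ} (hm : 0 < m)
    (hCZ : 0 < C_CZ) (hτ : 0 < τ) (hτ1 : τ ≤ 1) (A : ℝ) :
    ∃ C : ℝ, ∀ (X H : Set (EuclideanSpace ℝ (Fin d)))
      (k : EuclideanSpace ℝ (Fin d) → EuclideanSpace ℝ (Fin d) → 𝕜)
      (μ : Measure (EuclideanSpace ℝ (Fin d))) [IsProbabilityMeasure μ]
      (T : Lp 𝕜 2 μ →L[𝕜] Lp 𝕜 2 μ),
      IsCZKernel X m C_CZ τ k → IsCompact μ.support → μ.support ⊆ X → NonAhlforsBallsIn μ m H →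
      HasBergmanBound X H m k → IsCZOperator μ k T →
      T1Condition μ A T → T1Condition μ A (ContinuousLinearMap.adjoint T) → ‖T‖ ≤ C := by
  obtain ⟨r, hr, hbad⟩ := exists_two_mul_le_and_badProb_le d (ε := 1 / 128) (by norm_num)
  refine ⟨4 * goodConst d r A m C_CZ τ, ?_⟩
  intro X H k μ _ T hk hcpt hX hH hB hT hA hA'
  obtain ⟨δ, hδ⟩ := exists_isSuppressibleKernel hm hCZ hτ hτ1 hX hk hH hB
  exact hδ.opNorm_le hcpt hr hbad hT hA hA'

/-- The constant `C` depends only on `A`, `m`, `d` and the Calderón–Zygmund constants. The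
Hilbert space adjoint of `T` has kernel `conj k(y,x)`; it maps the real function `χ_Q` to the
complex conjugate of the image of `χ_Q` under the operator `T*` with kernel `k(y,x)`, so the
testing condition on the adjoint is the one on `T*`. -/
theorem theorem1 {𝕜 : Type*} [RCLike 𝕜] (d : ℕ) (m : ℝ) (hm : 0 < m) (hmd : m ≤ d)
    (C_CZ τ : ℝ) (hCZ : 0 < C_CZ) (hτ : 0 < τ) (hτ1 : τ ≤ 1) (A : ℝ) :
    ∃ C : ℝ, ∀ (X H : Set (EuclideanSpace ℝ (Fin d)))
      (k : EuclideanSpace ℝ (Fin d) → EuclideanSpace ℝ (Fin d) → 𝕜)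
      (μ : Measure (EuclideanSpace ℝ (Fin d))) [IsProbabilityMeasure μ]
      (T : Lp 𝕜 2 μ →L[𝕜] Lp 𝕜 2 μ),
      IsCZKernel X m C_CZ τ k →
      IsCompact μ.support → μ.support ⊆ X →
      IsOpen H → NonAhlforsBallsIn μ m H →
      HasBergmanBound X H m k →
      IsCZOperator μ k T →
      T1Condition μ A T → T1Condition μ A (ContinuousLinearMap.adjoint T) →
      ‖T‖ ≤ C := by
  obtain ⟨C, hC⟩ := theorem1_general (𝕜 := 𝕜) d hm hCZ hτ hτ1 A
  exact ⟨C, fun X H k μ _ T hk hcpt hX _ hH => hC X H k μ T hk hcpt hX hH⟩
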